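/- **Theorem.** Let $n\ge 1$ and $\lambda_1,\dots,\lambda_n>0$. Let $H_{n+1}=\mathbb C^n\times\mathbb R$, with points $x=(z,x_{2n+1})$, $z_j=x_{2j-1}+ix_{2j}$, be the Heisenberg group with CR structure spanned by $Z_j=\partial_{z_j}-i\lambda_j\overline z_j\,\partial_{x_{2n+1}}$ ($1\le j\le n$), a Hermitian metric for which $Z_j,\overline Z_j$ ($1\le j\le n$) and $-\partial_{x_{2n+1}}$ are orthonormal, and volume form $d\mu_{H_{n+1}}=2^n dx_1\cdots dx_{2n+1}$; put $d\mu=2^n dx_1\cdots dx_{2n}$ on $\mathbb C^n$. Let $\overline\partial_b$ be the maximal (distributional) extension to $L^2$ of the tangential Cauchy–Riemann operator, let $\Box_b^{(0)}=\overline\partial_b^*\overline\partial_b$ be the (Gaffney extension of the) Kohn Laplacian on functions, and let $S^{(0)}$ (Szegő projection) be the orthogonal projection of $L^2(H_{n+1})$ onto $\operatorname{Ker}\Box_b^{(0)}$. Let $\psi(z)=\sum_j\lambda_j|z_j|^2$. For $t\in\mathbb R$ let $H^0_{t\psi}(\mathbb C^n)$ be the space of holomorphic functions $f$ on $\mathbb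 C^n$ with $\int|f|^2e^{-2t\psi}\,d\mu<\infty$, let $(s_{t,j})_j$ be any orthonormal basis of it, and let $$P_{t\psi}(z,w)=e^{-t(\psi(z)+\psi(w))}\sum_j s_{t,j}(z)\overline{s_{t,j}(w)}$$ be the weighted Bergman kernel. Fix $\chi\in C_0^\infty(\mathbb R)$ with $\chi=1$ on $[-1,1]$ and $\chi=0$ outside $[-2,2]$. For $u\in L^2(H_{n+1})$ let $\check u$ and $\hat u$ be the limits in $L^2(H_{n+1})$, as $k\to\infty$, of $\frac1{2\pi}\int_{\mathbb R} u(z,s)\chi(s/k)e^{is\eta}\,ds$ and $\int_{\mathbb R} u(z,s)\chi(s/k)e^{-is\eta}\,ds$, respectively, and let $\tilde P u=\hat v$, where $v(z,t)=\int_{\mathbb C^n}P_{t\psi}(z,w)\,\check u(w,t)\,d\mu(w)$. Then $\tilde P$ is well defined on all of $L^2(H_{n+1})$ (the integrals defining $v$ converge absolutely for almost every $(z,t)$, $v\in L^2(H_{n+1})$, and the limits exist), and $$\tilde P=S^{(0)} .$$ Moreover $S^{(0)}$ has a distribution kernel $S^{(0)}(x,y)$ on $H_{n+1}\times H_{n+1}$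 (with respect to $d\mu_{H_{n+1}}$) that is given by the oscillatory integral $$S^{(0)}(x,y)=\frac1{2\pi}\int_{\mathbb R}e^{-it(x_{2n+1}-y_{2n+1})}P_{t\psi}(z,w)\,dt,\qquad x=(z,x_{2n+1}),\ y=(w,y_{2n+1}),$$ meaning that it is the limit, in the sense of distributions, as $\varepsilon\to0^+$, of $\frac1{2\pi}\int_{\mathbb R}\chi(\varepsilon t)e^{-it(x_{2n+1}-y_{2n+1})}P_{t\psi}(z,w)\,dt$. -/

import Mathlib

open MeasureTheory Filter Topology
open scoped ContDiff Distributions ENNReal NNReal InnerProductSpace ComplexConjugate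

noncomputable section

namespace Heisenberg

/-- Complex `n`-space. Only its topology, its smooth structure and its Lebesgue measure are used. -/
abbrev Cn (n : ℕ) : Type := Fin n → ℂ

/-- The measure `dμ(z) = 2ⁿ dx₁ ⋯ dx₂ₙ` on `ℂⁿ`. -/
def muC (n : ℕ) : Measure (Cn n) := ((2 : ℝ≥0) ^ n) • (volume : Measure (Cn n))

instance (n : ℕ) : SigmaFinite (muC n) := by unfold muC; infer_instance

instance (n : ℕ) : IsFiniteMeasureOnCompacts (muC n) := by unfold muC; infer_instance

/-- The Heisenberg group `ℂⁿ × ℝ`, with points `x = (z, x_{2n+1})`. -/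
abbrev H (n : ℕ) : Type := Cn n × ℝ

/-- The volume form `2ⁿ dx₁ ⋯ dx₂ₙ₊₁`, induced by the Hermitian metric for which the `Z_j`, their
conjugates and `T` form an orthonormal frame. -/
def muH (n : ℕ) : Measure (H n) := (muC n).prod volume

instance (n : ℕ) : SigmaFinite (muH n) := by unfold muH; infer_instance

instance (n : ℕ) : IsFiniteMeasureOnCompacts (muH n) := by unfold muH; infer_instance

/-- `L²` functions on the Heisenberg group. -/
abbrev L2 (n : ℕ) : Type := Lp ℂ 2 (muH n)

/-- `L²` forms of type `(0,1)`: the form `∑ f_j dz̄_j` is the tuple of its coefficients; the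
`dz̄_j` are pointwise orthonormal. -/
abbrev L2Form (n : ℕ) : Type := PiLp 2 (fun _ : Fin n => L2 n)

/-! ### The tangential Cauchy–Riemann operator and the Kohn Laplacian on functions -/

/-- The vector field `∂/∂z̄_j + i λ_j z_j ∂/∂x_{2n+1}` (the conjugate of `Z_j`) acting on `φ`, where
`∂/∂z̄_j = ½ (∂/∂x_{2j-1} + i ∂/∂x_{2j})` and `z_j = x_{2j-1} + i x_{2j}`. -/
def Zbar {n : ℕ} (lam : Fin n → ℝ) (j : Fin n) (φ : H n → ℂ) (x : H n) : ℂ :=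
  (1 / 2 : ℂ) * (fderiv ℝ φ x (Pi.single j 1, 0) +
      Complex.I * fderiv ℝ φ x (Pi.single j Complex.I, 0)) +
    Complex.I * (lam j : ℂ) * x.1 j * fderiv ℝ φ x (0, 1)

/-- `∂̄_b u = f` in the sense of distributions, for `u ∈ L²` and an `L²` form `f = ∑ f_j dz̄_j`, that
is, `(∂/∂z̄_j + i λ_j z_j ∂/∂x_{2n+1}) u = f_j` weakly for all `j` (the formal transpose of this vector
field is its negative). This is the graph of the maximal extension of `∂̄_b` to `L²` functions. -/
def IsDbar {n : ℕ} (lam : Fin n → ℝ) (u : L2 n) (f : L2Form n) : Prop :=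
  ∀ (j : Fin n) (φ : H n → ℂ), ContDiff ℝ ∞ φ → HasCompactSupport φ →
    ∫ x, f j x * φ x ∂(muH n) = - ∫ x, u x * Zbar lam j φ x ∂(muH n)

/-- `∂̄_b^* f = h`: the graph of the Hilbert space adjoint of `∂̄_b`, from `(0,1)`-forms to
functions. -/
def IsDbarAdjoint {n : ℕ} (lam : Fin n → ℝ) (f : L2Form n) (h : L2 n) : Prop :=
  ∀ (u : L2 n) (g : L2Form n), IsDbar lam u g → ⟪g, f⟫_ℂ = ⟪u, h⟫_ℂ

/-- `□_b^{(0)} u = h`: the graph of the Gaffney extension of the Kohn Laplacian on functions. Thus `u`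
is in the domain iff `u ∈ Dom ∂̄_b` and `∂̄_b u ∈ Dom ∂̄_b^*`, and then
`□_b^{(0)} u = ∂̄_b^* ∂̄_b u` (on functions the summand `∂̄_b ∂̄_b^*` is zero). -/
def IsKohnLaplacian {n : ℕ} (lam : Fin n → ℝ) (u h : L2 n) : Prop :=
  ∃ f : L2Form n, IsDbar lam u f ∧ IsDbarAdjoint lam f h

theorem isKohnLaplacian_zero_iff {n : ℕ} (lam : Fin n → ℝ) (u : L2 n) :
    IsKohnLaplacian lam u 0 ↔ IsDbar lam u 0 := by
  constructor
  · rintro ⟨f, hf, hadj⟩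
    have h := hadj u f hf
    rw [inner_zero_right, inner_self_eq_zero] at h
    rwa [h] at hf
  · intro h
    exact ⟨0, h, fun v g _ => by simp⟩

theorem isDbar_zero_iff {n : ℕ} (lam : Fin n → ℝ) (u : L2 n) :
    IsDbar lam u 0 ↔ ∀ (j : Fin n) (φ : H n → ℂ), ContDiff ℝ ∞ φ → HasCompactSupport φ →
      ∫ x, u x * Zbar lam j φ x ∂(muH n) = 0 := by
  have h0 : ∀ (j : Fin n) (φ : H n → ℂ),
      ∫ x, ((0 : L2Form n) j) x * φ x ∂(muH n) = 0 := by
    intro j φ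
    have : (fun x => ((0 : L2Form n) j) x * φ x) =ᵐ[muH n] fun _ => 0 := by
      filter_upwards [Lp.coeFn_zero ℂ 2 (muH n)] with x hx
      have h : ((0 : L2Form n) j) x = 0 := hx
      rw [h, zero_mul]
    rw [integral_congr_ae this, integral_zero]
  simp only [IsDbar, h0, eq_comm (a := (0 : ℂ)), neg_eq_zero]

theorem memLp_Zbar {n : ℕ} (lam : Fin n → ℝ) (j : Fin n) {φ : H n → ℂ}
    (hφ : ContDiff ℝ ∞ φ) (hc : HasCompactSupport φ) : MemLp (Zbar lam j φ) 2 (muH n) := by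
  have hd : Continuous (fderiv ℝ φ) := hφ.continuous_fderiv (by simp)
  have hcont : Continuous (Zbar lam j φ) := by unfold Zbar; fun_prop
  refine hcont.memLp_of_hasCompactSupport ?_
  refine (hc.fderiv (𝕜 := ℝ)).mono ?_
  intro x hx
  rw [Function.mem_support] at hx ⊢
  intro h
  apply hx
  simp [Zbar, h]

theorem integral_mul_eq_inner {n : ℕ} {g : H n → ℂ} (hg : MemLp g 2 (muH n)) (u : L2 n) :
    ∫ x, u x * g x ∂(muH n) = ⟪(hg.star.toLp (star g) : L2 n), u⟫_ℂ := by
  rw [MeasureTheory.L2.inner_def]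
  refine integral_congr_ae ?_
  filter_upwards [hg.star.coeFn_toLp] with x hx
  rw [hx]
  simp [RCLike.inner_apply]

/-- The space `Ker □_b^{(0)}` of `L²` functions. -/
def kerKohn {n : ℕ} (lam : Fin n → ℝ) : Submodule ℂ (L2 n) where
  carrier := {u | IsKohnLaplacian lam u 0}
  zero_mem' := by
    simp only [Set.mem_ofPred_eq, isKohnLaplacian_zero_iff, isDbar_zero_iff]
    intro j φ hφ hc
    rw [integral_mul_eq_inner (memLp_Zbar lam j hφ hc), inner_zero_right]
  add_mem' := by
    intro u v hu hv
    simp only [Set.mem_ofPred_eq, isKohnLaplacian_zero_iff, isDbar_zero_iff] at hu hv ⊢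
    intro j φ hφ hc
    have h1 := hu j φ hφ hc
    have h2 := hv j φ hφ hc
    rw [integral_mul_eq_inner (memLp_Zbar lam j hφ hc)] at h1 h2 ⊢
    rw [inner_add_right, h1, h2, add_zero]
  smul_mem' := by
    intro c u hu
    simp only [Set.mem_ofPred_eq, isKohnLaplacian_zero_iff, isDbar_zero_iff] at hu ⊢
    intro j φ hφ hc
    have h1 := hu j φ hφ hc
    rw [integral_mul_eq_inner (memLp_Zbar lam j hφ hc)] at h1 ⊢
    rw [inner_smul_right, h1, mul_zero]

theorem isClosed_kerKohn {n : ℕ} (lam : Fin n → ℝ) : IsClosed (kerKohn lam : Set (L2 n)) := by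
  have : (kerKohn lam : Set (L2 n)) = ⋂ (j : Fin n), ⋂ (φ : H n → ℂ), ⋂ (hφ : ContDiff ℝ ∞ φ),
      ⋂ (hc : HasCompactSupport φ),
        {u : L2 n | ⟪((memLp_Zbar lam j hφ hc).star.toLp (star (Zbar lam j φ)) : L2 n), u⟫_ℂ = 0} := by
    ext u
    have hu : u ∈ (kerKohn lam : Set (L2 n)) ↔ IsKohnLaplacian lam u 0 := Iff.rfl
    rw [hu, isKohnLaplacian_zero_iff, isDbar_zero_iff]
    simp only [Set.mem_iInter, Set.mem_ofPred_eq]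
    refine forall_congr' fun j => forall_congr' fun φ => forall_congr' fun hφ =>
      forall_congr' fun hc => ?_
    rw [integral_mul_eq_inner (memLp_Zbar lam j hφ hc)]
  rw [this]
  refine isClosed_iInter fun j => isClosed_iInter fun φ => isClosed_iInter fun hφ =>
    isClosed_iInter fun hc => ?_
  exact isClosed_eq (by fun_prop) continuous_const

instance {n : ℕ} (lam : Fin n → ℝ) : CompleteSpace (kerKohn lam) :=
  (isClosed_kerKohn lam).completeSpace_coe

/-- The Szegő projection `S^{(0)}`: the orthogonal projection of `L²` onto `Ker □_b^{(0)}`. -/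
def szego {n : ℕ} (lam : Fin n → ℝ) : L2 n →L[ℂ] L2 n := (kerKohn lam).starProjection

/-! ### Weighted Bergman kernels on `ℂⁿ` -/

/-- The measure `e^{-2ψ} dμ` on `ℂⁿ`. -/
def weightedMeasure {n : ℕ} (ψ : Cn n → ℝ) : Measure (Cn n) :=
  (muC n).withDensity fun z => ENNReal.ofReal (Real.exp (-2 * ψ z))

/-- `H⁰_ψ(ℂⁿ)`: the entire holomorphic functions in `L²(ℂⁿ, e^{-2ψ} dμ)`. -/
def bergmanSpace {n : ℕ} (ψ : Cn n → ℝ) : Submodule ℂ (Lp ℂ 2 (weightedMeasure ψ)) where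
  carrier := {f | ∃ g : Cn n → ℂ, Differentiable ℂ g ∧ f =ᵐ[weightedMeasure ψ] g}
  zero_mem' := ⟨0, differentiable_const _, Lp.coeFn_zero _ _ _⟩
  add_mem' := by
    rintro f₁ f₂ ⟨g₁, d₁, h₁⟩ ⟨g₂, d₂, h₂⟩
    exact ⟨g₁ + g₂, d₁.add d₂, (Lp.coeFn_add f₁ f₂).trans (h₁.add h₂)⟩
  smul_mem' := by
    rintro c f ⟨g, d, h⟩
    exact ⟨c • g, d.const_smul c, (Lp.coeFn_smul c f).trans (h.const_smul c)⟩

/-- The (unique) holomorphic representative of an element of `H⁰_ψ(ℂⁿ)`. -/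
def holoRep {n : ℕ} {ψ : Cn n → ℝ} (f : bergmanSpace ψ) : Cn n → ℂ := Classical.choose f.2

/-- The Bergman kernel `P_ψ(z,w) = e^{-(ψ(z)+ψ(w))} ∑_j s_j(z) conj(s_j(w))`, computed from an
orthonormal basis `(s_j)` of `H⁰_ψ(ℂⁿ)`. -/
def bergmanKernel {n : ℕ} {ψ : Cn n → ℝ} {ι : Type*} (s : HilbertBasis ι ℂ (bergmanSpace ψ))
    (z w : Cn n) : ℂ :=
  (Real.exp (-(ψ z + ψ w)) : ℂ) * ∑' j, holoRep (s j) z * conj (holoRep (s j) w)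

/-- The weight `ψ(z) = ∑_j λ_j |z_j|²`. -/
def psi {n : ℕ} (lam : Fin n → ℝ) (z : Cn n) : ℝ := ∑ j, lam j * ‖z j‖ ^ 2

/-! ### Partial Fourier transforms and the operator `P̃` -/

/-- `χ ∈ C₀^∞(ℝ)` with `χ = 1` on `[-1,1]` and `χ = 0` outside `[-2,2]`. -/
def IsCutoff (χ : ℝ → ℝ) : Prop :=
  ContDiff ℝ ∞ χ ∧ (∀ θ, |θ| ≤ 1 → χ θ = 1) ∧ ∀ θ, 2 < |θ| → χ θ = 0

/-- `v = û`, the partial Fourier transform of `u ∈ L²` in the last variable: the `L²` limit of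
`∫ u(z,s) χ(s/k) e^{-isη} ds` as `k → ∞`. -/
def IsPartialFourier {n : ℕ} (χ : ℝ → ℝ) (u v : L2 n) : Prop :=
  Tendsto (fun k : ℕ => eLpNorm (fun x : H n =>
    (∫ s : ℝ, u (x.1, s) * (χ (s / k) : ℂ) * Complex.exp (-(Complex.I * s * x.2))) - v x)
      2 (muH n)) atTop (𝓝 0)

/-- `v = ǔ`, the partial inverse Fourier transform of `u ∈ L²` in the last variable: the `L²` limit of
`(1/2π) ∫ u(z,s) χ(s/k) e^{isη} ds` as `k → ∞`. -/
def IsPartialFourierInv {n : ℕ} (χ : ℝ → ℝ) (u v : L2 n) : Prop :=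
  Tendsto (fun k : ℕ => eLpNorm (fun x : H n =>
    (1 / (2 * Real.pi) : ℂ) *
      (∫ s : ℝ, u (x.1, s) * (χ (s / k) : ℂ) * Complex.exp (Complex.I * s * x.2)) - v x)
      2 (muH n)) atTop (𝓝 0)

/-- `v(z,t) = ∫ P_t(z,w) u(w,t) dμ(w)` for almost every `(z,t)`, with absolutely convergent
integrals. -/
def IsFiberwiseIntegral {n : ℕ} (P : ℝ → Cn n → Cn n → ℂ) (u v : L2 n) : Prop :=
  ∀ᵐ x ∂(muH n), Integrable (fun w => P x.2 x.1 w * u (w, x.2)) (muC n) ∧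
    v x = ∫ w, P x.2 x.1 w * u (w, x.2) ∂(muC n)

/-- `P̃ u = h`: the operator obtained by applying to `u` the partial inverse Fourier transform, then
for each `t` the integral operator on `ℂⁿ` with kernel `P_t`, then the partial Fourier transform. -/
def IsFourierConjugate {n : ℕ} (χ : ℝ → ℝ) (P : ℝ → Cn n → Cn n → ℂ) (u h : L2 n) : Prop :=
  ∃ a v : L2 n, IsPartialFourierInv χ u a ∧ IsFiberwiseIntegral P a v ∧ IsPartialFourier χ v h

/-! ### Distribution kernels -/

/-- The distribution `K` on the product is the distribution kernel (with respect to the volume form) of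
the operator `A`: `⟨K, v ⊗ u⟩ = ∫ (A u) v` for test functions `u`, `v`. (Distributions are complex
valued; by linearity it is enough to test with real functions.) -/
def IsDistributionKernel {n : ℕ} (A : L2 n →L[ℂ] L2 n)
    (K : 𝓓'((⊤ : TopologicalSpace.Opens (H n × H n)), ℂ)) : Prop :=
  ∀ (u v : 𝓓((⊤ : TopologicalSpace.Opens (H n)), ℝ)) (f : L2 n)
    (Φ : 𝓓((⊤ : TopologicalSpace.Opens (H n × H n)), ℝ)),
    (f =ᵐ[muH n] fun y => (u y : ℂ)) → (∀ x y, Φ (x, y) = v x * u y) →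
    K Φ = ∫ x, A f x * (v x : ℂ) ∂(muH n)

/-- The truncated kernel `(1/2π) ∫ χ(εt) e^{-it(x_{2n+1} - y_{2n+1})} P_t(z,w) dt`, with
`x = (z, x_{2n+1})` and `y = (w, y_{2n+1})`. -/
def truncatedKernel {n : ℕ} (χ : ℝ → ℝ) (P : ℝ → Cn n → Cn n → ℂ) (ε : ℝ) (x y : H n) : ℂ :=
  (1 / (2 * Real.pi) : ℂ) * ∫ t : ℝ, (χ (ε * t) : ℂ) *
    Complex.exp (-(Complex.I * t * (x.2 - y.2))) * P t x.1 y.1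

/-- `K(x,y) = (1/2π) ∫ e^{-it(x_{2n+1} - y_{2n+1})} P_t(z,w) dt` as an oscillatory integral: `K` is the
limit, in the sense of distributions, of the truncated kernels as `ε → 0+`. -/
def IsOscillatoryIntegral {n : ℕ} (χ : ℝ → ℝ) (P : ℝ → Cn n → Cn n → ℂ)
    (K : 𝓓'((⊤ : TopologicalSpace.Opens (H n × H n)), ℂ)) : Prop :=
  ∀ Φ : 𝓓((⊤ : TopologicalSpace.Opens (H n × H n)), ℝ),
    Tendsto (fun ε : ℝ => ∫ p : H n × H n,
      truncatedKernel χ P ε p.1 p.2 * (Φ p : ℂ) ∂((muH n).prod (muH n))) (𝓝[>] 0) (𝓝 (K Φ))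

end Heisenberg

end

noncomputable section

namespace Heisenberg

/-! ### Plancherel's theorem for one-variable Fourier integrals. -/

section Plancherel

/-! The partial transform `∫ u(z,s) e^{ist} ds` replaces `∂/∂s` by `-it`, so it turns the `j`-th
component of the tangential Cauchy–Riemann operator into `∂/∂z̄_j + t λ_j z_j = e^{-tψ} ∘ ∂/∂z̄_j ∘
e^{tψ}`. Hence `u` lies in the kernel of the Kohn Laplacian exactly when, for almost every `t`, the
fiber `ǔ(·,t)` is `e^{-tψ}` times an entire function in `H⁰_{tψ}`. The orthogonal projection of
`L²(ℂⁿ)` onto such functions has kernel `P_{tψ}`, so projecting each fiber and transforming back is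
the Szegő projection.

The fibers are explicit. For `t > 0` the space is a Bargmann–Fock space with a Gaussian kernel; for
`t ≤ 0` it is zero because `n ≥ 1`. `bergmanKernel_eq_modelKernel` records both cases and removes
the choice of basis. The Gaussian kernel has row and column integrals at most `2 ^ n` for every `t`,
so Schur's test makes the fiberwise operator bounded on `L²` of the whole group.

The identity with the projection has two halves. The range lies in the kernel
(`mem_kerKohn_of_isFiberwiseIntegral`) since the columns of `P_{tψ}` times `e^{-its}` are smooth CR
functions, to which integration by parts applies. Conversely the transform of a CR function is fixed
by the fiber projections: its fibers are weakly holomorphic up to the weight (`ae_weak_dbar`), hence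
entire by Weyl's lemma (`exists_entire_of_weak_dbar`), hence reproduced
(`integral_modelKernel_mul`). Adjointness of the two transforms, Fourier inversion and symmetry of
the kernel then make `u - P̃u` orthogonal to the kernel of the Laplacian.

For the distribution kernel, the truncated integrals are paired with a test function and Fubini is
applied. The frequency components are bounded in `L¹` on compact sets uniformly in `t`, and two
integrations by parts in `x_{2n+1}` produce a factor `(1 + t²)⁻¹`. So the pairing is integrable in
`t` and the cutoff disappears by dominated convergence. On elementary tensors the resulting integral
over `t` is the pairing of `P̃u` with `v`. -/

open FourierTransform in
theorem eLpNorm_fourier_eq {f : ℝ → ℂ} (h1 : Integrable f) (h2 : MemLp f 2) :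
    eLpNorm (𝓕 f) 2 volume = eLpNorm f 2 volume := by
  set F : Lp ℂ 2 (volume : Measure ℝ) := h2.toLp f with hF
  have hcont : Continuous (𝓕 f) :=
    VectorFourier.fourierIntegral_continuous Real.continuous_fourierChar
      (by fun_prop) h1
  -- The `L²` transform, known through its action on tempered distributions, is identified with the
  -- Fourier integral by testing on smooth compactly supported functions. On both sides the
  -- transform can be moved to the test function.
  have key : (𝓕 F : Lp ℂ 2 (volume : Measure ℝ)) =ᵐ[volume] 𝓕 f := by
    have hloc : LocallyIntegrable (fun x => (𝓕 F : Lp ℂ 2 (volume : Measure ℝ)) x - 𝓕 f x) := by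
      refine LocallyIntegrable.sub ?_ hcont.locallyIntegrable
      exact (Lp.memLp _).locallyIntegrable (by norm_num)
    have := ae_eq_zero_of_integral_contDiff_smul_eq_zero hloc ?_
    · filter_upwards [this] with x hx using sub_eq_zero.1 hx
    intro g hg hgc
    have hg₁ : HasCompactSupport (Complex.ofRealCLM ∘ g) := hgc.comp_left rfl
    have hg₂ : ContDiff ℝ ∞ (Complex.ofRealCLM ∘ g) := by fun_prop
    set G : SchwartzMap ℝ ℂ := hg₁.toSchwartzMap hg₂ with hG
    have hGa : ∀ x, G x = (g x : ℂ) := fun x => by simp [hG]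
    have e1 := congrArg (fun T => T G) (Lp.fourier_toTemperedDistribution_eq F)
    simp only [TemperedDistribution.fourier_apply, Lp.toTemperedDistribution_apply] at e1
    have e2 : ∫ x, (𝓕 G) x • F x = ∫ x, (𝓕 G) x • f x := by
      refine integral_congr_ae ?_
      filter_upwards [h2.coeFn_toLp] with x hx
      rw [hx]
    have e3 : ∫ x, (𝓕 G) x • f x = ∫ x, G x • 𝓕 f x := by
      have := VectorFourier.integral_fourierIntegral_smul_eq_flip (L := innerₗ ℝ)
        (μ := volume) (ν := volume) Real.continuous_fourierChar
        (by fun_prop) G.integrable h1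
      simpa [SchwartzMap.fourier_coe] using! this
    have i1 : Integrable (fun x => g x • (𝓕 F : Lp ℂ 2 (volume : Measure ℝ)) x) := by
      refine ((Lp.memLp (𝓕 F)).locallyIntegrable (by norm_num)).integrable_smul_left_of_hasCompactSupport
        hg.continuous hgc
    have i2 : Integrable (fun x => g x • 𝓕 f x) :=
      hcont.locallyIntegrable.integrable_smul_left_of_hasCompactSupport hg.continuous hgc
    simp only [smul_sub]
    rw [integral_sub i1 i2, sub_eq_zero]
    have e4 := e1.symm.trans (e2.trans e3)
    simpa [hGa] using e4
  have hn := Lp.norm_fourier_eq F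
  have h3 : eLpNorm (𝓕 F : Lp ℂ 2 (volume : Measure ℝ)) 2 volume = eLpNorm F 2 volume := by
    rw [Lp.norm_def, Lp.norm_def] at hn
    exact (ENNReal.toReal_eq_toReal_iff' (Lp.eLpNorm_ne_top _) (Lp.eLpNorm_ne_top _)).1 hn
  rw [← eLpNorm_congr_ae key, h3, eLpNorm_congr_ae h2.coeFn_toLp]

theorem lintegral_enorm_sq_eq {α : Type*} [MeasurableSpace α] {μ : Measure α} {E : Type*}
    [NormedAddCommGroup E] (f : α → E) :
    ∫⁻ x, ‖f x‖ₑ ^ 2 ∂μ = eLpNorm f 2 μ ^ 2 := by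
  have := eLpNorm_nnreal_pow_eq_lintegral (f := f) (μ := μ) (p := 2) (by norm_num)
  simpa using this.symm

/-- Plancherel for `f ∈ L¹ ∩ L²` with the kernel `exp (i σ s η)`, `σ = ±1`. -/
theorem lintegral_fourier_sq {f : ℝ → ℂ} (h1 : Integrable f) (h2 : MemLp f 2) {σ : ℝ}
    (hσ : |σ| = 1) :
    ∫⁻ η : ℝ, ‖∫ s : ℝ, f s * Complex.exp ((σ * s * η : ℝ) * Complex.I)‖ₑ ^ 2 =
      ENNReal.ofReal (2 * Real.pi) * ∫⁻ s, ‖f s‖ₑ ^ 2 := by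
  have hpi := Real.pi_pos
  have ha : -σ / (2 * Real.pi) ≠ 0 := by
    have : σ ≠ 0 := fun h => by simp [h] at hσ
    exact div_ne_zero (neg_ne_zero.2 this) (by positivity)
  have habs : |-σ / (2 * Real.pi)| = (2 * Real.pi)⁻¹ := by
    rw [abs_div, abs_neg, hσ, abs_of_pos (by positivity), one_div]
  -- The normalised transform has kernel `e^{-2πi s ξ}`, so `e^{iσsη}` is its value at `ξ = -σ η /
  -- (2π)`. The Jacobian of this dilation is the source of the factor `2π`.
  have e1 : ∀ η : ℝ, ∫ s : ℝ, f s * Complex.exp ((σ * s * η : ℝ) * Complex.I) =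
      FourierTransform.fourier f (-σ / (2 * Real.pi) * η) := by
    intro η
    rw [Real.fourier_eq']
    refine integral_congr_ae (ae_of_all _ fun s => ?_)
    simp only [smul_eq_mul]
    rw [mul_comm]
    congr 3
    simp only [RCLike.inner_apply, conj_trivial]
    rw [Complex.ofReal_inj]
    field_simp
  simp_rw [e1]
  have e2 : ∫⁻ η : ℝ, ‖FourierTransform.fourier f η‖ₑ ^ 2 =
      ENNReal.ofReal (2 * Real.pi)⁻¹ *
        ∫⁻ η : ℝ, ‖FourierTransform.fourier f (-σ / (2 * Real.pi) * η)‖ₑ ^ 2 := by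
    conv_lhs => rw [← Real.smul_map_volume_mul_left ha]
    rw [lintegral_smul_measure, habs,
      (measurableEmbedding_mulLeft₀ ha).lintegral_map]
    rfl
  rw [lintegral_enorm_sq_eq, eLpNorm_fourier_eq h1 h2, ← lintegral_enorm_sq_eq] at e2
  rw [e2, ← mul_assoc, ← ENNReal.ofReal_mul (by positivity), mul_inv_cancel₀ (by positivity)]
  simp

end Plancherel

/-! ### Partial Fourier integrals and truncation in the last variable. -/

section PartialFourier

set_option linter.unusedSectionVars false

variable {X : Type*} [MeasurableSpace X] {μ : Measure X} [SFinite μ]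

/-- The partial Fourier integral `∫ w(x,s) e^{iσsη} ds` in the last variable. -/
def partialFourier (σ : ℝ) (w : X × ℝ → ℂ) (p : X × ℝ) : ℂ :=
  ∫ s : ℝ, w (p.1, s) * Complex.exp ((σ * s * p.2 : ℝ) * Complex.I)

theorem norm_mul_cexp_ofReal_mul_I (z : ℂ) (r : ℝ) : ‖z * Complex.exp (r * Complex.I)‖ = ‖z‖ := by
  rw [norm_mul, Complex.norm_exp_ofReal_mul_I, mul_one]

theorem stronglyMeasurable_partialFourier (σ : ℝ) {w : X × ℝ → ℂ} (hw : StronglyMeasurable w) :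
    StronglyMeasurable (partialFourier σ w) := by
  refine StronglyMeasurable.integral_prod_right'
    (f := fun q : (X × ℝ) × ℝ => w (q.1.1, q.2) * Complex.exp ((σ * q.2 * q.1.2 : ℝ) * Complex.I)) ?_
  refine (hw.comp_measurable (by fun_prop)).mul ?_
  exact Measurable.stronglyMeasurable (by fun_prop)

/-- Fourier integrals of truncated `L²` functions converge absolutely on almost every slice for this
reason. -/
theorem integrable_of_memLp_two_of_bounded_support {f : ℝ → ℂ} (hf : MemLp f 2) {R : ℝ}
    (hR : ∀ s, R < |s| → f s = 0) : Integrable f := by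
  have h : IntegrableOn f (Set.Icc (-R) R) :=
    (hf.restrict (Set.Icc (-R) R)).integrable (by norm_num)
  refine (integrableOn_iff_integrable_of_support_subset ?_).1 h
  intro s hs
  by_contra hc
  refine hs (hR s ?_)
  by_contra h'
  exact hc (by simpa [abs_le] using not_lt.1 h')

theorem ae_memLp_slice {w : X × ℝ → ℂ} (hw : StronglyMeasurable w)
    (h2 : ∫⁻ p, ‖w p‖ₑ ^ 2 ∂(μ.prod volume) ≠ ⊤) :
    ∀ᵐ x ∂μ, MemLp (fun s => w (x, s)) 2 := by
  have hm : Measurable fun p => ‖w p‖ₑ ^ 2 := hw.enorm.pow_const 2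
  rw [lintegral_prod _ hm.aemeasurable] at h2
  filter_upwards [ae_lt_top hm.lintegral_prod_right' h2] with x hx
  refine ⟨(hw.comp_measurable (by fun_prop)).aestronglyMeasurable, ?_⟩
  rw [lintegral_enorm_sq_eq] at hx
  by_contra hc
  rw [not_lt, top_le_iff] at hc
  simp [hc] at hx

theorem lintegral_partialFourier_sq {w : X × ℝ → ℂ} (hw : StronglyMeasurable w)
    (h2 : ∫⁻ p, ‖w p‖ₑ ^ 2 ∂(μ.prod volume) ≠ ⊤) {R : ℝ} (hR : ∀ x s, R < |s| → w (x, s) = 0)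
    {σ : ℝ} (hσ : |σ| = 1) :
    ∫⁻ p, ‖partialFourier σ w p‖ₑ ^ 2 ∂(μ.prod volume) =
      ENNReal.ofReal (2 * Real.pi) * ∫⁻ p, ‖w p‖ₑ ^ 2 ∂(μ.prod volume) := by
  rw [lintegral_prod _ ((stronglyMeasurable_partialFourier σ hw).enorm.pow_const 2).aemeasurable,
    lintegral_prod _ (hw.enorm.pow_const 2).aemeasurable, ← lintegral_const_mul]
  · refine lintegral_congr_ae ?_
    filter_upwards [ae_memLp_slice hw h2] with x hx
    exact lintegral_fourier_sq (integrable_of_memLp_two_of_bounded_support hx (hR x)) hx hσ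
  · exact (hw.enorm.pow_const 2).lintegral_prod_right'

theorem memLp_two_iff {α : Type*} [MeasurableSpace α] {ν : Measure α} {f : α → ℂ}
    (hf : AEStronglyMeasurable f ν) : MemLp f 2 ν ↔ ∫⁻ p, ‖f p‖ₑ ^ 2 ∂ν ≠ ⊤ := by
  rw [lintegral_enorm_sq_eq]
  constructor
  · intro h
    exact ENNReal.pow_ne_top h.2.ne
  · intro h
    refine ⟨hf, lt_top_iff_ne_top.2 fun h' => h ?_⟩
    simp [h']

theorem memLp_partialFourier {w : X × ℝ → ℂ} (hw : StronglyMeasurable w)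
    (h2 : MemLp w 2 (μ.prod volume)) {R : ℝ} (hR : ∀ x s, R < |s| → w (x, s) = 0)
    {σ : ℝ} (hσ : |σ| = 1) : MemLp (partialFourier σ w) 2 (μ.prod volume) := by
  rw [memLp_two_iff h2.1] at h2
  rw [memLp_two_iff (stronglyMeasurable_partialFourier σ hw).aestronglyMeasurable,
    lintegral_partialFourier_sq hw h2 hR hσ]
  exact ENNReal.mul_ne_top ENNReal.ofReal_ne_top h2

theorem eLpNorm_partialFourier {w : X × ℝ → ℂ} (hw : StronglyMeasurable w)
    (h2 : MemLp w 2 (μ.prod volume)) {R : ℝ} (hR : ∀ x s, R < |s| → w (x, s) = 0)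
    {σ : ℝ} (hσ : |σ| = 1) :
    eLpNorm (partialFourier σ w) 2 (μ.prod volume) =
      ENNReal.ofReal (Real.sqrt (2 * Real.pi)) * eLpNorm w 2 (μ.prod volume) := by
  rw [memLp_two_iff h2.1] at h2
  have h := lintegral_partialFourier_sq hw h2 hR hσ
  rw [lintegral_enorm_sq_eq, lintegral_enorm_sq_eq,
    ← Real.sq_sqrt (show 0 ≤ 2 * Real.pi by positivity),
    ENNReal.ofReal_pow (Real.sqrt_nonneg _), ← mul_pow] at h
  exact (ENNReal.pow_right_strictMono (n := 2) (by norm_num)).injective h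

/-- Linearity of the partial Fourier integral, almost everywhere. -/
theorem partialFourier_sub_ae {w₁ w₂ : X × ℝ → ℂ} (hw₁ : StronglyMeasurable w₁)
    (hw₂ : StronglyMeasurable w₂)
    (h₁ : MemLp w₁ 2 (μ.prod volume)) (h₂ : MemLp w₂ 2 (μ.prod volume)) {R₁ R₂ : ℝ}
    (hR₁ : ∀ x s, R₁ < |s| → w₁ (x, s) = 0) (hR₂ : ∀ x s, R₂ < |s| → w₂ (x, s) = 0) (σ : ℝ) :
    partialFourier σ (w₁ - w₂) =ᵐ[μ.prod volume] partialFourier σ w₁ - partialFourier σ w₂ := by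
  have a₁ := ae_memLp_slice hw₁ ((memLp_two_iff h₁.1).1 h₁)
  have a₂ := ae_memLp_slice hw₂ ((memLp_two_iff h₂.1).1 h₂)
  have key : ∀ (w : X × ℝ → ℂ) (x : X) (η : ℝ), Integrable (fun s => w (x, s)) →
      Integrable fun s => w (x, s) * Complex.exp ((σ * s * η : ℝ) * Complex.I) := by
    intro w x η h
    refine h.mono (h.1.mul (Continuous.aestronglyMeasurable (by fun_prop))) ?_
    exact ae_of_all _ fun s => (norm_mul_cexp_ofReal_mul_I _ _).le
  have := (Measure.quasiMeasurePreserving_fst (μ := μ) (ν := (volume : Measure ℝ))).ae (a₁.and a₂)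
  filter_upwards [this] with p hp
  have i₁ := integrable_of_memLp_two_of_bounded_support hp.1 (hR₁ p.1)
  have i₂ := integrable_of_memLp_two_of_bounded_support hp.2 (hR₂ p.1)
  simp only [partialFourier, Pi.sub_apply, sub_mul]
  exact integral_sub (key _ _ _ i₁) (key _ _ _ i₂)

/-- The truncation `u(x,s) χ(s/k)`. -/
def truncate (χ : ℝ → ℝ) (k : ℕ) (u : X × ℝ → ℂ) (p : X × ℝ) : ℂ := u p * (χ (p.2 / k) : ℂ)

theorem IsCutoff.exists_bound {χ : ℝ → ℝ} (hχ : IsCutoff χ) : ∃ C : ℝ, 0 ≤ C ∧ ∀ θ, |χ θ| ≤ C := by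
  have hc : HasCompactSupport χ := by
    refine HasCompactSupport.intro (isCompact_Icc (a := (-2 : ℝ)) (b := 2)) fun x hx => hχ.2.2 x ?_
    by_contra h
    exact hx (by simpa [abs_le] using not_lt.1 h)
  obtain ⟨C, hC⟩ := hχ.1.continuous.bounded_above_of_compact_support hc
  exact ⟨C, (norm_nonneg _).trans (hC 0), fun θ => hC θ⟩

theorem IsCutoff.tendsto {χ : ℝ → ℝ} (hχ : IsCutoff χ) (s : ℝ) :
    ∀ᶠ k : ℕ in atTop, χ (s / k) = 1 := by
  -- The `+ 1` keeps `k` positive when `s = 0`.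
  filter_upwards [eventually_ge_atTop (⌈|s|⌉₊ + 1)] with k hk
  have hk' : |s| ≤ k := (Nat.le_ceil _).trans (by exact_mod_cast (by omega : ⌈|s|⌉₊ ≤ k))
  have h0 : (0 : ℝ) < k := by exact_mod_cast (by omega : 0 < k)
  refine hχ.2.1 _ ?_
  rw [abs_div, abs_of_pos h0, div_le_one h0]
  exact hk'

/-- At `k = 0` the quotient `s / 0` is `0` and `χ 0 = 1`, so nothing is truncated. Positivity of `k`
is therefore needed, and the sequences below are indexed by `k + 1`. -/
theorem truncate_eq_zero {χ : ℝ → ℝ} (hχ : IsCutoff χ) {k : ℕ} (hk : 0 < k) (u : X × ℝ → ℂ) :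
    ∀ x s, 2 * (k : ℝ) < |s| → truncate χ k u (x, s) = 0 := by
  intro x s hs
  have h0 : (0 : ℝ) < k := by exact_mod_cast hk
  have : χ (s / k) = 0 := by
    refine hχ.2.2 _ ?_
    rw [abs_div, abs_of_pos h0, lt_div_iff₀ h0]
    exact hs
  simp [truncate, this]

theorem stronglyMeasurable_truncate {χ : ℝ → ℝ} (hχ : Continuous χ) (k : ℕ) {u : X × ℝ → ℂ}
    (hu : StronglyMeasurable u) : StronglyMeasurable (truncate χ k u) :=
  hu.mul (Measurable.stronglyMeasurable
    (Complex.continuous_ofReal.comp hχ |>.measurable.comp (by fun_prop)))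

theorem memLp_truncate {χ : ℝ → ℝ} (hχ : Continuous χ) {C : ℝ} (hC : ∀ θ, |χ θ| ≤ C) (k : ℕ)
    {u : X × ℝ → ℂ} (hu : StronglyMeasurable u) (h2 : MemLp u 2 (μ.prod volume)) :
    MemLp (truncate χ k u) 2 (μ.prod volume) := by
  refine h2.of_le_mul (c := C) (stronglyMeasurable_truncate hχ k hu).aestronglyMeasurable ?_
  refine ae_of_all _ fun p => ?_
  rw [truncate, norm_mul, mul_comm, Complex.norm_real]
  exact mul_le_mul_of_nonneg_right (hC _) (norm_nonneg _)

/-- Dominated convergence for the squares, with majorant `((C + 1) |u|)²`; at each point the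
difference is eventually exactly zero. -/
theorem tendsto_truncate {χ : ℝ → ℝ} (hχ : IsCutoff χ)
    {u : X × ℝ → ℂ} (hu : StronglyMeasurable u) (h2 : MemLp u 2 (μ.prod volume)) :
    Tendsto (fun k => eLpNorm (truncate χ k u - u) 2 (μ.prod volume)) atTop (𝓝 0) := by
  obtain ⟨C, hC0, hC⟩ := hχ.exists_bound
  have hmeas : ∀ k, StronglyMeasurable (truncate (X := X) χ k u) :=
    fun k => stronglyMeasurable_truncate hχ.1.continuous k hu
  have h : Tendsto (fun k => ∫⁻ p, ‖(truncate χ k u - u) p‖ₑ ^ 2 ∂(μ.prod volume)) atTop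
      (𝓝 (∫⁻ _ : X × ℝ, 0 ∂(μ.prod volume))) := by
    refine tendsto_lintegral_of_dominated_convergence
      (fun p => (ENNReal.ofReal (C + 1) * ‖u p‖ₑ) ^ 2)
      (fun k => ((hmeas k).sub hu).enorm.pow_const 2) ?_ ?_ ?_
    · intro k
      refine ae_of_all _ fun p => pow_le_pow_left' ?_ 2
      have : (truncate χ k u - u) p = ((χ (p.2 / k) - 1 : ℝ) : ℂ) * u p := by
        simp [truncate]; ring
      rw [this, enorm_mul]
      gcongr
      rw [← ofReal_norm, Complex.norm_real]
      refine ENNReal.ofReal_le_ofReal ((norm_sub_le _ _).trans ?_)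
      simpa using hC _
    · simp_rw [mul_pow]
      rw [lintegral_const_mul _ (hu.enorm.pow_const 2)]
      exact ENNReal.mul_ne_top (by finiteness) ((memLp_two_iff h2.1).1 h2)
    · refine ae_of_all _ fun p => ?_
      refine tendsto_const_nhds.congr' ?_
      filter_upwards [hχ.tendsto p.2] with k hk
      simp [truncate, hk]
  rw [lintegral_zero] at h
  have h' := h.ennrpow_const (1 / 2 : ℝ)
  rw [ENNReal.zero_rpow_of_pos (by norm_num)] at h'
  refine h'.congr fun k => ?_
  rw [lintegral_enorm_sq_eq, ← ENNReal.rpow_natCast, ← ENNReal.rpow_mul]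
  norm_num

end PartialFourier

/-! ### The partial Fourier transform on `L²`: existence, norm, adjoint, inversion. -/

section FourierL2

set_option linter.unusedSectionVars false

variable {X : Type*} [MeasurableSpace X] {μ : Measure X} [SFinite μ]

/-- `v` is the `L²` limit of the truncated partial Fourier integrals of `u`. -/
def HasPartialFourier (χ : ℝ → ℝ) (σ : ℝ) (u v : Lp ℂ 2 (μ.prod (volume : Measure ℝ))) : Prop :=
  Tendsto (fun k => eLpNorm (fun p => partialFourier σ (truncate χ k u) p - v p) 2
    (μ.prod volume)) atTop (𝓝 0)

/-- The truncations of an `L²` function, as a sequence in `L²`. -/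
def truncLp {χ : ℝ → ℝ} (hχ : IsCutoff χ) (u : Lp ℂ 2 (μ.prod (volume : Measure ℝ))) (k : ℕ) :
    Lp ℂ 2 (μ.prod (volume : Measure ℝ)) :=
  (memLp_truncate hχ.1.continuous hχ.exists_bound.choose_spec.2 (k + 1)
    (Lp.stronglyMeasurable u) (Lp.memLp u)).toLp _

theorem coeFn_truncLp {χ : ℝ → ℝ} (hχ : IsCutoff χ) (u : Lp ℂ 2 (μ.prod (volume : Measure ℝ)))
    (k : ℕ) : truncLp hχ u k =ᵐ[μ.prod volume] truncate χ (k + 1) u :=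
  MemLp.coeFn_toLp _

theorem tendsto_truncLp {χ : ℝ → ℝ} (hχ : IsCutoff χ) (u : Lp ℂ 2 (μ.prod (volume : Measure ℝ))) :
    Tendsto (truncLp hχ u) atTop (𝓝 u) := by
  rw [Lp.tendsto_Lp_iff_tendsto_eLpNorm']
  have h := (tendsto_truncate hχ (Lp.stronglyMeasurable u) (Lp.memLp u)).comp (tendsto_add_atTop_nat 1)
  refine h.congr fun k => eLpNorm_congr_ae ?_
  filter_upwards [coeFn_truncLp hχ u k] with p hp
  simp [hp]

theorem memLp_partialFourier_truncate {χ : ℝ → ℝ} (hχ : IsCutoff χ) {σ : ℝ} (hσ : |σ| = 1)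
    (u : Lp ℂ 2 (μ.prod (volume : Measure ℝ))) (k : ℕ) :
    MemLp (partialFourier σ (truncate χ (k + 1) u)) 2 (μ.prod volume) :=
  memLp_partialFourier (stronglyMeasurable_truncate hχ.1.continuous _ (Lp.stronglyMeasurable u))
    (memLp_truncate hχ.1.continuous hχ.exists_bound.choose_spec.2 (k + 1)
      (Lp.stronglyMeasurable u) (Lp.memLp u))
    (truncate_eq_zero hχ k.succ_pos u) hσ

/-- The truncated partial Fourier integrals of an `L²` function, as a sequence in `L²`. -/
def fourierLp {χ : ℝ → ℝ} (hχ : IsCutoff χ) {σ : ℝ} (hσ : |σ| = 1)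
    (u : Lp ℂ 2 (μ.prod (volume : Measure ℝ))) (k : ℕ) : Lp ℂ 2 (μ.prod (volume : Measure ℝ)) :=
  (memLp_partialFourier_truncate hχ hσ u k).toLp _

theorem coeFn_fourierLp {χ : ℝ → ℝ} (hχ : IsCutoff χ) {σ : ℝ} (hσ : |σ| = 1)
    (u : Lp ℂ 2 (μ.prod (volume : Measure ℝ))) (k : ℕ) :
    fourierLp hχ hσ u k =ᵐ[μ.prod volume] partialFourier σ (truncate χ (k + 1) u) :=
  MemLp.coeFn_toLp _

theorem norm_fourierLp {χ : ℝ → ℝ} (hχ : IsCutoff χ) {σ : ℝ} (hσ : |σ| = 1)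
    (u : Lp ℂ 2 (μ.prod (volume : Measure ℝ))) (k : ℕ) :
    ‖fourierLp hχ hσ u k‖ = Real.sqrt (2 * Real.pi) * ‖truncLp hχ u k‖ := by
  rw [Lp.norm_def, Lp.norm_def, eLpNorm_congr_ae (coeFn_fourierLp hχ hσ u k),
    eLpNorm_congr_ae (coeFn_truncLp hχ u k), eLpNorm_partialFourier
      (stronglyMeasurable_truncate hχ.1.continuous _ (Lp.stronglyMeasurable u))
      ((memLp_congr_ae (coeFn_truncLp hχ u k)).1 (Lp.memLp _))
      (truncate_eq_zero hχ k.succ_pos u) hσ, ENNReal.toReal_mul,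
    ENNReal.toReal_ofReal (Real.sqrt_nonneg _)]

/-- Plancherel applied to a difference of truncations: the Fourier integrals form a Cauchy sequence
because the truncations do. -/
theorem norm_fourierLp_sub {χ : ℝ → ℝ} (hχ : IsCutoff χ) {σ : ℝ} (hσ : |σ| = 1)
    (u : Lp ℂ 2 (μ.prod (volume : Measure ℝ))) (k l : ℕ) :
    ‖fourierLp hχ hσ u k - fourierLp hχ hσ u l‖ =
      Real.sqrt (2 * Real.pi) * ‖truncLp hχ u k - truncLp hχ u l‖ := by
  have hs : ∀ k, StronglyMeasurable (truncate χ (k + 1) u) := fun k =>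
    stronglyMeasurable_truncate hχ.1.continuous _ (Lp.stronglyMeasurable u)
  have hm : ∀ k, MemLp (truncate χ (k + 1) u) 2 (μ.prod volume) := fun k =>
    (memLp_congr_ae (coeFn_truncLp hχ u k)).1 (Lp.memLp _)
  have hz : ∀ k x s, 2 * ((k + 1 : ℕ) : ℝ) < |s| → truncate χ (k + 1) u (x, s) = 0 := fun k =>
    truncate_eq_zero hχ k.succ_pos u
  have e1 : (fourierLp hχ hσ u k - fourierLp hχ hσ u l : Lp ℂ 2 (μ.prod volume)) =ᵐ[μ.prod volume]
      partialFourier σ (truncate χ (k + 1) u - truncate χ (l + 1) u) := by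
    filter_upwards [Lp.coeFn_sub (fourierLp hχ hσ u k) (fourierLp hχ hσ u l),
      coeFn_fourierLp hχ hσ u k, coeFn_fourierLp hχ hσ u l,
      partialFourier_sub_ae (hs k) (hs l) (hm k) (hm l) (hz k) (hz l) σ] with p h1 h2 h3 h4
    rw [h1, h4, Pi.sub_apply, Pi.sub_apply, h2, h3]
  have e2 : (truncLp hχ u k - truncLp hχ u l : Lp ℂ 2 (μ.prod volume)) =ᵐ[μ.prod volume]
      truncate χ (k + 1) u - truncate χ (l + 1) u := by
    filter_upwards [Lp.coeFn_sub (truncLp hχ u k) (truncLp hχ u l),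
      coeFn_truncLp hχ u k, coeFn_truncLp hχ u l] with p h1 h2 h3
    rw [h1, Pi.sub_apply, Pi.sub_apply, h2, h3]
  rw [Lp.norm_def, Lp.norm_def, eLpNorm_congr_ae e1, eLpNorm_congr_ae e2,
    eLpNorm_partialFourier ((hs k).sub (hs l)) ((hm k).sub (hm l))
      (R := max (2 * ((k + 1 : ℕ) : ℝ)) (2 * ((l + 1 : ℕ) : ℝ))) ?_ hσ, ENNReal.toReal_mul,
    ENNReal.toReal_ofReal (Real.sqrt_nonneg _)]
  intro x s h
  rw [Pi.sub_apply, hz k x s ((le_max_left _ _).trans_lt h),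
    hz l x s ((le_max_right _ _).trans_lt h), sub_zero]

/-- Dropping the term `k = 0`, which need not be square integrable, does not affect the limit and
allows work in the complete space `Lp`. -/
theorem hasPartialFourier_iff {χ : ℝ → ℝ} (hχ : IsCutoff χ) {σ : ℝ} (hσ : |σ| = 1)
    {u v : Lp ℂ 2 (μ.prod (volume : Measure ℝ))} :
    HasPartialFourier χ σ u v ↔ Tendsto (fourierLp hχ hσ u) atTop (𝓝 v) := by
  rw [Lp.tendsto_Lp_iff_tendsto_eLpNorm', HasPartialFourier, ← tendsto_add_atTop_iff_nat 1]
  refine tendsto_congr fun k => eLpNorm_congr_ae ?_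
  filter_upwards [coeFn_fourierLp hχ hσ u k] with p hp
  simp [hp]

theorem exists_hasPartialFourier {χ : ℝ → ℝ} (hχ : IsCutoff χ) {σ : ℝ} (hσ : |σ| = 1)
    (u : Lp ℂ 2 (μ.prod (volume : Measure ℝ))) : ∃ v, HasPartialFourier χ σ u v := by
  simp_rw [hasPartialFourier_iff hχ hσ]
  refine cauchySeq_tendsto_of_complete ?_
  have hU := (tendsto_truncLp hχ u).cauchySeq
  rw [Metric.cauchySeq_iff] at hU ⊢
  intro ε hε
  have hpos : 0 < Real.sqrt (2 * Real.pi) := Real.sqrt_pos.2 (by positivity)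
  obtain ⟨N, hN⟩ := hU (ε / Real.sqrt (2 * Real.pi)) (by positivity)
  refine ⟨N, fun m hm k hk => ?_⟩
  have := hN m hm k hk
  rw [dist_eq_norm] at this ⊢
  rw [norm_fourierLp_sub, mul_comm]
  exact (lt_div_iff₀ hpos).1 this

theorem HasPartialFourier.unique {χ : ℝ → ℝ} (hχ : IsCutoff χ) {σ : ℝ} (hσ : |σ| = 1)
    {u v v' : Lp ℂ 2 (μ.prod (volume : Measure ℝ))} (h : HasPartialFourier χ σ u v)
    (h' : HasPartialFourier χ σ u v') : v = v' :=
  tendsto_nhds_unique ((hasPartialFourier_iff hχ hσ).1 h) ((hasPartialFourier_iff hχ hσ).1 h')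

theorem HasPartialFourier.norm_eq {χ : ℝ → ℝ} (hχ : IsCutoff χ) {σ : ℝ} (hσ : |σ| = 1)
    {u v : Lp ℂ 2 (μ.prod (volume : Measure ℝ))} (h : HasPartialFourier χ σ u v) :
    ‖v‖ = Real.sqrt (2 * Real.pi) * ‖u‖ := by
  refine tendsto_nhds_unique ((hasPartialFourier_iff hχ hσ).1 h).norm ?_
  simp_rw [norm_fourierLp]
  exact (tendsto_truncLp hχ u).norm.const_mul _

/-- The partial Fourier integral is symmetric on `L²` functions of bounded support in the last
variable. -/
theorem integral_partialFourier_mul {w₁ w₂ : X × ℝ → ℂ} (hw₁ : StronglyMeasurable w₁)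
    (hw₂ : StronglyMeasurable w₂)
    (h₁ : MemLp w₁ 2 (μ.prod volume)) (h₂ : MemLp w₂ 2 (μ.prod volume)) {R₁ R₂ : ℝ}
    (hR₁ : ∀ x s, R₁ < |s| → w₁ (x, s) = 0) (hR₂ : ∀ x s, R₂ < |s| → w₂ (x, s) = 0) {σ : ℝ}
    (hσ : |σ| = 1) :
    ∫ p, partialFourier σ w₁ p * w₂ p ∂(μ.prod volume) =
      ∫ p, w₁ p * partialFourier σ w₂ p ∂(μ.prod volume) := by
  have a₁ := ae_memLp_slice hw₁ ((memLp_two_iff h₁.1).1 h₁)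
  have a₂ := ae_memLp_slice hw₂ ((memLp_two_iff h₂.1).1 h₂)
  have f₁ := memLp_partialFourier hw₁ h₁ hR₁ hσ
  have f₂ := memLp_partialFourier hw₂ h₂ hR₂ hσ
  have j₁ : Integrable (fun p => partialFourier σ w₁ p * w₂ p) (μ.prod volume) :=
    f₁.integrable_mul h₂
  have j₂ : Integrable (fun p => w₁ p * partialFourier σ w₂ p) (μ.prod volume) :=
    h₁.integrable_mul f₂
  rw [integral_prod _ j₁, integral_prod _ j₂]
  refine integral_congr_ae ?_
  filter_upwards [a₁, a₂] with x b₁ b₂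
  have i₁ := integrable_of_memLp_two_of_bounded_support b₁ (hR₁ x)
  have i₂ := integrable_of_memLp_two_of_bounded_support b₂ (hR₂ x)
  simp only [partialFourier, ← integral_mul_const, ← integral_const_mul]
  rw [integral_integral_swap]
  · refine integral_congr_ae (ae_of_all _ fun s => integral_congr_ae (ae_of_all _ fun η => ?_))
    have : (σ * s * η : ℝ) = (σ * η * s : ℝ) := by ring
    simp only [this]
    ring
  · refine (i₂.mul_prod i₁).mono ?_ (ae_of_all _ fun q => ?_)
    · refine AEStronglyMeasurable.mul (AEStronglyMeasurable.mul ?_ ?_) ?_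
      · exact i₁.1.comp_snd
      · exact Continuous.aestronglyMeasurable (by fun_prop)
      · exact i₂.1.comp_fst
    · simp only [Function.uncurry, norm_mul, Complex.norm_exp_ofReal_mul_I, mul_one]
      rw [mul_comm]

theorem integral_fourierLp_mul {χ : ℝ → ℝ} (hχ : IsCutoff χ) {σ : ℝ} (hσ : |σ| = 1)
    (u u' : Lp ℂ 2 (μ.prod (volume : Measure ℝ))) (k : ℕ) :
    ∫ p, fourierLp hχ hσ u k p * truncLp hχ u' k p ∂(μ.prod volume) =
      ∫ p, truncLp hχ u k p * fourierLp hχ hσ u' k p ∂(μ.prod volume) := by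
  have hs : ∀ u : Lp ℂ 2 (μ.prod (volume : Measure ℝ)), StronglyMeasurable (truncate χ (k + 1) u) :=
    fun u => stronglyMeasurable_truncate hχ.1.continuous _ (Lp.stronglyMeasurable u)
  have hm : ∀ u : Lp ℂ 2 (μ.prod (volume : Measure ℝ)),
      MemLp (truncate χ (k + 1) u) 2 (μ.prod volume) := fun u =>
    (memLp_congr_ae (coeFn_truncLp hχ u k)).1 (Lp.memLp _)
  have hz : ∀ (u : Lp ℂ 2 (μ.prod (volume : Measure ℝ))) x s, 2 * ((k + 1 : ℕ) : ℝ) < |s| →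
      truncate χ (k + 1) u (x, s) = 0 := fun u => truncate_eq_zero hχ k.succ_pos u
  calc _ = ∫ p, partialFourier σ (truncate χ (k + 1) u) p * truncate χ (k + 1) u' p
        ∂(μ.prod volume) := by
        refine integral_congr_ae ?_
        filter_upwards [coeFn_fourierLp hχ hσ u k, coeFn_truncLp hχ u' k] with p h1 h2
        rw [h1, h2]
    _ = ∫ p, truncate χ (k + 1) u p * partialFourier σ (truncate χ (k + 1) u') p
        ∂(μ.prod volume) :=
      integral_partialFourier_mul (hs u) (hs u') (hm u) (hm u') (hz u) (hz u') hσ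
    _ = _ := by
        refine integral_congr_ae ?_
        filter_upwards [coeFn_fourierLp hχ hσ u' k, coeFn_truncLp hχ u k] with p h1 h2
        rw [h1, h2]

theorem integral_mul_eq_inner_star {α : Type*} [MeasurableSpace α] {ν : Measure α} (a b : Lp ℂ 2 ν) :
    ∫ p, a p * b p ∂ν = ⟪star a, b⟫_ℂ := by
  rw [MeasureTheory.L2.inner_def]
  refine integral_congr_ae ?_
  filter_upwards [Lp.coeFn_star a] with x hx
  rw [hx]
  simp [RCLike.inner_apply, mul_comm]

theorem tendsto_star_Lp {α : Type*} [MeasurableSpace α] {ν : Measure α}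
    {f : ℕ → Lp ℂ 2 ν} {f' : Lp ℂ 2 ν} (hf : Tendsto f atTop (𝓝 f')) :
    Tendsto (fun k => star (f k)) atTop (𝓝 (star f')) := by
  rw [Lp.tendsto_Lp_iff_tendsto_eLpNorm'] at hf ⊢
  refine hf.congr fun k => eLpNorm_congr_norm_ae ?_
  filter_upwards [Lp.coeFn_star (f k), Lp.coeFn_star f'] with x h1 h2
  rw [Pi.sub_apply, Pi.sub_apply, h1, h2, Pi.star_apply, Pi.star_apply, ← star_sub, norm_star]

theorem tendsto_integral_mul {α : Type*} [MeasurableSpace α] {ν : Measure α}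
    {f g : ℕ → Lp ℂ 2 ν} {f' g' : Lp ℂ 2 ν} (hf : Tendsto f atTop (𝓝 f'))
    (hg : Tendsto g atTop (𝓝 g')) :
    Tendsto (fun k => ∫ p, f k p * g k p ∂ν) atTop (𝓝 (∫ p, f' p * g' p ∂ν)) := by
  simp_rw [integral_mul_eq_inner_star]
  exact Tendsto.inner (tendsto_star_Lp hf) hg

/-- The partial Fourier transform is symmetric for the bilinear pairing. -/
theorem HasPartialFourier.integral_mul {χ : ℝ → ℝ} (hχ : IsCutoff χ) {σ : ℝ} (hσ : |σ| = 1)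
    {u u' v v' : Lp ℂ 2 (μ.prod (volume : Measure ℝ))} (h : HasPartialFourier χ σ u v)
    (h' : HasPartialFourier χ σ u' v') :
    ∫ p, v p * u' p ∂(μ.prod volume) = ∫ p, u p * v' p ∂(μ.prod volume) := by
  have t1 := tendsto_integral_mul ((hasPartialFourier_iff hχ hσ).1 h) (tendsto_truncLp hχ u')
  have t2 := tendsto_integral_mul (tendsto_truncLp hχ u) ((hasPartialFourier_iff hχ hσ).1 h')
  simp_rw [integral_fourierLp_mul] at t1
  exact tendsto_nhds_unique t1 t2

theorem partialFourier_conj (σ : ℝ) (w : X × ℝ → ℂ) (p : X × ℝ) :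
    partialFourier (-σ) (fun q => conj (w q)) p = conj (partialFourier σ w p) := by
  rw [partialFourier, partialFourier, ← integral_conj]
  congr 1 with s
  simp [← Complex.exp_conj]

/-- Conjugation reverses the sign of the frequency; this converts the bilinear symmetry of the
transform into an adjoint relation. -/
theorem HasPartialFourier.star {χ : ℝ → ℝ} {σ : ℝ}
    {u v : Lp ℂ 2 (μ.prod (volume : Measure ℝ))} (h : HasPartialFourier χ σ u v) :
    HasPartialFourier χ (-σ) (star u) (star v) := by
  refine Tendsto.congr (fun k => eLpNorm_congr_norm_ae ?_) h
  have hu : ∀ᵐ x ∂μ, ∀ᵐ s : ℝ, (Star.star u : Lp ℂ 2 (μ.prod (volume : Measure ℝ))) (x, s) =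
      conj (u (x, s)) := Measure.ae_ae_of_ae_prod (Lp.coeFn_star u)
  filter_upwards [Lp.coeFn_star v,
    (Measure.quasiMeasurePreserving_fst (μ := μ) (ν := (volume : Measure ℝ))).ae hu] with p h1 h2
  have : partialFourier (-σ) (truncate χ k (Star.star u : Lp ℂ 2 (μ.prod (volume : Measure ℝ)))) p =
      conj (partialFourier σ (truncate χ k u) p) := by
    rw [← partialFourier_conj]
    refine integral_congr_ae ?_
    filter_upwards [h2] with s hs
    simp [truncate, hs]
  rw [h1, this, Pi.star_apply, ← Complex.star_def, ← star_sub, norm_star]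

/-- The adjoint of the partial Fourier transform is the one with the opposite sign. -/
theorem HasPartialFourier.inner_eq {χ : ℝ → ℝ} (hχ : IsCutoff χ) {σ : ℝ} (hσ : |σ| = 1)
    {u u' v v' : Lp ℂ 2 (μ.prod (volume : Measure ℝ))} (h : HasPartialFourier χ σ u v)
    (h' : HasPartialFourier χ (-σ) u' v') : ⟪v, u'⟫_ℂ = ⟪u, v'⟫_ℂ := by
  have := h.star.integral_mul hχ (by rwa [abs_neg]) h'
  simpa only [integral_mul_eq_inner_star, star_star] using this

/-- Fourier inversion. -/
theorem HasPartialFourier.inversion {χ : ℝ → ℝ} (hχ : IsCutoff χ) {σ : ℝ} (hσ : |σ| = 1)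
    {u a w : Lp ℂ 2 (μ.prod (volume : Measure ℝ))}
    (h : HasPartialFourier χ σ u ((2 * Real.pi : ℂ) • a)) (h' : HasPartialFourier χ (-σ) a w) :
    w = u := by
  -- Inversion is obtained in norm, with no pointwise formula: Plancherel and the adjoint relation
  -- give `‖w‖² = ‖u‖² = Re ⟪w, u⟫ = 2π ‖a‖²`, whence `‖w - u‖² = 0`.
  have e1 := h.norm_eq hχ hσ
  have e2 := h'.norm_eq hχ (by rwa [abs_neg])
  have e3 := h'.inner_eq hχ (by rwa [abs_neg]) (by simpa using h)
  have hpi := Real.pi_pos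
  have hs : Real.sqrt (2 * Real.pi) ^ 2 = 2 * Real.pi := Real.sq_sqrt (by positivity)
  rw [norm_smul] at e1
  have hn : ‖(2 * Real.pi : ℂ)‖ = 2 * Real.pi := by
    simp [abs_of_pos hpi]
  rw [hn] at e1
  rw [inner_smul_right, inner_self_eq_norm_sq_to_K] at e3
  have e4 : RCLike.re ⟪w, u⟫_ℂ = 2 * Real.pi * ‖a‖ ^ 2 := by
    rw [e3]
    have : ((2 * Real.pi : ℂ) * ((‖a‖ : ℝ) : ℂ) ^ 2) = ((2 * Real.pi * ‖a‖ ^ 2 : ℝ) : ℂ) := by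
      push_cast; ring
    exact (congrArg Complex.re this).trans (Complex.ofReal_re _)
  have e5 : 2 * Real.pi * ‖a‖ ^ 2 = ‖u‖ ^ 2 := by
    have : (2 * Real.pi * ‖a‖) ^ 2 = 2 * Real.pi * ‖u‖ ^ 2 := by rw [e1, mul_pow, hs]
    have h2 : (2 * Real.pi) * (2 * Real.pi * ‖a‖ ^ 2) = (2 * Real.pi) * ‖u‖ ^ 2 := by
      rw [← this]; ring
    exact mul_left_cancel₀ (by positivity) h2
  have e6 : ‖w‖ ^ 2 = 2 * Real.pi * ‖a‖ ^ 2 := by rw [e2, mul_pow, hs]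
  have e7 : ‖w - u‖ ^ 2 = 0 := by
    rw [@norm_sub_sq ℂ, e4, e6, ← e5]; ring
  rw [← sub_eq_zero, ← norm_eq_zero]
  exact pow_eq_zero_iff (two_ne_zero) |>.1 e7

end FourierL2

/-! ### Rotation averages of entire functions and the Cauchy–Riemann equations. -/

section WeakDbar

variable {n : ℕ}

theorem measurePreserving_rotation (θ : ℝ) :
    MeasurePreserving (fun z : Cn n => Complex.exp (θ * Complex.I) • z) volume volume := by
  refine volume_preserving_pi (fun _ : Fin n => ?_)
    (f := fun _ : Fin n => fun w : ℂ => Complex.exp (θ * Complex.I) * w)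
  have := (rotation (Circle.exp θ)).measurePreserving
  convert! this using 2

/-- The mean value property of an entire function against a measure invariant under the diagonal
rotations. -/
theorem integral_mul_of_rotation_invariant {f : Cn n → ℂ} (hf : Differentiable ℂ f) {ρ : Cn n → ℂ}
    (hρ : Measurable ρ) (hinv : ∀ (θ : ℝ) z, ρ (Complex.exp (θ * Complex.I) • z) = ρ z)
    (hint : Integrable fun z => f z * ρ z) : ∫ z, f z * ρ z = f 0 * ∫ z, ρ z := by
  have hpi := Real.two_pi_pos
  have hslice : ∀ θ : ℝ, ∫ z, f (Complex.exp (θ * Complex.I) • z) * ρ z = ∫ z, f z * ρ z := by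
    intro θ
    have h := (measurePreserving_rotation (n := n) θ).integral_comp
      (Homeomorph.smulOfNeZero _ (Complex.exp_ne_zero _)).measurableEmbedding (fun z => f z * ρ z)
    rw [← h]
    simp only [hinv]
  have hsliceI : ∀ θ : ℝ, Integrable fun z => f (Complex.exp (θ * Complex.I) • z) * ρ z := by
    intro θ
    have h := (measurePreserving_rotation (n := n) θ).integrable_comp_of_integrable hint
    simpa only [Function.comp_def, hinv] using h
  have hslicen : ∀ θ : ℝ, ∫ z, ‖f (Complex.exp (θ * Complex.I) • z) * ρ z‖ = ∫ z, ‖f z * ρ z‖ := by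
    intro θ
    have h := (measurePreserving_rotation (n := n) θ).integral_comp
      (Homeomorph.smulOfNeZero _ (Complex.exp_ne_zero _)).measurableEmbedding (fun z => ‖f z * ρ z‖)
    rw [← h]
    simp only [hinv]
  have : IsFiniteMeasure ((volume : Measure ℝ).restrict (Set.uIoc 0 (2 * Real.pi))) := by
    rw [Set.uIoc_of_le hpi.le]; infer_instance
  have hI : Integrable (fun p : ℝ × Cn n => f (Complex.exp (p.1 * Complex.I) • p.2) * ρ p.2)
      ((volume.restrict (Set.uIoc 0 (2 * Real.pi))).prod volume) := by
    rw [integrable_prod_iff]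
    · refine ⟨ae_of_all _ hsliceI, ?_⟩
      simp only [hslicen]
      exact integrable_const _
    · refine AEStronglyMeasurable.mul ?_ ?_
      · exact (hf.continuous.comp (by fun_prop)).aestronglyMeasurable
      · exact (hρ.comp measurable_snd).aestronglyMeasurable
  -- One-variable mean value property of `ζ ↦ f (ζ • z)` on the unit circle; the value at the centre
  -- is `f 0` for every `z`.
  have hmean : ∀ z, ∫ θ in (0 : ℝ)..2 * Real.pi, f (Complex.exp (θ * Complex.I) • z) =
      (2 * Real.pi : ℝ) • f 0 := by
    intro z
    have hg : Differentiable ℂ fun ζ : ℂ => f (ζ • z) := hf.comp (by fun_prop)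
    have h := (hg.diffContOnCl (s := Metric.ball 0 |1|)).circleAverage
    rw [Real.circleAverage, inv_smul_eq_iff₀ hpi.ne'] at h
    simpa [circleMap] using h
  have hswap : ∫ θ in (0 : ℝ)..2 * Real.pi, ∫ z, f (Complex.exp (θ * Complex.I) • z) * ρ z =
      ∫ z, ∫ θ in (0 : ℝ)..2 * Real.pi, f (Complex.exp (θ * Complex.I) • z) * ρ z :=
    intervalIntegral_integral_swap hI
  simp only [hslice, intervalIntegral.integral_mul_const, hmean, intervalIntegral.integral_const,
    sub_zero] at hswap
  simp only [Complex.real_smul, mul_assoc, integral_const_mul] at hswap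
  exact mul_left_cancel₀ (by exact_mod_cast hpi.ne') hswap

/-- Twice the operator `∂/∂z̄_j` on functions on `ℂⁿ`. -/
def dbar (j : Fin n) (φ : Cn n → ℂ) (z : Cn n) : ℂ :=
  fderiv ℝ φ z (Pi.single j 1) + Complex.I * fderiv ℝ φ z (Pi.single j Complex.I)

/-- The equations say that the real derivative commutes with `i` on each coordinate axis, so it
equals the complex linear map `∑ ∂_j f dz_j`. -/
theorem differentiable_of_dbar_eq_zero {f : Cn n → ℂ} (hf : Differentiable ℝ f)
    (h : ∀ j z, dbar j f z = 0) : Differentiable ℂ f := by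
  intro z
  rw [differentiableAt_iff_restrictScalars ℝ (hf z)]
  refine ⟨∑ j, (ContinuousLinearMap.proj (R := ℂ) (φ := fun _ : Fin n => ℂ) j).smulRight
    (fderiv ℝ f z (Pi.single j 1)), ?_⟩
  ext v
  have hI : ∀ j, fderiv ℝ f z (Pi.single j Complex.I) =
      Complex.I * fderiv ℝ f z (Pi.single j 1) := by
    intro j
    have h0 := h j z
    rw [dbar] at h0
    have : Complex.I * (fderiv ℝ f z (Pi.single j 1) +
      Complex.I * fderiv ℝ f z (Pi.single j Complex.I)) = 0 := by rw [h0, mul_zero]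
    rw [mul_add, ← mul_assoc, Complex.I_mul_I] at this
    linear_combination -this
  have hv : v = ∑ j, (Pi.single j (v j) : Cn n) := (Finset.univ_sum_single v).symm
  conv_rhs => rw [hv, map_sum]
  simp only [ContinuousLinearMap.coe_restrictScalars', sum_apply,
    ContinuousLinearMap.smulRight_apply, ContinuousLinearMap.proj_apply, smul_eq_mul]
  refine Finset.sum_congr rfl fun j _ => ?_
  have : (Pi.single j (v j) : Cn n) =
      (v j).re • (Pi.single j 1 : Cn n) + (v j).im • (Pi.single j Complex.I : Cn n) := by
    ext i
    by_cases hij : i = j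
    · subst hij
      simp
    · simp [hij]
  rw [this, map_add, map_smul, map_smul, hI, Complex.real_smul, Complex.real_smul]
  nth_rewrite 1 [← Complex.re_add_im (v j)]
  ring

end WeakDbar

/-! ### Weyl's lemma by radial mollification. -/

section Weyl

variable {n : ℕ}

/-- `∑ |z_j|²`. -/
def normSqC (z : Cn n) : ℝ := ∑ j, ‖z j‖ ^ 2

theorem contDiff_normSqC : ContDiff ℝ ∞ (normSqC (n := n)) := by
  unfold normSqC
  refine ContDiff.sum fun j _ => ?_
  exact (contDiff_norm_sq ℝ (E := ℂ)).comp (contDiff_apply ℝ ℂ j)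

/-- The norm of `Cn n` is the supremum norm, which is not smooth. Mollifiers are built from the
Euclidean square, and this comparison controls their supports. -/
theorem norm_sq_le_normSqC (z : Cn n) : ‖z‖ ^ 2 ≤ normSqC z := by
  have h0 : 0 ≤ normSqC z := Finset.sum_nonneg fun _ _ => sq_nonneg _
  have : ‖z‖ ≤ Real.sqrt (normSqC z) := by
    refine (pi_norm_le_iff_of_nonneg (Real.sqrt_nonneg _)).2 fun j => ?_
    refine Real.le_sqrt_of_sq_le ?_
    exact Finset.single_le_sum (f := fun j => ‖z j‖ ^ 2) (fun _ _ => sq_nonneg _) (Finset.mem_univ j)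
  calc ‖z‖ ^ 2 ≤ Real.sqrt (normSqC z) ^ 2 := by gcongr
    _ = _ := Real.sq_sqrt h0

/-- A smooth bump function on `ℝ`. -/
def baseBump : ContDiffBump (0 : ℝ) := ⟨1 / 2, 1, by norm_num, by norm_num⟩

/-- The unnormalized radial mollifier. -/
def radial (r : ℝ) (z : Cn n) : ℝ := baseBump (normSqC z / r ^ 2)

theorem contDiff_radial (r : ℝ) : ContDiff ℝ ∞ (radial (n := n) r) := by
  unfold radial
  exact baseBump.contDiff.comp (contDiff_normSqC.div_const _)

theorem radial_nonneg (r : ℝ) (z : Cn n) : 0 ≤ radial r z := baseBump.nonneg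

theorem radial_eq_zero {r : ℝ} (hr : 0 < r) {z : Cn n} (hz : r ≤ ‖z‖) : radial r z = 0 := by
  refine baseBump.zero_of_le_dist ?_
  have h1 : 1 ≤ normSqC z / r ^ 2 := by
    rw [le_div_iff₀ (by positivity), one_mul]
    exact (pow_le_pow_left₀ hr.le hz 2).trans (norm_sq_le_normSqC z)
  rw [Real.dist_0_eq_abs]
  exact h1.trans (le_abs_self _)

theorem hasCompactSupport_radial {r : ℝ} (hr : 0 < r) : HasCompactSupport (radial (n := n) r) := by
  refine HasCompactSupport.intro (isCompact_closedBall (0 : Cn n) r) fun z hz => radial_eq_zero hr ?_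
  simp only [Metric.mem_closedBall, dist_zero_right, not_le] at hz
  exact hz.le

theorem integral_radial_pos {r : ℝ} (hr : 0 < r) : 0 < ∫ z : Cn n, radial r z := by
  refine (contDiff_radial r).continuous.integral_pos_of_hasCompactSupport_nonneg_nonzero
    (hasCompactSupport_radial hr) (radial_nonneg r) (x := 0) ?_
  have : radial r (0 : Cn n) = 1 := by
    refine baseBump.one_of_mem_closedBall ?_
    simp [normSqC, baseBump]
  rw [this]; exact one_ne_zero

/-- The radial mollifier. -/
def mollifier (r : ℝ) (z : Cn n) : ℝ := (∫ w : Cn n, radial r w)⁻¹ * radial r z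

theorem contDiff_mollifier (r : ℝ) : ContDiff ℝ ∞ (mollifier (n := n) r) :=
  contDiff_const.mul (contDiff_radial r)

theorem mollifier_nonneg (r : ℝ) (z : Cn n) : 0 ≤ mollifier r z :=
  mul_nonneg (inv_nonneg.2 (integral_nonneg (radial_nonneg r))) (radial_nonneg r z)

theorem hasCompactSupport_mollifier {r : ℝ} (hr : 0 < r) :
    HasCompactSupport (mollifier (n := n) r) := (hasCompactSupport_radial hr).mul_left

theorem integral_mollifier {r : ℝ} (hr : 0 < r) : ∫ z : Cn n, mollifier r z = 1 := by
  unfold mollifier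
  rw [integral_const_mul, inv_mul_cancel₀ (integral_radial_pos hr).ne']

/-- The invariance needed for the mean value property, hence for entire functions to be fixed by
mollification. -/
theorem mollifier_rotation (r θ : ℝ) (z : Cn n) :
    mollifier r (Complex.exp (θ * Complex.I) • z) = mollifier r z := by
  unfold mollifier radial normSqC
  simp [Complex.norm_exp_ofReal_mul_I]

theorem support_mollifier_subset {r : ℝ} (hr : 0 < r) :
    Function.support (mollifier (n := n) r) ⊆ Metric.ball 0 r := by
  intro z hz
  rw [Metric.mem_ball, dist_zero_right]
  by_contra h
  exact hz (by simp [mollifier, radial_eq_zero hr (not_lt.1 h)])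

/-- The mollification of `b`. -/
def mollify (r : ℝ) (b : Cn n → ℂ) : Cn n → ℂ :=
  convolution (mollifier r) b (ContinuousLinearMap.lsmul ℝ ℝ) volume

theorem mollify_apply (r : ℝ) (b : Cn n → ℂ) (x : Cn n) :
    mollify r b x = ∫ w, mollifier r w • b (x - w) := rfl

theorem contDiff_mollify {r : ℝ} (hr : 0 < r) {b : Cn n → ℂ} (hb : LocallyIntegrable b) :
    ContDiff ℝ ∞ (mollify r b) :=
  (hasCompactSupport_mollifier hr).contDiff_convolution_left _ (contDiff_mollifier r) hb

theorem fderiv_mollify {r : ℝ} (hr : 0 < r) {b : Cn n → ℂ} (hb : LocallyIntegrable b) (x v : Cn n) :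
    fderiv ℝ (mollify r b) x v = ∫ w, fderiv ℝ (mollifier r) w v • b (x - w) := by
  have h := (hasCompactSupport_mollifier hr).hasFDerivAt_convolution_left
    (ContinuousLinearMap.lsmul ℝ ℝ) ((contDiff_mollifier r).of_le (by simp)) hb x
  have hconv : ConvolutionExistsAt (fderiv ℝ (mollifier (n := n) r)) b x
      ((ContinuousLinearMap.lsmul ℝ ℝ (E := ℂ)).precompL (Cn n)) volume :=
    ((hasCompactSupport_mollifier hr).fderiv (𝕜 := ℝ)).convolutionExists_left _
      ((contDiff_mollifier r).continuous_fderiv (by simp)) hb x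
  rw [mollify, h.fderiv, convolution, ContinuousLinearMap.integral_apply hconv]
  rfl

/-- The mollifications of a weakly holomorphic function are entire. -/
theorem differentiable_mollify {r : ℝ} (hr : 0 < r) {b : Cn n → ℂ} (hb : LocallyIntegrable b)
    (h : ∀ (j : Fin n) (φ : Cn n → ℂ), ContDiff ℝ ∞ φ → HasCompactSupport φ →
      ∫ z, b z * dbar j φ z = 0) : Differentiable ℂ (mollify r b) := by
  refine differentiable_of_dbar_eq_zero ((contDiff_mollify hr hb).differentiable (by simp)) ?_
  intro j x
  have hcd := contDiff_mollifier (n := n) r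
  have hint : ∀ v : Cn n, Integrable fun w => fderiv ℝ (mollifier r) w v • b (x - w) := by
    intro v
    have hc : Continuous fun w => fderiv ℝ (mollifier (n := n) r) w v :=
      (hcd.continuous_fderiv (by simp)).clm_apply continuous_const
    have hs : HasCompactSupport fun w => fderiv ℝ (mollifier (n := n) r) w v :=
      (hasCompactSupport_mollifier hr).fderiv_apply (𝕜 := ℝ) v
    exact hs.convolutionExists_left (ContinuousLinearMap.lsmul ℝ ℝ) hc hb x
  rw [dbar, fderiv_mollify hr hb, fderiv_mollify hr hb, ← integral_const_mul,
    ← integral_add (hint _) ((hint _).const_mul _)]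
  -- The test function for the weak equation is the reflected mollifier `y ↦ ρ_r(x - y)`; its
  -- derivatives are those of `ρ_r` with the opposite sign.
  have hφ : ContDiff ℝ ∞ fun y : Cn n => (mollifier r (x - y) : ℂ) :=
    Complex.ofRealCLM.contDiff.comp (hcd.comp (contDiff_const.sub contDiff_id))
  have hφc : HasCompactSupport fun y : Cn n => (mollifier r (x - y) : ℂ) :=
    ((hasCompactSupport_mollifier hr).comp_homeomorph (Homeomorph.subLeft x)).comp_left
      (g := fun t : ℝ => (t : ℂ)) Complex.ofReal_zero
  have hder : ∀ y v : Cn n, fderiv ℝ (fun y : Cn n => (mollifier r (x - y) : ℂ)) y v =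
      -(fderiv ℝ (mollifier r) (x - y) v : ℂ) := by
    intro y v
    have h1 : HasFDerivAt (fun y : Cn n => x - y) (-ContinuousLinearMap.id ℝ (Cn n)) y := by
      simpa using (hasFDerivAt_id (𝕜 := ℝ) y).const_sub x
    have h2 := ((hcd.differentiable (by simp)) (x - y)).hasFDerivAt.comp y h1
    have h3 := Complex.ofRealCLM.hasFDerivAt.comp y h2
    have h4 : fderiv ℝ (fun y : Cn n => (mollifier r (x - y) : ℂ)) y = _ := h3.fderiv
    rw [h4]
    simp
  have h0 := h j _ hφ hφc
  simp only [dbar, hder] at h0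
  have h1 := integral_sub_left_eq_self (fun y => b y * (-(fderiv ℝ (mollifier r) (x - y)
    (Pi.single j 1) : ℂ) + Complex.I * -(fderiv ℝ (mollifier r) (x - y)
    (Pi.single j Complex.I) : ℂ))) volume x
  rw [h0] at h1
  rw [← neg_eq_zero, ← integral_neg, ← h1]
  refine integral_congr_ae (ae_of_all _ fun w => ?_)
  simp only [sub_sub_cancel, Complex.real_smul]
  ring

/-- Fubini for the pairing of a mollification with a test function. -/
theorem integral_mollify_mul {r : ℝ} (hr : 0 < r) {b : Cn n → ℂ} (hb : LocallyIntegrable b)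
    {g : Cn n → ℂ} (hg : Continuous g) (hgc : HasCompactSupport g) :
    ∫ x, mollify r b x * g x = ∫ w, mollifier r w • ∫ x, b (x - w) * g x := by
  -- Only the values of `b` on this compact difference set enter the double integral, so `b` may be
  -- replaced by an integrable function before Fubini is used.
  set K : Set (Cn n) := (fun p : Cn n × Cn n => p.1 - p.2) '' (tsupport g ×ˢ Metric.closedBall 0 r)
    with hK
  have hKc : IsCompact K := (hgc.isCompact.prod (isCompact_closedBall 0 r)).image (by fun_prop)
  have hbK : Integrable (K.indicator b) :=
    (integrable_indicator_iff hKc.measurableSet).2 (hb.integrableOn_isCompact hKc)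
  have hρ : Integrable (mollifier (n := n) r) :=
    (contDiff_mollifier r).continuous.integrable_of_hasCompactSupport (hasCompactSupport_mollifier hr)
  have hI := hρ.convolution_integrand (ContinuousLinearMap.lsmul ℝ ℝ (E := ℂ)) hbK
  obtain ⟨C, hC⟩ := hg.bounded_above_of_compact_support hgc
  have hI2 : Integrable (fun p : Cn n × Cn n => g p.1 *
      (mollifier r p.2 • K.indicator b (p.1 - p.2))) (volume.prod volume) :=
    hI.bdd_mul (hg.comp continuous_fst).aestronglyMeasurable (ae_of_all _ fun p => hC p.1)
  have heq : ∀ x w, g x * (mollifier r w • K.indicator b (x - w)) =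
      mollifier r w • (b (x - w) * g x) := by
    intro x w
    by_cases hx : g x = 0
    · simp [hx]
    by_cases hw : mollifier r w = 0
    · simp [hw]
    have : x - w ∈ K := ⟨(x, w), ⟨subset_tsupport _ hx,
      Metric.ball_subset_closedBall (support_mollifier_subset hr hw)⟩, rfl⟩
    rw [Set.indicator_of_mem this, Complex.real_smul, Complex.real_smul]
    ring
  simp only [heq] at hI2
  simp only [mollify_apply, ← integral_mul_const, ← integral_smul]
  have := integral_integral_swap (f := fun x w => mollifier r w • (b (x - w) * g x)) hI2
  rw [← this]
  simp only [smul_mul_assoc]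

/-- The mean value property against a rotation invariant density of total mass one. -/
theorem mollify_eq_self {r : ℝ} (hr : 0 < r) {f : Cn n → ℂ} (hf : Differentiable ℂ f) (x : Cn n) :
    ∫ w, mollifier r w • f (x - w) = f x := by
  have hg : Differentiable ℂ fun w => f (x - w) := hf.comp (by fun_prop)
  have h := integral_mul_of_rotation_invariant hg (ρ := fun w => (mollifier r w : ℂ))
    (Complex.continuous_ofReal.comp (contDiff_mollifier r).continuous).measurable
    (fun θ z => by rw [mollifier_rotation]) ?_
  · rw [integral_complex_ofReal, integral_mollifier hr] at h
    simpa [mul_comm] using h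
  · refine (Continuous.integrable_of_hasCompactSupport ?_ ?_)
    · exact hg.continuous.mul (Complex.continuous_ofReal.comp (contDiff_mollifier r).continuous)
    · exact HasCompactSupport.mul_left ((hasCompactSupport_mollifier hr).comp_left
        (g := fun t : ℝ => (t : ℂ)) Complex.ofReal_zero)

/-- Weyl's lemma for the Cauchy–Riemann system: a locally integrable weakly holomorphic function is
almost everywhere equal to an entire function. -/
theorem exists_entire_of_weak_dbar {b : Cn n → ℂ} (hb : LocallyIntegrable b)
    (h : ∀ (j : Fin n) (φ : Cn n → ℂ), ContDiff ℝ ∞ φ → HasCompactSupport φ →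
      ∫ z, b z * dbar j φ z = 0) : ∃ f : Cn n → ℂ, Differentiable ℂ f ∧ b =ᵐ[volume] f := by
  have hd : ∀ {r : ℝ}, 0 < r → Differentiable ℂ (mollify r b) := fun hr =>
    differentiable_mollify hr hb h
  -- Both mollifications are entire, hence fixed by further mollification. As mollifications
  -- commute, `ρ_r * b = ρ_s * (ρ_r * b) = ρ_r * (ρ_s * b) = ρ_s * b`.
  have hindep : ∀ r s : ℝ, 0 < r → 0 < s → mollify r b = mollify s b := by
    intro r s hr hs
    funext x
    have hg : Continuous fun y : Cn n => (mollifier s (x - y) : ℂ) :=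
      Complex.continuous_ofReal.comp ((contDiff_mollifier s).continuous.comp (by fun_prop))
    have hgc : HasCompactSupport fun y : Cn n => (mollifier s (x - y) : ℂ) :=
      ((hasCompactSupport_mollifier hs).comp_homeomorph (Homeomorph.subLeft x)).comp_left
        (g := fun t : ℝ => (t : ℂ)) Complex.ofReal_zero
    have e := integral_mollify_mul hr hb hg hgc
    have e1 : ∫ y, mollify r b y * (mollifier s (x - y) : ℂ) = mollify r b x := by
      rw [← mollify_eq_self hs (hd hr) x, ← integral_sub_left_eq_self _ volume x]
      refine integral_congr_ae (ae_of_all _ fun w => ?_)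
      simp [mul_comm]
    have e2 : ∀ w, ∫ y, b (y - w) * (mollifier s (x - y) : ℂ) = mollify s b (x - w) := by
      intro w
      rw [mollify_apply, ← integral_sub_left_eq_self _ volume x]
      refine integral_congr_ae (ae_of_all _ fun y => ?_)
      simp only [sub_sub_cancel, Complex.real_smul]
      rw [sub_right_comm, mul_comm]
    simp only [e1, e2, mollify_eq_self hr (hd hs)] at e
    exact e
  refine ⟨mollify 1 b, hd one_pos, ?_⟩
  have hcont := (hd one_pos).continuous
  have hloc : LocallyIntegrable (fun x => b x - mollify 1 b x) :=
    hb.sub hcont.locallyIntegrable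
  have := ae_eq_zero_of_integral_contDiff_smul_eq_zero hloc ?_
  · filter_upwards [this] with x hx using sub_eq_zero.1 hx
  intro g hg hgc
  set G : Cn n → ℂ := fun x => (g x : ℂ) with hG
  have hGcont : Continuous G := Complex.continuous_ofReal.comp hg.continuous
  have hGc : HasCompactSupport G := hgc.comp_left (g := fun t : ℝ => (t : ℂ)) Complex.ofReal_zero
  -- `A w` pairs the translate of `b` by `w` with the test function. Averaging `A` against `ρ_r`
  -- gives a value independent of `r`, while continuity of `A` makes it tend to `A 0`, the pairing
  -- of `b` itself.
  set A : Cn n → ℂ := fun w => ∫ x, b (x - w) * G x with hA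
  have hAcont : Continuous A := by
    have h1 : Continuous (convolution b (fun y => G (-y)) (ContinuousLinearMap.mul ℝ ℂ) volume) :=
      (hGc.comp_homeomorph (Homeomorph.neg (Cn n))).continuous_convolution_right _ hb
        (hGcont.comp continuous_neg)
    have h2 : A = fun w => convolution b (fun y => G (-y)) (ContinuousLinearMap.mul ℝ ℂ) volume (-w) := by
      funext w
      rw [hA, convolution_def]
      simp only [ContinuousLinearMap.mul_apply']
      rw [← integral_add_right_eq_self (fun x => b (x - w) * G x) w]
      refine integral_congr_ae (ae_of_all _ fun y => ?_)
      simp [add_comm]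
    rw [h2]
    exact h1.comp continuous_neg
  have hconst : ∀ r : ℝ, 0 < r → ∫ w, mollifier r w • A w = ∫ x, mollify 1 b x * G x := by
    intro r hr
    rw [hindep 1 r one_pos hr, integral_mollify_mul hr hb hGcont hGc]
  have hlim : Tendsto (fun k : ℕ => ∫ w, mollifier (1 / ((k : ℝ) + 1)) w • A w) atTop (𝓝 (A 0)) := by
    have hpos : ∀ k : ℕ, (0 : ℝ) < 1 / ((k : ℝ) + 1) := fun k => by positivity
    have := convolution_tendsto_right (μ := (volume : Measure (Cn n)))
      (φ := fun k : ℕ => mollifier (n := n) (1 / ((k : ℝ) + 1))) (l := atTop)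
      (g := fun _ : ℕ => fun w => A (-w)) (k := fun _ => 0) (x₀ := 0) (z₀ := A 0)
      (Eventually.of_forall fun k => mollifier_nonneg _)
      (Eventually.of_forall fun k => integral_mollifier (hpos k)) ?_
      (Eventually.of_forall fun k => (hAcont.comp continuous_neg).aestronglyMeasurable) ?_
      tendsto_const_nhds
    · refine this.congr fun k => ?_
      rw [convolution_def]
      simp
    · rw [tendsto_smallSets_iff]
      intro t ht
      obtain ⟨ε, hε, hεt⟩ := Metric.mem_nhds_iff.1 ht
      have := (tendsto_one_div_add_atTop_nhds_zero_nat (𝕜 := ℝ)).eventually (gt_mem_nhds hε)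
      filter_upwards [this] with k hk
      exact (support_mollifier_subset (hpos k)).trans ((Metric.ball_subset_ball hk.le).trans hεt)
    · have h3 : Tendsto (fun w => A (-w)) (𝓝 0) (𝓝 (A 0)) := by
        have := (hAcont.comp continuous_neg).tendsto (0 : Cn n)
        simpa [Function.comp_def] using this
      exact h3.comp tendsto_snd
  have hA0 : A 0 = ∫ x, mollify 1 b x * G x := by
    refine tendsto_nhds_unique hlim ?_
    refine tendsto_const_nhds.congr fun k => (hconst _ (by positivity)).symm
  have i1 : Integrable fun x => g x • b x :=
    hb.integrable_smul_left_of_hasCompactSupport hg.continuous hgc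
  have i2 : Integrable fun x => g x • mollify 1 b x :=
    hcont.locallyIntegrable.integrable_smul_left_of_hasCompactSupport hg.continuous hgc
  simp only [smul_sub]
  rw [integral_sub i1 i2, sub_eq_zero]
  simp only [hA, hG, sub_zero] at hA0
  simpa [mul_comm] using hA0

end Weyl

/-! ### The Gaussian kernel of Bargmann–Fock space. -/

section ModelKernel

variable {n : ℕ}

instance (n : ℕ) : (muC n).IsAddHaarMeasure :=
  Measure.IsAddHaarMeasure.nnreal_smul volume (by positivity)

theorem ae_muC : ae (muC n) = ae (volume : Measure (Cn n)) :=
  Measure.ae_smul_measure_eq (c := (2 : ℝ≥0) ^ n) (by positivity) _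

theorem integral_muC (f : Cn n → ℂ) : ∫ z, f z ∂(muC n) = 2 ^ n * ∫ z, f z := by
  rw [muC, integral_smul_nnreal_measure, NNReal.smul_def]
  simp

theorem integrable_muC_iff {f : Cn n → ℂ} : Integrable f (muC n) ↔ Integrable f := by
  exact integrable_smul_measure (c := (((2 : ℝ≥0) ^ n : ℝ≥0) : ℝ≥0∞)) (by positivity) (by finiteness)

/-- The Hermitian form `∑ λ_j z_j conj(w_j)`. -/
def herm (lam : Fin n → ℝ) (z w : Cn n) : ℂ := ∑ j, lam j * z j * conj (w j)

variable (lam : Fin n → ℝ)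

theorem herm_self (z : Cn n) : herm lam z z = psi lam z := by
  simp only [herm, psi, Complex.ofReal_sum]
  refine Finset.sum_congr rfl fun j _ => ?_
  rw [mul_assoc, Complex.mul_conj, Complex.normSq_eq_norm_sq, Complex.ofReal_mul]

theorem herm_conj (z w : Cn n) : conj (herm lam z w) = herm lam w z := by
  simp only [herm, map_sum, map_mul, Complex.conj_ofReal, Complex.conj_conj]
  refine Finset.sum_congr rfl fun j _ => ?_
  ring

theorem herm_add_left (z z' w : Cn n) : herm lam (z + z') w = herm lam z w + herm lam z' w := by
  simp only [herm, ← Finset.sum_add_distrib, Pi.add_apply]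
  refine Finset.sum_congr rfl fun j _ => ?_
  ring

theorem herm_add_right (z w w' : Cn n) : herm lam z (w + w') = herm lam z w + herm lam z w' := by
  simp only [herm, ← Finset.sum_add_distrib, Pi.add_apply, map_add]
  refine Finset.sum_congr rfl fun j _ => ?_
  ring

theorem herm_sub_left (z z' w : Cn n) : herm lam (z - z') w = herm lam z w - herm lam z' w := by
  have := herm_add_left lam (z - z') z' w
  rw [sub_add_cancel] at this
  rw [this, add_sub_cancel_right]

theorem herm_sub_right (z w w' : Cn n) : herm lam z (w - w') = herm lam z w - herm lam z w' := by
  have := herm_add_right lam z (w - w') w'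
  rw [sub_add_cancel] at this
  rw [this, add_sub_cancel_right]

/-- Polarisation; it makes the modulus of the kernel a Gaussian in `z - w`, so that all its
integrals are translation invariant. -/
theorem two_mul_re_herm (z w : Cn n) :
    2 * (herm lam z w).re = psi lam z + psi lam w - psi lam (z - w) := by
  have h1 : ((2 * (herm lam z w).re : ℝ) : ℂ) = herm lam z w + herm lam w z := by
    rw [← herm_conj lam z w, Complex.add_conj]
  rw [← Complex.ofReal_inj, h1]
  push_cast
  rw [← herm_self, ← herm_self, ← herm_self, herm_sub_left, herm_sub_right, herm_sub_right]
  ring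

theorem continuous_psi : Continuous (psi lam) := by
  unfold psi; fun_prop

theorem continuous_herm : Continuous fun p : Cn n × Cn n => herm lam p.1 p.2 := by
  unfold herm
  refine continuous_finsetSum _ fun j _ => ?_
  refine Continuous.mul (by fun_prop) ?_
  exact Complex.continuous_conj.comp (by fun_prop)

theorem differentiable_herm (w : Cn n) : Differentiable ℂ fun z => herm lam z w := by
  unfold herm
  fun_prop

theorem psi_rotation (θ : ℝ) (z : Cn n) :
    psi lam (Complex.exp (θ * Complex.I) • z) = psi lam z := by
  simp [psi, Complex.norm_exp_ofReal_mul_I]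

variable {lam}

theorem psi_nonneg (hlam : ∀ j, 0 < lam j) (z : Cn n) : 0 ≤ psi lam z :=
  Finset.sum_nonneg fun j _ => mul_nonneg (hlam j).le (sq_nonneg _)

theorem integrable_exp_neg_psi (hlam : ∀ j, 0 < lam j) {t : ℝ} (ht : 0 < t) :
    Integrable fun z : Cn n => Real.exp (-t * psi lam z) := by
  have h := Integrable.fintype_prod (𝕜 := ℝ) (μ := fun _ : Fin n => (volume : Measure ℂ))
    (f := fun (j : Fin n) (w : ℂ) => Real.exp (-(t * lam j) * ‖w‖ ^ 2)) fun j => by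
      have h1 := (GaussianFourier.integrable_cexp_neg_mul_sq_norm_add (V := ℂ)
        (b := ((t * lam j : ℝ) : ℂ)) (by simpa using mul_pos ht (hlam j)) 0 0).re
      refine h1.congr (ae_of_all _ fun w => ?_)
      simp only [zero_mul, add_zero]
      have : (-((t * lam j : ℝ) : ℂ) * (‖w‖ : ℂ) ^ 2) = ((-(t * lam j) * ‖w‖ ^ 2 : ℝ) : ℂ) := by
        push_cast; ring
      rw [this, ← Complex.ofReal_exp]
      exact Complex.ofReal_re _
  refine h.congr (ae_of_all _ fun z => ?_)
  simp only [← Real.exp_sum, psi, Finset.mul_sum]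
  congr 1
  refine Finset.sum_congr rfl fun j _ => ?_
  ring

theorem integral_exp_neg_psi (hlam : ∀ j, 0 < lam j) {t : ℝ} (ht : 0 < t) :
    ∫ z : Cn n, Real.exp (-t * psi lam z) = ∏ j, Real.pi / (t * lam j) := by
  have h := integral_fintype_prod_volume_eq_prod (𝕜 := ℝ) (E := fun _ : Fin n => ℂ)
    (fun (j : Fin n) (w : ℂ) => Real.exp (-(t * lam j) * ‖w‖ ^ 2))
  have h2 : ∀ j, ∫ w : ℂ, Real.exp (-(t * lam j) * ‖w‖ ^ 2) = Real.pi / (t * lam j) := by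
    intro j
    rw [GaussianFourier.integral_rexp_neg_mul_sq_norm (mul_pos ht (hlam j))]
    simp
  simp only [h2] at h
  rw [← h]
  congr 1 with z
  simp only [← Real.exp_sum, psi, Finset.mul_sum]
  congr 1
  refine Finset.sum_congr rfl fun j _ => ?_
  ring

variable (lam)

/-- The value `∏ (t λ_j / π)` of the weighted Bergman kernel on the diagonal. -/
def diagConst (t : ℝ) : ℝ := ∏ j, (t * lam j / Real.pi)

theorem continuous_diagConst : Continuous (diagConst lam) := by unfold diagConst; fun_prop

variable {lam}

theorem diagConst_pos (hlam : ∀ j, 0 < lam j) {t : ℝ} (ht : 0 < t) : 0 < diagConst lam t :=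
  Finset.prod_pos fun j _ => div_pos (mul_pos ht (hlam j)) Real.pi_pos

/-- For the measure `2 ^ n` times Lebesgue, `diagConst` is the reciprocal of the total mass of
`e^{-2tψ}`: the normalisation of the reproducing formula. -/
theorem diagConst_mul_prod (hlam : ∀ j, 0 < lam j) {t : ℝ} (ht : 0 < t) :
    diagConst lam t * (2 ^ n * ∏ j, Real.pi / (2 * t * lam j)) = 1 := by
  have : (2 : ℝ) ^ n = ∏ _j : Fin n, (2 : ℝ) := by simp
  rw [diagConst, this, ← Finset.prod_mul_distrib, ← Finset.prod_mul_distrib]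
  refine Finset.prod_eq_one fun j _ => ?_
  have := hlam j
  have := Real.pi_pos
  field_simp

/-- The modulus of the kernel decays like `e^{-tψ}` and not `e^{-2tψ}`, which costs the factor `2 ^
n` in Schur's test. It does not depend on `t`. -/
theorem diagConst_mul_prod' (hlam : ∀ j, 0 < lam j) {t : ℝ} (ht : 0 < t) :
    diagConst lam t * (2 ^ n * ∏ j, Real.pi / (t * lam j)) = 2 ^ n := by
  have : (2 : ℝ) ^ n = ∏ _j : Fin n, (2 : ℝ) := by simp
  rw [diagConst, this, ← Finset.prod_mul_distrib, ← Finset.prod_mul_distrib]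
  refine Finset.prod_congr rfl fun j _ => ?_
  have := hlam j
  have := Real.pi_pos
  field_simp

variable (lam)

/-- The weighted Bergman kernel in closed form. -/
def modelKernel (t : ℝ) (z w : Cn n) : ℂ :=
  if 0 < t then
    (diagConst lam t : ℂ) * Complex.exp (-(t * (psi lam z + psi lam w)) + 2 * t * herm lam z w)
  else 0

theorem modelKernel_of_nonpos {t : ℝ} (ht : t ≤ 0) (z w : Cn n) : modelKernel lam t z w = 0 :=
  if_neg (not_lt.2 ht)

theorem modelKernel_of_pos {t : ℝ} (ht : 0 < t) (z w : Cn n) : modelKernel lam t z w =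
    (diagConst lam t : ℂ) * Complex.exp (-(t * (psi lam z + psi lam w)) + 2 * t * herm lam z w) :=
  if_pos ht

theorem modelKernel_conj (t : ℝ) (z w : Cn n) :
    conj (modelKernel lam t z w) = modelKernel lam t w z := by
  unfold modelKernel
  split_ifs
  · rw [map_mul, Complex.conj_ofReal, ← Complex.exp_conj]
    simp only [map_add, map_neg, map_mul, Complex.conj_ofReal, herm_conj, Complex.conj_ofNat]
    rw [add_comm (psi lam z : ℂ)]
  · simp

theorem measurable_modelKernel :
    Measurable fun p : ℝ × Cn n × Cn n => modelKernel lam p.1 p.2.1 p.2.2 := by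
  unfold modelKernel
  have := continuous_herm lam
  have := continuous_psi lam
  have := continuous_diagConst lam
  refine Measurable.ite (measurableSet_lt measurable_const measurable_fst) ?_ measurable_const
  refine Continuous.measurable ?_
  refine Continuous.mul (by fun_prop) (Complex.continuous_exp.comp (Continuous.add (by fun_prop) ?_))
  exact Continuous.mul (by fun_prop) ((continuous_herm lam).comp continuous_snd)

variable {lam}

theorem norm_modelKernel (hlam : ∀ j, 0 < lam j) {t : ℝ} (ht : 0 < t) (z w : Cn n) :
    ‖modelKernel lam t z w‖ = diagConst lam t * Real.exp (-t * psi lam (z - w)) := by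
  rw [modelKernel_of_pos lam ht, norm_mul, Complex.norm_real, Real.norm_of_nonneg
    (diagConst_pos hlam ht).le, Complex.norm_exp]
  congr 2
  have h := two_mul_re_herm lam z w
  have e : (2 * (t : ℂ) * herm lam z w).re = t * (2 * (herm lam z w).re) := by
    have : 2 * (t : ℂ) * herm lam z w = ((2 * t : ℝ) : ℂ) * herm lam z w := by push_cast; ring
    rw [this, Complex.re_ofReal_mul]; ring
  rw [Complex.add_re, e, h, Complex.neg_re, ← Complex.ofReal_add, ← Complex.ofReal_mul,
    Complex.ofReal_re]
  ring

theorem norm_modelKernel_le (hlam : ∀ j, 0 < lam j) (t : ℝ) (z w : Cn n) :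
    ‖modelKernel lam t z w‖ ≤ |diagConst lam t| := by
  by_cases ht : 0 < t
  · rw [norm_modelKernel hlam ht, abs_of_pos (diagConst_pos hlam ht)]
    refine mul_le_of_le_one_right (diagConst_pos hlam ht).le (Real.exp_le_one_iff.2 ?_)
    rw [neg_mul, neg_nonpos]
    exact mul_nonneg ht.le (psi_nonneg hlam _)
  · rw [modelKernel_of_nonpos lam (not_lt.1 ht), norm_zero]
    exact abs_nonneg _

/-- Uniform bound for Schur's test. -/
theorem lintegral_norm_modelKernel_le (hlam : ∀ j, 0 < lam j) (t : ℝ) (z : Cn n) :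
    ∫⁻ w, ‖modelKernel lam t z w‖ₑ ∂(muC n) ≤ 2 ^ n := by
  by_cases ht : 0 < t
  · have e : ∀ w, ‖modelKernel lam t z w‖ₑ =
        ENNReal.ofReal (diagConst lam t) * ENNReal.ofReal (Real.exp (-t * psi lam (z - w))) := by
      intro w
      rw [← ofReal_norm, norm_modelKernel hlam ht, ENNReal.ofReal_mul (diagConst_pos hlam ht).le]
    simp_rw [e]
    rw [lintegral_const_mul _ (by have := continuous_psi lam; fun_prop),
      lintegral_sub_left_eq_self (fun w => ENNReal.ofReal (Real.exp (-t * psi lam w))) z, muC,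
      lintegral_smul_measure, ← ofReal_integral_eq_lintegral_ofReal (integrable_exp_neg_psi hlam ht)
        (ae_of_all _ fun _ => (Real.exp_pos _).le), integral_exp_neg_psi hlam ht,
      ENNReal.smul_def, smul_eq_mul]
    have h2 : (((2 : ℝ≥0) ^ n : ℝ≥0) : ℝ≥0∞) = ENNReal.ofReal (2 ^ n) := by
      rw [ENNReal.ofReal_pow (by norm_num)]
      simp
    rw [h2, ← ENNReal.ofReal_mul (by positivity), ← ENNReal.ofReal_mul (diagConst_pos hlam ht).le,
      diagConst_mul_prod' hlam ht, ENNReal.ofReal_pow (by norm_num)]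
    simp
  · simp [modelKernel_of_nonpos lam (not_lt.1 ht)]

theorem lintegral_norm_modelKernel_le' (hlam : ∀ j, 0 < lam j) (t : ℝ) (w : Cn n) :
    ∫⁻ z, ‖modelKernel lam t z w‖ₑ ∂(muC n) ≤ 2 ^ n := by
  refine le_of_eq_of_le (lintegral_congr fun z => ?_) (lintegral_norm_modelKernel_le hlam t w)
  rw [← modelKernel_conj, RCLike.enorm_conj]

/-- As for any reproducing kernel, the squared norm of a row is the diagonal value, here constant in
`z`. -/
theorem lintegral_norm_sq_modelKernel (hlam : ∀ j, 0 < lam j) {t : ℝ} (ht : 0 < t) (z : Cn n) :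
    ∫⁻ w, ‖modelKernel lam t z w‖ₑ ^ 2 ∂(muC n) = ENNReal.ofReal (diagConst lam t) := by
  have hd := diagConst_pos hlam ht
  have e : ∀ w, ‖modelKernel lam t z w‖ₑ ^ 2 =
      ENNReal.ofReal (diagConst lam t ^ 2) *
        ENNReal.ofReal (Real.exp (-(2 * t) * psi lam (z - w))) := by
    intro w
    rw [← ofReal_norm, norm_modelKernel hlam ht, ← ENNReal.ofReal_pow (by positivity),
      ← ENNReal.ofReal_mul (by positivity), mul_pow, ← Real.exp_nat_mul]
    congr 3
    push_cast; ring
  simp_rw [e]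
  rw [lintegral_const_mul _ (by have := continuous_psi lam; fun_prop),
    lintegral_sub_left_eq_self (fun w => ENNReal.ofReal (Real.exp (-(2 * t) * psi lam w))) z, muC,
    lintegral_smul_measure, ← ofReal_integral_eq_lintegral_ofReal
      (integrable_exp_neg_psi hlam (by positivity)) (ae_of_all _ fun _ => (Real.exp_pos _).le),
    integral_exp_neg_psi hlam (by positivity), ENNReal.smul_def, smul_eq_mul]
  have h2 : (((2 : ℝ≥0) ^ n : ℝ≥0) : ℝ≥0∞) = ENNReal.ofReal (2 ^ n) := by
    rw [ENNReal.ofReal_pow (by norm_num)]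
    simp
  rw [h2, ← ENNReal.ofReal_mul (by positivity), ← ENNReal.ofReal_mul (by positivity), pow_two,
    mul_assoc, diagConst_mul_prod hlam ht, mul_one]

theorem memLp_modelKernel (hlam : ∀ j, 0 < lam j) {t : ℝ} (ht : 0 < t) (z : Cn n) :
    MemLp (fun w => modelKernel lam t z w) 2 (muC n) := by
  rw [memLp_two_iff, lintegral_norm_sq_modelKernel hlam ht]
  · exact ENNReal.ofReal_ne_top
  · exact ((measurable_modelKernel lam).comp
      (measurable_const.prodMk (measurable_const.prodMk measurable_id))).aestronglyMeasurable

/-- The reproducing property of the weighted Bergman kernel. -/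
theorem integral_modelKernel_mul (hlam : ∀ j, 0 < lam j) {t : ℝ} (ht : 0 < t) {f : Cn n → ℂ}
    (hf : Differentiable ℂ f)
    (h2 : MemLp (fun z => (Real.exp (-t * psi lam z) : ℂ) * f z) 2 (muC n)) (z : Cn n) :
    ∫ w, modelKernel lam t z w * ((Real.exp (-t * psi lam w) : ℂ) * f w) ∂(muC n) =
      (Real.exp (-t * psi lam z) : ℂ) * f z := by
  have hint : Integrable (fun w => modelKernel lam t z w * ((Real.exp (-t * psi lam w) : ℂ) * f w))
    (muC n) := (memLp_modelKernel hlam ht z).integrable_mul h2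
  -- Translating by `z` and completing the square leaves the rotation invariant Gaussian `e^{-2tψ}`
  -- times the entire function `F`. The mean value property then evaluates the integral as `F 0 = f
  -- z` times the mass of the Gaussian.
  set F : Cn n → ℂ := fun w => f (w + z) * Complex.exp (-(2 * t * herm lam w z)) with hF
  have hFd : Differentiable ℂ F := by
    refine (hf.comp (by fun_prop)).mul (Differentiable.cexp ?_)
    exact ((differentiable_herm lam z).const_mul _).neg
  have e : ∀ w, modelKernel lam t z (w + z) * ((Real.exp (-t * psi lam (w + z)) : ℂ) * f (w + z)) =
      (diagConst lam t * Real.exp (-t * psi lam z) : ℂ) *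
        (F w * (Real.exp (-(2 * t) * psi lam w) : ℂ)) := by
    intro w
    have key : Complex.exp (-(t * (psi lam z + psi lam (w + z))) + 2 * t * herm lam z (w + z)) *
        Complex.exp (-t * psi lam (w + z)) = Complex.exp (-t * psi lam z) *
          (Complex.exp (-(2 * t * herm lam w z)) * Complex.exp (-(2 * t) * psi lam w)) := by
      rw [← Complex.exp_add, ← Complex.exp_add, ← Complex.exp_add]
      congr 1
      rw [← herm_self, ← herm_self, ← herm_self]
      simp only [herm_add_left, herm_add_right]
      ring
    rw [modelKernel_of_pos lam ht]
    simp only [hF, Complex.ofReal_exp]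
    push_cast
    linear_combination (diagConst lam t : ℂ) * f (w + z) * key
  have hint2 : Integrable fun w => F w * (Real.exp (-(2 * t) * psi lam w) : ℂ) := by
    have := (hint.comp_add_right z)
    simp only [e] at this
    rw [integrable_muC_iff] at this
    refine (integrable_const_mul_iff (IsUnit.mk0 _ ?_) _).1 this
    exact mul_ne_zero (by exact_mod_cast (diagConst_pos hlam ht).ne')
      (by exact_mod_cast (Real.exp_pos _).ne')
  have hmv := integral_mul_of_rotation_invariant hFd
    (ρ := fun w => (Real.exp (-(2 * t) * psi lam w) : ℂ))
    (by have := continuous_psi lam; fun_prop) (fun θ w => by simp only [psi_rotation]) hint2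
  rw [integral_complex_ofReal, integral_exp_neg_psi hlam (by positivity)] at hmv
  rw [← integral_add_right_eq_self _ z]
  simp only [e]
  rw [integral_muC, integral_const_mul, hmv]
  have hF0 : F 0 = f z := by simp [hF, herm]
  rw [hF0]
  have := diagConst_mul_prod hlam ht
  have h' : (diagConst lam t : ℂ) * (2 ^ n * ((∏ j, Real.pi / (2 * t * lam j) : ℝ) : ℂ)) = 1 := by
    exact_mod_cast this
  linear_combination (Real.exp (-t * psi lam z) : ℂ) * f z * h'

theorem lintegral_mul_sq_le {α : Type*} [MeasurableSpace α] {ν : Measure α} {f g : α → ℝ≥0∞}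
    (hf : AEMeasurable f ν) (hg : AEMeasurable g ν) :
    (∫⁻ x, f x * g x ∂ν) ^ 2 ≤ (∫⁻ x, f x ^ 2 ∂ν) * ∫⁻ x, g x ^ 2 ∂ν := by
  have h := ENNReal.lintegral_mul_le_Lp_mul_Lq ν Real.HolderConjugate.two_two hf hg
  have h2 := pow_le_pow_left' h 2
  rw [mul_pow, ← ENNReal.rpow_natCast, ← ENNReal.rpow_natCast, ← ENNReal.rpow_natCast,
    ← ENNReal.rpow_mul, ← ENNReal.rpow_mul] at h2
  norm_num at h2
  exact h2

/-- An entire function which is square integrable for a weight `e^{-2tψ}` with `t ≤ 0` vanishes. -/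
theorem eq_zero_of_memLp_of_nonpos (hn : 1 ≤ n) (hlam : ∀ j, 0 < lam j) {t : ℝ} (ht : t ≤ 0)
    {f : Cn n → ℂ} (hf : Differentiable ℂ f)
    (h2 : MemLp (fun z => (Real.exp (-t * psi lam z) : ℂ) * f z) 2 (muC n)) : f = 0 := by
  have hfc := hf.continuous
  have hpsi := continuous_psi lam
  -- Since `t ≤ 0 < s` and `ψ ≥ 0`, the weight `e^{-sψ}` is the smaller one: `f` lies in the Fock
  -- space of every `s > 0`, with norm bounded independently of `s`.
  have hle : ∀ s : ℝ, 0 < s → ∀ z, ‖(Real.exp (-s * psi lam z) : ℂ) * f z‖ ≤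
      ‖(Real.exp (-t * psi lam z) : ℂ) * f z‖ := by
    intro s hs z
    rw [norm_mul, norm_mul, Complex.norm_real, Complex.norm_real, Real.norm_of_nonneg
      (Real.exp_pos _).le, Real.norm_of_nonneg (Real.exp_pos _).le]
    gcongr
    · exact psi_nonneg hlam z
    · linarith
  have hs2 : ∀ s : ℝ, 0 < s → MemLp (fun z => (Real.exp (-s * psi lam z) : ℂ) * f z) 2 (muC n) :=
    fun s hs => h2.mono (Continuous.aestronglyMeasurable (by fun_prop)) (ae_of_all _ (hle s hs))
  have hN := (memLp_two_iff h2.1).1 h2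
  set N := ∫⁻ z, ‖(Real.exp (-t * psi lam z) : ℂ) * f z‖ₑ ^ 2 ∂(muC n) with hNdef
  -- The reproducing formula and Cauchy–Schwarz bound point values by the diagonal of the kernel;
  -- letting `s → 0+` will force `f z = 0`.
  have hbound : ∀ z (s : ℝ), 0 < s → ‖(Real.exp (-s * psi lam z) : ℂ) * f z‖ₑ ^ 2 ≤
      ENNReal.ofReal (diagConst lam s) * N := by
    intro z s hs
    rw [← integral_modelKernel_mul hlam hs hf (hs2 s hs) z]
    calc _ ≤ (∫⁻ w, ‖modelKernel lam s z w‖ₑ * ‖(Real.exp (-s * psi lam w) : ℂ) * f w‖ₑ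
          ∂(muC n)) ^ 2 := by
          refine pow_le_pow_left' ((enorm_integral_le_lintegral_enorm _).trans_eq ?_) 2
          simp only [enorm_mul]
      _ ≤ _ := lintegral_mul_sq_le (memLp_modelKernel hlam hs z).1.enorm (hs2 s hs).1.enorm
      _ ≤ _ := by
          rw [lintegral_norm_sq_modelKernel hlam hs]
          gcongr
          refine lintegral_mono fun w => pow_le_pow_left' ?_ 2
          exact enorm_le_iff_norm_le.2 (hle s hs w)
  funext z
  have hl : Tendsto (fun s : ℝ => ‖(Real.exp (-s * psi lam z) : ℂ) * f z‖ₑ ^ 2) (𝓝[>] 0)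
      (𝓝 (‖f z‖ₑ ^ 2)) := by
    have : Continuous fun s : ℝ => ‖(Real.exp (-s * psi lam z) : ℂ) * f z‖ₑ ^ 2 := by fun_prop
    have h := this.tendsto 0
    simp only [neg_zero, zero_mul, Real.exp_zero, Complex.ofReal_one, one_mul] at h
    exact h.mono_left nhdsWithin_le_nhds
  have hr : Tendsto (fun s : ℝ => ENNReal.ofReal (diagConst lam s) * N) (𝓝[>] 0) (𝓝 0) := by
    -- This is where `n ≥ 1` enters: for `n = 0` the product is empty and equals `1`.
    have h0 : diagConst lam 0 = 0 := by
      rw [diagConst]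
      exact Finset.prod_eq_zero (Finset.mem_univ ⟨0, hn⟩) (by simp)
    have h := ENNReal.tendsto_ofReal ((continuous_diagConst lam).tendsto 0)
    rw [h0, ENNReal.ofReal_zero] at h
    have := ENNReal.Tendsto.mul_const (b := N) h (Or.inr hN)
    rw [zero_mul] at this
    exact this.mono_left nhdsWithin_le_nhds
  have := le_of_tendsto_of_tendsto hl hr (by
    filter_upwards [self_mem_nhdsWithin] with s hs using hbound z s hs)
  simpa using this

end ModelKernel

/-! ### The weighted Bergman kernel in closed form. -/

section BergmanKernel

variable {n : ℕ}

theorem differentiable_holoRep {ψ : Cn n → ℝ} (f : bergmanSpace ψ) : Differentiable ℂ (holoRep f) :=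
  (Classical.choose_spec f.2).1

theorem ae_eq_holoRep {ψ : Cn n → ℝ} (f : bergmanSpace ψ) :
    (f : Lp ℂ 2 (weightedMeasure ψ)) =ᵐ[weightedMeasure ψ] holoRep f :=
  (Classical.choose_spec f.2).2

theorem ae_eq_weightedMeasure_iff {ψ : Cn n → ℝ} (hψ : Continuous ψ) {f g : Cn n → ℂ} :
    f =ᵐ[weightedMeasure ψ] g ↔ f =ᵐ[volume] g := by
  rw [weightedMeasure, withDensity_ae_eq (by fun_prop)]
  · rw [Filter.EventuallyEq, ae_muC]; rfl
  · refine ae_of_all _ fun z => ?_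
    simp [Real.exp_pos]

/-- The density is positive, so null sets are those of Lebesgue measure. This makes the holomorphic
representative independent of the choice in `holoRep`. -/
theorem eq_of_ae_eq_weightedMeasure {ψ : Cn n → ℝ} (hψ : Continuous ψ) {f g : Cn n → ℂ}
    (hf : Continuous f) (hg : Continuous g) (h : f =ᵐ[weightedMeasure ψ] g) : f = g :=
  (Continuous.ae_eq_iff_eq volume hf hg).1 ((ae_eq_weightedMeasure_iff hψ).1 h)

theorem memLp_weightedMeasure_iff {ψ : Cn n → ℝ} (hψ : Continuous ψ) {g : Cn n → ℂ}
    (hg : Continuous g) :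
    MemLp g 2 (weightedMeasure ψ) ↔ MemLp (fun z => (Real.exp (-ψ z) : ℂ) * g z) 2 (muC n) := by
  rw [memLp_two_iff hg.aestronglyMeasurable,
    memLp_two_iff (Continuous.aestronglyMeasurable (by fun_prop)), weightedMeasure,
    lintegral_withDensity_eq_lintegral_mul _ (by fun_prop) (by fun_prop)]
  refine not_congr (Eq.congr_left (lintegral_congr fun z => ?_))
  rw [Pi.mul_apply, enorm_mul, mul_pow]
  congr 1
  rw [← ofReal_norm, Complex.norm_real, Real.norm_of_nonneg (Real.exp_pos _).le,
    ← ENNReal.ofReal_pow (Real.exp_pos _).le, ← Real.exp_nat_mul]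
  congr 2
  push_cast; ring

theorem memLp_holoRep {ψ : Cn n → ℝ} (hψ : Continuous ψ) (f : bergmanSpace ψ) :
    MemLp (fun z => (Real.exp (-ψ z) : ℂ) * holoRep f z) 2 (muC n) :=
  (memLp_weightedMeasure_iff hψ (differentiable_holoRep f).continuous).1
    ((memLp_congr_ae (ae_eq_holoRep f)).1 (Lp.memLp _))

theorem inner_bergmanSpace {ψ : Cn n → ℝ} (hψ : Continuous ψ) (f g : bergmanSpace ψ) :
    ⟪f, g⟫_ℂ = ∫ z, (Real.exp (-2 * ψ z) : ℂ) * (conj (holoRep f z) * holoRep g z) ∂(muC n) := by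
  rw [Submodule.coe_inner, MeasureTheory.L2.inner_def]
  have : ∀ᵐ z ∂(weightedMeasure ψ), ⟪(f : Lp ℂ 2 (weightedMeasure ψ)) z,
      (g : Lp ℂ 2 (weightedMeasure ψ)) z⟫_ℂ = conj (holoRep f z) * holoRep g z := by
    filter_upwards [ae_eq_holoRep f, ae_eq_holoRep g] with z h1 h2
    rw [h1, h2, RCLike.inner_apply, mul_comm]
  rw [integral_congr_ae this, weightedMeasure,
    integral_withDensity_eq_integral_toReal_smul (by fun_prop) (by simp)]
  refine integral_congr_ae (ae_of_all _ fun z => ?_)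
  simp only [ENNReal.toReal_ofReal (Real.exp_pos _).le, Complex.real_smul]

/-- An element of the Bergman space given by an entire function. -/
theorem exists_bergmanSpace {ψ : Cn n → ℝ} (hψ : Continuous ψ) {g : Cn n → ℂ}
    (hg : Differentiable ℂ g) (h2 : MemLp (fun z => (Real.exp (-ψ z) : ℂ) * g z) 2 (muC n)) :
    ∃ f : bergmanSpace ψ, holoRep f = g := by
  have hm := (memLp_weightedMeasure_iff hψ hg.continuous).2 h2
  refine ⟨⟨hm.toLp g, g, hg, hm.coeFn_toLp⟩, ?_⟩
  refine eq_of_ae_eq_weightedMeasure hψ (differentiable_holoRep _).continuous hg.continuous ?_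
  exact (ae_eq_holoRep _).symm.trans hm.coeFn_toLp

/-- The Bergman kernel of the weight `tψ` in closed form. -/
theorem bergmanKernel_eq_modelKernel (hn : 1 ≤ n) {lam : Fin n → ℝ} (hlam : ∀ j, 0 < lam j) {t : ℝ}
    {ι : Type*} (s : HilbertBasis ι ℂ (bergmanSpace (fun z : Cn n => t * psi lam z))) (z w : Cn n) :
    bergmanKernel s z w = modelKernel lam t z w := by
  have hψ : Continuous fun z : Cn n => t * psi lam z := continuous_const.mul (continuous_psi lam)
  have hmem : ∀ f : bergmanSpace (fun z : Cn n => t * psi lam z),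
      MemLp (fun z => (Real.exp (-t * psi lam z) : ℂ) * holoRep f z) 2 (muC n) := by
    intro f
    simpa only [neg_mul] using memLp_holoRep hψ f
  by_cases ht : 0 < t
  -- The column of the model kernel at `w`, stripped of both weight factors; it will represent
  -- evaluation at `w`.
  · have hK : ∀ w, ∃ k : bergmanSpace (fun z : Cn n => t * psi lam z),
        holoRep k = fun z => (diagConst lam t : ℂ) * Complex.exp (2 * t * herm lam z w) := by
      intro w
      refine exists_bergmanSpace hψ ?_ ?_
      · refine Differentiable.const_mul (Differentiable.cexp ?_) _
        exact (differentiable_herm lam w).const_mul _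
      · refine ((memLp_modelKernel hlam ht w).const_mul
          (Real.exp (t * psi lam w) : ℂ)).congr_norm ?_ (ae_of_all _ fun z => ?_)
        · have := (continuous_herm lam).comp (Continuous.prodMk continuous_id
            (continuous_const (y := w)))
          refine Continuous.aestronglyMeasurable ?_
          refine Continuous.mul (by fun_prop) (Continuous.mul continuous_const ?_)
          exact Complex.continuous_exp.comp (continuous_const.mul this)
        · rw [← modelKernel_conj, norm_mul, RCLike.norm_conj, ← norm_mul, modelKernel_of_pos lam ht]
          congr 1
          have : Complex.exp (t * psi lam w) * Complex.exp (-(t * (psi lam z + psi lam w)) +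
              2 * t * herm lam z w) = Complex.exp (-(t * psi lam z)) *
              Complex.exp (2 * t * herm lam z w) := by
            rw [← Complex.exp_add, ← Complex.exp_add]; congr 1; ring
          push_cast
          linear_combination (diagConst lam t : ℂ) * this
    choose k hk using hK
    have hrep : ∀ (f : bergmanSpace (fun z : Cn n => t * psi lam z)) (w : Cn n),
        ⟪k w, f⟫_ℂ = holoRep f w := by
      intro f w
      have h := integral_modelKernel_mul hlam ht (differentiable_holoRep f) (hmem f) w
      have he : (Real.exp (-t * psi lam w) : ℂ) ≠ 0 := by exact_mod_cast (Real.exp_pos _).ne'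
      refine mul_left_cancel₀ he ?_
      rw [← h, inner_bergmanSpace hψ, ← integral_const_mul]
      refine integral_congr_ae (ae_of_all _ fun z => ?_)
      simp only [hk, map_mul, Complex.conj_ofReal, ← Complex.exp_conj, herm_conj,
        Complex.conj_ofNat]
      rw [modelKernel_of_pos lam ht]
      push_cast
      have : Complex.exp (-t * psi lam w) * (Complex.exp (-2 * (t * psi lam z)) *
          Complex.exp (2 * t * herm lam w z)) = Complex.exp (-(t * (psi lam w + psi lam z)) +
              2 * t * herm lam w z) * Complex.exp (-t * psi lam z) := by
        rw [← Complex.exp_add, ← Complex.exp_add, ← Complex.exp_add]; congr 1; ring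
      linear_combination (diagConst lam t : ℂ) * holoRep f z * this
    -- Parseval for `⟪k z, k w⟫`: its coefficients are the values of the basis functions at `z` and
    -- `w`, while the inner product itself is the value of `k w` at `z`.
    have hsum := s.hasSum_inner_mul_inner (k z) (k w)
    have hterm : ∀ j, ⟪k z, s j⟫_ℂ * ⟪s j, k w⟫_ℂ = holoRep (s j) z * conj (holoRep (s j) w) := by
      intro j
      rw [← inner_conj_symm (s j) (k w), hrep, hrep]
    simp only [hterm] at hsum
    simp only [hrep, hk] at hsum
    rw [bergmanKernel, hsum.tsum_eq, modelKernel_of_pos lam ht, Complex.exp_add]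
    push_cast
    rw [show -(t * (psi lam z + psi lam w) : ℂ) = -(t * psi lam z + t * psi lam w) by ring]
    ring
  · have h0 : ∀ f : bergmanSpace (fun z : Cn n => t * psi lam z), holoRep f = 0 := fun f =>
      eq_zero_of_memLp_of_nonpos hn hlam (not_lt.1 ht) (differentiable_holoRep f) (hmem f)
    simp [bergmanKernel, h0, modelKernel_of_nonpos lam (not_lt.1 ht)]

end BergmanKernel

/-! ### Schur's test for fiberwise integral operators. -/

section FiberIntegral

variable {n : ℕ}

/-- A family of kernels on `ℂⁿ` satisfying the hypotheses of Schur's test uniformly. -/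
structure IsSchurKernel (K : ℝ → Cn n → Cn n → ℂ) : Prop where
  measurable : Measurable fun p : ℝ × Cn n × Cn n => K p.1 p.2.1 p.2.2
  bound_left : ∀ t z, ∫⁻ w, ‖K t z w‖ₑ ∂(muC n) ≤ 2 ^ n
  bound_right : ∀ t w, ∫⁻ z, ‖K t z w‖ₑ ∂(muC n) ≤ 2 ^ n

theorem isSchurKernel_modelKernel {lam : Fin n → ℝ} (hlam : ∀ j, 0 < lam j) :
    IsSchurKernel (modelKernel lam) :=
  ⟨measurable_modelKernel lam, lintegral_norm_modelKernel_le hlam,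
    lintegral_norm_modelKernel_le' hlam⟩

theorem IsSchurKernel.swap {K : ℝ → Cn n → Cn n → ℂ} (hK : IsSchurKernel K) :
    IsSchurKernel fun t z w => K t w z :=
  ⟨hK.measurable.comp (f := fun p : ℝ × Cn n × Cn n => (p.1, p.2.2, p.2.1)) (by fun_prop),
    hK.bound_right, hK.bound_left⟩

/-- The fiberwise integral operator with kernel `K`. -/
def fiberIntegral (K : ℝ → Cn n → Cn n → ℂ) (a : H n → ℂ) (x : H n) : ℂ :=
  ∫ w, K x.2 x.1 w * a (w, x.2) ∂(muC n)

/-- The fiberwise integral of absolute values. -/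
def fiberLIntegral (K : ℝ → Cn n → Cn n → ℂ) (a : H n → ℂ) (x : H n) : ℝ≥0∞ :=
  ∫⁻ w, ‖K x.2 x.1 w‖ₑ * ‖a (w, x.2)‖ₑ ∂(muC n)

section

variable {K : ℝ → Cn n → Cn n → ℂ} {a b : H n → ℂ}

theorem IsSchurKernel.measurable_slice (hK : IsSchurKernel K) (t : ℝ) (z : Cn n) : Measurable fun w => K t z w :=
  hK.measurable.comp (measurable_const.prodMk (measurable_const.prodMk measurable_id))

theorem IsSchurKernel.measurable_pullback (hK : IsSchurKernel K) :
    Measurable fun q : H n × Cn n => K q.1.2 q.1.1 q.2 :=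
  hK.measurable.comp (f := fun q : H n × Cn n => (q.1.2, q.1.1, q.2)) (by fun_prop)

theorem measurable_fiberLIntegral (hK : IsSchurKernel K) (ha : StronglyMeasurable a) :
    Measurable (fiberLIntegral K a) := by
  refine Measurable.lintegral_prod_right' (f := fun q : H n × Cn n =>
    ‖K q.1.2 q.1.1 q.2‖ₑ * ‖a (q.2, q.1.2)‖ₑ) ?_
  exact hK.measurable_pullback.enorm.mul
    (ha.measurable.comp (f := fun q : H n × Cn n => (q.2, q.1.2)) (by fun_prop)).enorm

theorem stronglyMeasurable_fiberIntegral (hK : IsSchurKernel K) (ha : StronglyMeasurable a) :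
    StronglyMeasurable (fiberIntegral K a) := by
  refine StronglyMeasurable.integral_prod_right' (f := fun q : H n × Cn n =>
    K q.1.2 q.1.1 q.2 * a (q.2, q.1.2)) ?_
  exact (hK.measurable_pullback.mul
    (ha.measurable.comp (f := fun q : H n × Cn n => (q.2, q.1.2)) (by fun_prop))).stronglyMeasurable

theorem enorm_fiberIntegral_le (x : H n) : ‖fiberIntegral K a x‖ₑ ≤ fiberLIntegral K a x := by
  refine (enorm_integral_le_lintegral_enorm _).trans_eq ?_
  simp only [enorm_mul, fiberLIntegral]

/-- The first half of Schur's test: write `|K| = |K|^{1/2} |K|^{1/2}`, apply Cauchy–Schwarz and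
bound the row integral. -/
theorem fiberLIntegral_sq_le (hK : IsSchurKernel K) (ha : StronglyMeasurable a) (x : H n) :
    fiberLIntegral K a x ^ 2 ≤
      2 ^ n * ∫⁻ w, ‖K x.2 x.1 w‖ₑ * ‖a (w, x.2)‖ₑ ^ 2 ∂(muC n) := by
  have hk : Measurable fun w => ‖K x.2 x.1 w‖ₑ := (hK.measurable_slice x.2 x.1).enorm
  have haw : Measurable fun w => ‖a (w, x.2)‖ₑ :=
    (ha.measurable.comp (f := fun w : Cn n => (w, x.2)) (by fun_prop)).enorm
  have hsq : ∀ c : ℝ≥0∞, (c ^ (1 / 2 : ℝ)) ^ 2 = c := by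
    intro c
    rw [← ENNReal.rpow_natCast, ← ENNReal.rpow_mul]
    norm_num
  have h := lintegral_mul_sq_le (ν := muC n)
    (f := fun w => ‖K x.2 x.1 w‖ₑ ^ (1 / 2 : ℝ))
    (g := fun w => ‖K x.2 x.1 w‖ₑ ^ (1 / 2 : ℝ) * ‖a (w, x.2)‖ₑ)
    (hk.pow_const _).aemeasurable ((hk.pow_const _).mul haw).aemeasurable
  simp only [mul_pow, hsq, ← mul_assoc, ← pow_two] at h
  exact h.trans (mul_le_mul_left (hK.bound_left _ _) _)

/-- The second half: Tonelli puts the `z` integral inside, where the column bound applies.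
Uniformity in `t` lets the fibers be integrated together. -/
theorem lintegral_fiberLIntegral_sq_le (hK : IsSchurKernel K) (ha : StronglyMeasurable a) :
    ∫⁻ x, fiberLIntegral K a x ^ 2 ∂(muH n) ≤ 2 ^ n * 2 ^ n * ∫⁻ x, ‖a x‖ₑ ^ 2 ∂(muH n) := by
  have hm : Measurable fun q : H n × Cn n => ‖K q.1.2 q.1.1 q.2‖ₑ * ‖a (q.2, q.1.2)‖ₑ ^ 2 :=
    hK.measurable_pullback.enorm.mul
      ((ha.measurable.comp (f := fun q : H n × Cn n => (q.2, q.1.2)) (by fun_prop)).enorm.pow_const 2)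
  calc _ ≤ ∫⁻ x, 2 ^ n * ∫⁻ w, ‖K x.2 x.1 w‖ₑ * ‖a (w, x.2)‖ₑ ^ 2 ∂(muC n) ∂(muH n) :=
        lintegral_mono fun x => fiberLIntegral_sq_le hK ha x
    _ = 2 ^ n * ∫⁻ t : ℝ, ∫⁻ z, ∫⁻ w, ‖K t z w‖ₑ * ‖a (w, t)‖ₑ ^ 2 ∂(muC n) ∂(muC n) := by
        rw [lintegral_const_mul _ hm.lintegral_prod_right', muH,
          lintegral_prod_symm _ hm.lintegral_prod_right'.aemeasurable]
    _ = 2 ^ n * ∫⁻ t : ℝ, ∫⁻ w, ∫⁻ z, ‖K t z w‖ₑ * ‖a (w, t)‖ₑ ^ 2 ∂(muC n) ∂(muC n) := by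
        congr 1
        refine lintegral_congr fun t => lintegral_lintegral_swap ?_
        exact (hm.comp (f := fun q : Cn n × Cn n => ((q.1, t), q.2)) (by fun_prop)).aemeasurable
    _ ≤ 2 ^ n * ∫⁻ t : ℝ, ∫⁻ w, 2 ^ n * ‖a (w, t)‖ₑ ^ 2 ∂(muC n) := by
        gcongr with t w
        rw [lintegral_mul_const'' _ (hK.swap.measurable_slice t w).enorm.aemeasurable]
        gcongr
        exact hK.bound_right t w
    _ = _ := by
        have hm2 : Measurable fun x : H n => ‖a x‖ₑ ^ 2 := ha.enorm.pow_const 2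
        rw [mul_assoc, muH, lintegral_prod_symm _ hm2.aemeasurable,
          ← lintegral_const_mul _ hm2.lintegral_prod_left']
        congr 1
        refine lintegral_congr fun t => ?_
        exact lintegral_const_mul _ (hm2.comp (f := fun w : Cn n => (w, t)) (by fun_prop))

theorem lintegral_fiberLIntegral_sq_ne_top (hK : IsSchurKernel K) (ha : StronglyMeasurable a) (h2 : MemLp a 2 (muH n)) :
    ∫⁻ x, fiberLIntegral K a x ^ 2 ∂(muH n) ≠ ⊤ :=
  ne_top_of_le_ne_top (ENNReal.mul_ne_top (by finiteness) ((memLp_two_iff h2.1).1 h2))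
    (lintegral_fiberLIntegral_sq_le hK ha)

theorem memLp_fiberIntegral (hK : IsSchurKernel K) (ha : StronglyMeasurable a) (h2 : MemLp a 2 (muH n)) :
    MemLp (fiberIntegral K a) 2 (muH n) := by
  rw [memLp_two_iff (stronglyMeasurable_fiberIntegral hK ha).aestronglyMeasurable]
  refine ne_top_of_le_ne_top (lintegral_fiberLIntegral_sq_ne_top hK ha h2)
    (lintegral_mono fun x => pow_le_pow_left' (enorm_fiberIntegral_le x) 2)

/-- The integral of absolute values is itself square integrable, hence finite almost everywhere. -/
theorem ae_integrable_fiber (hK : IsSchurKernel K) (ha : StronglyMeasurable a) (h2 : MemLp a 2 (muH n)) :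
    ∀ᵐ x ∂(muH n), Integrable (fun w => K x.2 x.1 w * a (w, x.2)) (muC n) := by
  have h := ae_lt_top ((measurable_fiberLIntegral hK ha).pow_const 2)
    (lintegral_fiberLIntegral_sq_ne_top hK ha h2)
  filter_upwards [h] with x hx
  refine ⟨((hK.measurable_slice _ _).mul
    (ha.measurable.comp (f := fun w : Cn n => (w, x.2)) (by fun_prop))).aestronglyMeasurable, ?_⟩
  rw [HasFiniteIntegral]
  simp only [enorm_mul]
  change fiberLIntegral K a x < ⊤
  by_contra hc
  rw [not_lt, top_le_iff] at hc
  simp [hc] at hx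

/-- Fubini's theorem for the pairing of a fiberwise integral with a square integrable function. -/
theorem integral_fiberIntegral_mul (hK : IsSchurKernel K) (ha : StronglyMeasurable a) (hb : StronglyMeasurable b)
    (h2a : MemLp a 2 (muH n)) (h2b : MemLp b 2 (muH n)) :
    ∫ x, fiberIntegral K a x * b x ∂(muH n) =
      ∫ x, a x * fiberIntegral (fun t z w => K t w z) b x ∂(muH n) := by
  have i₁ : Integrable (fun x => fiberIntegral K a x * b x) ((muC n).prod volume) :=
    (memLp_fiberIntegral hK ha h2a).integrable_mul h2b
  have i₂ : Integrable (fun x => a x * fiberIntegral (fun t z w => K t w z) b x)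
    ((muC n).prod volume) := h2a.integrable_mul (memLp_fiberIntegral hK.swap hb h2b)
  -- Absolute convergence of the triple integral, by Cauchy–Schwarz and Schur; it justifies the
  -- exchange on almost every fiber.
  have hfin : ∫⁻ x, fiberLIntegral K a x * ‖b x‖ₑ ∂(muH n) ≠ ⊤ := by
    have h := lintegral_mul_sq_le (ν := muH n) (measurable_fiberLIntegral hK ha).aemeasurable
      hb.enorm.aemeasurable
    intro htop
    rw [htop] at h
    refine (ENNReal.mul_lt_top (lintegral_fiberLIntegral_sq_ne_top hK ha h2a).lt_top
      ((memLp_two_iff h2b.1).1 h2b).lt_top).not_ge ?_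
    simpa using h
  have hma : Measurable fun q : H n × Cn n => a (q.2, q.1.2) :=
    ha.measurable.comp (f := fun q : H n × Cn n => (q.2, q.1.2)) (by fun_prop)
  have hmN : Measurable fun x => fiberLIntegral K a x * ‖b x‖ₑ :=
    (measurable_fiberLIntegral hK ha).mul hb.enorm
  change ∫⁻ x, fiberLIntegral K a x * ‖b x‖ₑ ∂((muC n).prod volume) ≠ ⊤ at hfin
  rw [lintegral_prod_symm _ hmN.aemeasurable] at hfin
  have hae := ae_lt_top hmN.lintegral_prod_left' hfin
  rw [muH, integral_prod_symm _ i₁, integral_prod_symm _ i₂]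
  refine integral_congr_ae ?_
  filter_upwards [hae] with t ht
  simp only [fiberIntegral, ← integral_mul_const, ← integral_const_mul]
  have hmF : Measurable fun q : Cn n × Cn n => K t q.1 q.2 * a (q.2, t) * b (q.1, t) :=
    ((hK.measurable_pullback.mul hma).comp (f := fun q : Cn n × Cn n => ((q.1, t), q.2))
      (by fun_prop)).mul (hb.measurable.comp (f := fun q : Cn n × Cn n => (q.1, t)) (by fun_prop))
  rw [integral_integral_swap]
  · refine integral_congr_ae (ae_of_all _ fun w => integral_congr_ae (ae_of_all _ fun z => ?_))
    simp only
    ring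
  · refine ⟨hmF.aestronglyMeasurable, ?_⟩
    rw [HasFiniteIntegral, lintegral_prod _ (by exact hmF.enorm.aemeasurable)]
    refine lt_of_eq_of_lt (lintegral_congr fun z => ?_) ht
    simp only [Function.uncurry, enorm_mul, fiberLIntegral]
    rw [lintegral_mul_const'' _]
    exact ((hK.measurable_slice t z).enorm.mul (ha.measurable.comp (f := fun w : Cn n => (w, t))
      (by fun_prop)).enorm).aemeasurable

theorem exists_isFiberwiseIntegral (hK : IsSchurKernel K) (a : L2 n) : ∃ v : L2 n, IsFiberwiseIntegral K a v := by
  have hm := memLp_fiberIntegral hK (Lp.stronglyMeasurable a) (Lp.memLp a)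
  refine ⟨hm.toLp _, ?_⟩
  filter_upwards [ae_integrable_fiber hK (Lp.stronglyMeasurable a) (Lp.memLp a),
    hm.coeFn_toLp] with x h1 h2
  exact ⟨h1, h2⟩

end

theorem IsFiberwiseIntegral.ae_eq {K : ℝ → Cn n → Cn n → ℂ} {a v : L2 n}
    (h : IsFiberwiseIntegral K a v) : v =ᵐ[muH n] fiberIntegral K a := by
  filter_upwards [h] with x hx using hx.2

theorem conj_fiberIntegral {K : ℝ → Cn n → Cn n → ℂ} (hsymm : ∀ t z w, conj (K t z w) = K t w z)
    (a : H n → ℂ) (x : H n) : conj (fiberIntegral K a x) =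
      fiberIntegral (fun t z w => K t w z) (fun y => conj (a y)) x := by
  simp only [fiberIntegral, ← integral_conj, map_mul, hsymm]

/-- A fiberwise integral operator with Hermitian kernel is symmetric. -/
theorem IsFiberwiseIntegral.inner_eq {K : ℝ → Cn n → Cn n → ℂ} (hK : IsSchurKernel K)
    (hsymm : ∀ t z w, conj (K t z w) = K t w z) {a v b v' : L2 n}
    (h : IsFiberwiseIntegral K a v) (h' : IsFiberwiseIntegral K b v') : ⟪v, b⟫_ℂ = ⟪a, v'⟫_ℂ := by
  have hac : StronglyMeasurable fun y => conj (a y) :=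
    Complex.continuous_conj.comp_stronglyMeasurable (Lp.stronglyMeasurable a)
  have := integral_fiberIntegral_mul hK.swap hac (Lp.stronglyMeasurable b)
    (Lp.memLp a).star (Lp.memLp b)
  rw [MeasureTheory.L2.inner_def, MeasureTheory.L2.inner_def]
  calc _ = ∫ x, fiberIntegral (fun t z w => K t w z) (fun y => conj (a y)) x * b x ∂(muH n) := by
        refine integral_congr_ae ?_
        filter_upwards [h.ae_eq] with x hx
        rw [hx, RCLike.inner_apply, conj_fiberIntegral hsymm, mul_comm]
    _ = _ := this
    _ = _ := by
        refine integral_congr_ae ?_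
        filter_upwards [h'.ae_eq] with x hx
        rw [hx, RCLike.inner_apply, mul_comm]

end FiberIntegral

/-! ### Partial transforms on the Heisenberg group and calculus of the CR vector fields. -/

section CRCalculus

variable {n : ℕ}

instance (n : ℕ) : (muH n).IsAddHaarMeasure := by unfold muH; infer_instance

theorem isPartialFourier_iff {χ : ℝ → ℝ} {u v : L2 n} :
    IsPartialFourier χ u v ↔ HasPartialFourier (μ := muC n) χ (-1) u v := by
  refine tendsto_congr fun k => ?_
  congr 1
  funext x
  rw [partialFourier]
  congr 2
  funext s
  rw [truncate]
  congr 2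
  push_cast; ring

/-- The factor `1 / 2π` is moved onto the limit, so that both transforms are instances of one
unnormalised transform with `σ = ±1`. -/
theorem isPartialFourierInv_iff {χ : ℝ → ℝ} {u v : L2 n} :
    IsPartialFourierInv χ u v ↔
      HasPartialFourier (μ := muC n) χ 1 u ((2 * Real.pi : ℂ) • v) := by
  have hpi : (2 * Real.pi : ℂ) ≠ 0 := by
    exact_mod_cast Real.two_pi_pos.ne'
  have e : ∀ k : ℕ, eLpNorm (fun x : H n => partialFourier 1 (truncate χ k u) x -
      ((2 * Real.pi : ℂ) • v : L2 n) x) 2 (muH n) = ‖(2 * Real.pi : ℂ)‖ₑ *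
        eLpNorm (fun x : H n => (1 / (2 * Real.pi) : ℂ) * (∫ s : ℝ, u (x.1, s) * (χ (s / k) : ℂ) *
          Complex.exp (Complex.I * s * x.2)) - v x) 2 (muH n) := by
    intro k
    rw [← eLpNorm_const_smul]
    refine eLpNorm_congr_ae ?_
    filter_upwards [Lp.coeFn_smul (2 * Real.pi : ℂ) v] with x hx
    rw [hx]
    simp only [Pi.smul_apply, smul_eq_mul, mul_sub]
    congr 1
    rw [← mul_assoc, mul_one_div_cancel hpi, one_mul, partialFourier]
    congr 1
    funext s
    rw [truncate]
    congr 2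
    push_cast; ring
  have hne : ‖(2 * Real.pi : ℂ)‖ₑ ≠ 0 := enorm_ne_zero.2 hpi
  constructor
  · intro h
    have := ENNReal.Tendsto.const_mul (a := ‖(2 * Real.pi : ℂ)‖ₑ) h (Or.inr enorm_ne_top)
    rw [mul_zero] at this
    exact this.congr fun k => (e k).symm
  · intro h
    have h' : Tendsto (fun k : ℕ => eLpNorm (fun x : H n => partialFourier 1 (truncate χ k u) x -
      ((2 * Real.pi : ℂ) • v : L2 n) x) 2 (muH n)) atTop (𝓝 0) := h
    have := ENNReal.Tendsto.const_mul (a := ‖(2 * Real.pi : ℂ)‖ₑ⁻¹) h'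
      (Or.inr (ENNReal.inv_ne_top.2 hne))
    rw [mul_zero] at this
    refine this.congr fun k => ?_
    rw [e, ← mul_assoc, ENNReal.inv_mul_cancel hne enorm_ne_top, one_mul]

/-- For functions of bounded support in the last variable, the partial Fourier transform is given by
the integral. -/
theorem HasPartialFourier.ae_eq {X : Type*} [MeasurableSpace X] {μ : Measure X} [SFinite μ]
    {χ : ℝ → ℝ} (hχ : IsCutoff χ) {σ : ℝ} (hσ : |σ| = 1)
    {u v : Lp ℂ 2 (μ.prod (volume : Measure ℝ))} (h : HasPartialFourier χ σ u v)
    {w : X × ℝ → ℂ} (hw : StronglyMeasurable w) (huw : u =ᵐ[μ.prod volume] w) {R : ℝ}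
    (hR : ∀ x s, R < |s| → w (x, s) = 0) : v =ᵐ[μ.prod volume] partialFourier σ w := by
  have hw2 : MemLp w 2 (μ.prod volume) := (memLp_congr_ae huw).1 (Lp.memLp u)
  have hP := memLp_partialFourier hw hw2 hR hσ
  suffices hlim : HasPartialFourier χ σ u (hP.toLp _) by
    rw [h.unique hχ hσ hlim]
    exact hP.coeFn_toLp
  -- Once `k ≥ |R|` the cutoff equals one on the support, so the sequence is eventually constant.
  refine tendsto_const_nhds.congr' ?_
  filter_upwards [eventually_ge_atTop (⌈|R|⌉₊ + 1)] with k hk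
  have hk' : |R| ≤ k := (Nat.le_ceil _).trans (by exact_mod_cast (by omega : ⌈|R|⌉₊ ≤ k))
  have h0 : (0 : ℝ) < k := by exact_mod_cast (by omega : 0 < k)
  have hsl := (Measure.quasiMeasurePreserving_fst (μ := μ) (ν := (volume : Measure ℝ))).ae
    (Measure.ae_ae_of_ae_prod huw)
  symm
  rw [← eLpNorm_zero (p := 2) (μ := μ.prod (volume : Measure ℝ)) (ε := ℂ)]
  refine eLpNorm_congr_ae ?_
  filter_upwards [hsl, hP.coeFn_toLp] with p h1 h2
  rw [h2, Pi.zero_apply, sub_eq_zero]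
  refine integral_congr_ae ?_
  filter_upwards [h1] with s hs
  rw [truncate, hs]
  by_cases hsR : R < |s|
  · rw [hR _ _ hsR]; ring
  · have : χ (s / k) = 1 := by
      refine hχ.2.1 _ ?_
      rw [abs_div, abs_of_pos h0, div_le_one h0]
      exact (not_lt.1 hsR).trans ((le_abs_self R).trans hk')
    rw [this]; simp

theorem exists_bound_snd {f : H n → ℂ} (hf : HasCompactSupport f) :
    ∃ R : ℝ, ∀ z s, R < |s| → f (z, s) = 0 := by
  obtain ⟨R, hR⟩ := hf.isCompact.isBounded.subset_closedBall 0
  refine ⟨R, fun z s hs => ?_⟩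
  by_contra hc
  have := hR (subset_tsupport _ hc)
  rw [mem_closedBall_zero_iff] at this
  exact absurd ((norm_snd_le (z, s)).trans this) (not_le.2 hs)

/-! ### Integration by parts for `Zbar` -/

variable (lam : Fin n → ℝ)

theorem continuous_Zbar {j : Fin n} {φ : H n → ℂ} (hφ : ContDiff ℝ ∞ φ) :
    Continuous (Zbar lam j φ) := by
  have hd : Continuous (fderiv ℝ φ) := hφ.continuous_fderiv (by simp)
  unfold Zbar; fun_prop

theorem hasCompactSupport_Zbar {j : Fin n} {φ : H n → ℂ} (hc : HasCompactSupport φ) :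
    HasCompactSupport (Zbar lam j φ) := by
  refine (hc.fderiv (𝕜 := ℝ)).mono ?_
  intro x hx
  rw [Function.mem_support] at hx ⊢
  intro h
  exact hx (by simp [Zbar, h])

theorem integral_mul_fderiv {E φ : H n → ℂ} (hE : ContDiff ℝ ∞ E) (hφ : ContDiff ℝ ∞ φ)
    (hc : HasCompactSupport φ) (v : H n) :
    ∫ x, E x * fderiv ℝ φ x v ∂(muH n) = -∫ x, fderiv ℝ E x v * φ x ∂(muH n) := by
  have hcE := hE.continuous
  have hcφ := hφ.continuous
  have hE' : Continuous fun x => fderiv ℝ E x v :=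
    (hE.continuous_fderiv (by simp)).clm_apply continuous_const
  have hφ' : Continuous fun x => fderiv ℝ φ x v :=
    (hφ.continuous_fderiv (by simp)).clm_apply continuous_const
  exact integral_mul_fderiv_eq_neg_fderiv_mul_of_integrable
    ((hE'.mul hcφ).integrable_of_hasCompactSupport hc.mul_left)
    ((hcE.mul hφ').integrable_of_hasCompactSupport (hc.fderiv_apply (𝕜 := ℝ) v).mul_left)
    ((hcE.mul hcφ).integrable_of_hasCompactSupport hc.mul_left)
    (fun x _ => hE.differentiable (by simp) x) (fun x _ => hφ.differentiable (by simp) x)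

theorem integral_linear_comb {α : Type*} [MeasurableSpace α] {ν : Measure α} {f g h : α → ℂ}
    (hf : Integrable f ν) (hg : Integrable g ν) (hh : Integrable h ν) {c d : ℂ} :
    ∫ x, (c * f x + d * g x) + h x ∂ν = c * ∫ x, f x ∂ν + d * ∫ x, g x ∂ν + ∫ x, h x ∂ν := by
  have hfg : Integrable (fun x => c * f x + d * g x) ν := (hf.const_mul c).add (hg.const_mul d)
  rw [integral_add hfg hh, integral_add (hf.const_mul c) (hg.const_mul d), integral_const_mul,
    integral_const_mul]

/-- The formal transpose of `Zbar` is its negative. -/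
theorem integral_mul_Zbar {j : Fin n} {E φ : H n → ℂ} (hE : ContDiff ℝ ∞ E) (hφ : ContDiff ℝ ∞ φ)
    (hc : HasCompactSupport φ) :
    ∫ x, E x * Zbar lam j φ x ∂(muH n) = -∫ x, Zbar lam j E x * φ x ∂(muH n) := by
  have hcE := hE.continuous
  have hcφ := hφ.continuous
  have hE' : ∀ v, Continuous fun x => fderiv ℝ E x v := fun v =>
    (hE.continuous_fderiv (by simp)).clm_apply continuous_const
  have hφ' : ∀ v, Continuous fun x => fderiv ℝ φ x v := fun v =>
    (hφ.continuous_fderiv (by simp)).clm_apply continuous_const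
  have iφ : ∀ (F : H n → ℂ) v, Continuous F → Integrable (fun x => F x * fderiv ℝ φ x v) (muH n) :=
    fun F v hF => (hF.mul (hφ' v)).integrable_of_hasCompactSupport
      (hc.fderiv_apply (𝕜 := ℝ) v).mul_left
  have iE : ∀ (F : H n → ℂ), Continuous F → Integrable (fun x => F x * φ x) (muH n) :=
    fun F hF => (hF.mul hcφ).integrable_of_hasCompactSupport hc.mul_left
  -- The coefficient `z_j` does not depend on `x_{2n+1}` and can be absorbed into `E` before
  -- integrating by parts in that variable.
  set G : H n → ℂ := fun x => Complex.I * (lam j : ℂ) * x.1 j * E x with hG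
  have hzd : ContDiff ℝ ∞ fun x : H n => x.1 j := (contDiff_apply ℝ ℂ j).comp contDiff_fst
  have hGd : ContDiff ℝ ∞ G := (contDiff_const.mul hzd).mul hE
  have hGder : ∀ x, fderiv ℝ G x (0, 1) = Complex.I * (lam j : ℂ) * x.1 j * fderiv ℝ E x (0, 1) := by
    intro x
    have hl : fderiv ℝ (fun x : H n => Complex.I * (lam j : ℂ) * x.1 j) x (0, 1) = 0 := by
      set L : H n →L[ℝ] ℂ := (ContinuousLinearMap.proj (R := ℝ)
        (φ := fun _ : Fin n => ℂ) j).comp (ContinuousLinearMap.fst ℝ (Cn n) ℝ)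
      have h1 : HasFDerivAt (fun x : H n => x.1 j) L x := L.hasFDerivAt
      rw [(h1.const_mul (Complex.I * (lam j : ℂ))).fderiv]
      simp [L]
    have h2 := fderiv_fun_mul (x := x) ((contDiff_const (c := Complex.I * (lam j : ℂ))).mul hzd
      |>.differentiable (by simp) x) (hE.differentiable (by simp) x)
    rw [hG, h2]
    simp [hl]
  have e1 := integral_mul_fderiv hE hφ hc (Pi.single j 1, 0)
  have e2 := integral_mul_fderiv hE hφ hc (Pi.single j Complex.I, 0)
  have e3 := integral_mul_fderiv hGd hφ hc (0, 1)
  simp only [hGder] at e3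
  calc _ = ∫ x, ((1 / 2 : ℂ) * (E x * fderiv ℝ φ x (Pi.single j 1, 0)) +
        (1 / 2 * Complex.I : ℂ) * (E x * fderiv ℝ φ x (Pi.single j Complex.I, 0))) +
        G x * fderiv ℝ φ x (0, 1) ∂(muH n) := by
        refine integral_congr_ae (ae_of_all _ fun x => ?_)
        simp only [Zbar, hG]; ring
    _ = -((1 / 2 : ℂ) * ∫ x, fderiv ℝ E x (Pi.single j 1, 0) * φ x ∂(muH n)) -
        ((1 / 2 * Complex.I : ℂ) * ∫ x, fderiv ℝ E x (Pi.single j Complex.I, 0) * φ x ∂(muH n)) -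
        ∫ x, Complex.I * (lam j : ℂ) * x.1 j * fderiv ℝ E x (0, 1) * φ x ∂(muH n) := by
        rw [integral_linear_comb (iφ _ _ hcE) (iφ _ _ hcE) (iφ _ _ hGd.continuous), e1, e2, e3]
        ring
    _ = -∫ x, ((1 / 2 : ℂ) * (fderiv ℝ E x (Pi.single j 1, 0) * φ x) +
        (1 / 2 * Complex.I : ℂ) * (fderiv ℝ E x (Pi.single j Complex.I, 0) * φ x)) +
        Complex.I * (lam j : ℂ) * x.1 j * fderiv ℝ E x (0, 1) * φ x ∂(muH n) := by
        have i3 : Integrable (fun x : H n => Complex.I * (lam j : ℂ) * x.1 j *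
            fderiv ℝ E x (0, 1) * φ x) (muH n) :=
          iE _ (((continuous_const.mul hzd.continuous)).mul (hE' _))
        rw [integral_linear_comb (iE _ (hE' _)) (iE _ (hE' _)) i3]
        ring
    _ = _ := by
        congr 1
        refine integral_congr_ae (ae_of_all _ fun x => ?_)
        simp only [Zbar]; ring

/-! ### Explicit CR functions -/

/-- The CR functions `exp (-τ ψ(z) + 2 τ ∑ λ_j z_j conj(w_j) - i τ s)`. -/
def planeWave (τ : ℝ) (w : Cn n) (x : H n) : ℂ :=
  Complex.exp (-(τ * psi lam x.1) + 2 * τ * herm lam x.1 w - Complex.I * τ * x.2)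

theorem contDiff_psi : ContDiff ℝ ∞ (psi lam) := by
  unfold psi
  refine ContDiff.sum fun j _ => contDiff_const.mul ?_
  exact (contDiff_norm_sq ℝ (E := ℂ)).comp (contDiff_apply ℝ ℂ j)

theorem contDiff_planeWave_exponent (τ : ℝ) (w : Cn n) : ContDiff ℝ ∞ fun x : H n =>
    -((τ : ℂ) * psi lam x.1) + 2 * τ * herm lam x.1 w - Complex.I * τ * x.2 := by
  have h1 : ContDiff ℝ ∞ fun x : H n => (psi lam x.1 : ℂ) :=
    Complex.ofRealCLM.contDiff.comp ((contDiff_psi lam).comp contDiff_fst)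
  have h2 : ContDiff ℝ ∞ fun x : H n => herm lam x.1 w := by
    unfold herm
    refine ContDiff.sum fun j _ => (contDiff_const.mul ?_).mul contDiff_const
    exact (contDiff_apply ℝ ℂ j).comp contDiff_fst
  have h3 : ContDiff ℝ ∞ fun x : H n => (x.2 : ℂ) := Complex.ofRealCLM.contDiff.comp contDiff_snd
  exact ((contDiff_const.mul h1).neg.add (contDiff_const.mul h2)).sub (contDiff_const.mul h3)

theorem contDiff_planeWave (τ : ℝ) (w : Cn n) : ContDiff ℝ ∞ (planeWave lam τ w) :=
  (contDiff_planeWave_exponent lam τ w).cexp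

/-- Along a line the exponent is a quadratic polynomial in the parameter; its linear coefficient is
the logarithmic derivative. -/
theorem fderiv_planeWave (τ : ℝ) (w : Cn n) (x v : H n) :
    fderiv ℝ (planeWave lam τ w) x v = planeWave lam τ w x *
      (-(τ * (herm lam x.1 v.1 + herm lam v.1 x.1)) + 2 * τ * herm lam v.1 w -
        Complex.I * τ * v.2) := by
  have hd := (contDiff_planeWave lam τ w).differentiable (by simp) x
  rw [← hd.lineDeriv_eq_fderiv]
  refine HasLineDerivAt.lineDeriv ?_
  have hs : ∀ (r : ℝ) (a b : Cn n), herm lam (r • a) b = r * herm lam a b := by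
    intro r a b
    simp only [herm, Finset.mul_sum, Pi.smul_apply, Complex.real_smul]
    exact Finset.sum_congr rfl fun j _ => by ring
  have hs' : ∀ (r : ℝ) (a b : Cn n), herm lam a (r • b) = r * herm lam a b := by
    intro r a b
    rw [← herm_conj, hs, map_mul, herm_conj, Complex.conj_ofReal]
  have e : ∀ r : ℝ, planeWave lam τ w (x + r • v) = Complex.exp
      ((-(τ * psi lam x.1) + 2 * τ * herm lam x.1 w - Complex.I * τ * x.2) +
        (r : ℂ) * (-(τ * (herm lam x.1 v.1 + herm lam v.1 x.1)) + 2 * τ * herm lam v.1 w -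
        Complex.I * τ * v.2) + (r : ℂ) ^ 2 * -(τ * herm lam v.1 v.1)) := by
    intro r
    rw [planeWave, ← herm_self, ← herm_self]
    congr 1
    simp only [Prod.fst_add, Prod.smul_fst, Prod.snd_add, Prod.smul_snd, herm_add_left,
      herm_add_right, hs, hs', smul_eq_mul, Complex.ofReal_add, Complex.ofReal_mul]
    ring
  rw [HasLineDerivAt]
  simp only [e]
  have hr : HasDerivAt (fun r : ℝ => (r : ℂ)) 1 0 := Complex.ofRealCLM.hasDerivAt
  have := (((hr.mul_const (-(τ * (herm lam x.1 v.1 + herm lam v.1 x.1)) +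
    2 * τ * herm lam v.1 w - Complex.I * τ * v.2)).const_add
      (-(τ * psi lam x.1) + 2 * τ * herm lam x.1 w - Complex.I * τ * x.2)).add
        ((hr.pow 2).mul_const (-(τ * herm lam v.1 v.1)))).cexp
  convert! this using 1
  simp [planeWave]

theorem herm_single_right (z : Cn n) (j : Fin n) (c : ℂ) :
    herm lam z (Pi.single j c) = lam j * z j * conj c := by
  rw [herm, Finset.sum_eq_single j]
  · simp
  · intro i _ hi
    simp [hi]
  · simp

/-- On functions `f(z) e^{-iτs}` the field acts as `e^{-τψ} ∂/∂z̄_j e^{τψ}`, and `exp (2τ ∑ λ_j z_j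
conj(w_j))` is holomorphic in `z`. The sign of `τ` plays no role. -/
theorem Zbar_planeWave (τ : ℝ) (w : Cn n) (j : Fin n) (x : H n) :
    Zbar lam j (planeWave lam τ w) x = 0 := by
  have hl : ∀ (z : Cn n) (c : ℂ), herm lam (Pi.single j c) z = lam j * conj (z j) * c := by
    intro z c
    rw [← herm_conj, herm_single_right]
    simp
  have hz : ∀ z : Cn n, herm lam z 0 = 0 := fun z => by simp [herm]
  have hz' : ∀ z : Cn n, herm lam 0 z = 0 := fun z => by simp [herm]
  simp only [Zbar, fderiv_planeWave, hl, herm_single_right, hz, hz', Complex.conj_I, map_one,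
    Complex.ofReal_zero, Complex.ofReal_one]
  linear_combination (planeWave lam τ w x) * (1 / 2 * (-(τ * lam j * conj (x.1 j)) +
    τ * lam j * x.1 j + 2 * τ * lam j * conj (w j)) - τ * lam j * x.1 j) * Complex.I_mul_I

end CRCalculus

/-! ### The range of `P̃` and the truncated CR equation. -/

section Range

variable {n : ℕ} {lam : Fin n → ℝ}

theorem mem_kerKohn_iff {u : L2 n} : u ∈ kerKohn lam ↔
    ∀ (j : Fin n) (φ : H n → ℂ), ContDiff ℝ ∞ φ → HasCompactSupport φ →
      ∫ x, u x * Zbar lam j φ x ∂(muH n) = 0 :=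
  (isKohnLaplacian_zero_iff lam u).trans (isDbar_zero_iff lam u)

/-- The operator `P̃` has its range in the kernel of the Kohn Laplacian. -/
theorem mem_kerKohn_of_isFiberwiseIntegral (hlam : ∀ j, 0 < lam j) {χ : ℝ → ℝ} (hχ : IsCutoff χ)
    {a v h : L2 n} (hv : IsFiberwiseIntegral (modelKernel lam) a v)
    (hh : IsPartialFourier χ v h) : h ∈ kerKohn lam := by
  rw [mem_kerKohn_iff]
  intro j φ hφ hc
  have hσ : |(-1 : ℝ)| = 1 := by simp
  have hFc := continuous_Zbar lam (j := j) hφ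
  have hFs := hasCompactSupport_Zbar lam (j := j) hc
  have hFm := memLp_Zbar lam j hφ hc
  obtain ⟨R, hR⟩ := exists_bound_snd hFs
  have hFsm : StronglyMeasurable (Zbar lam j φ) := hFc.stronglyMeasurable
  obtain ⟨w, hw⟩ := exists_hasPartialFourier (μ := muC n) hχ hσ (hFm.toLp _)
  have hwae := hw.ae_eq hχ hσ hFsm hFm.coeFn_toLp hR
  have e1 := (isPartialFourier_iff.1 hh).integral_mul hχ hσ hw
  have e2 : ∫ x, h x * Zbar lam j φ x ∂(muH n) = ∫ x, h x * (hFm.toLp _ : L2 n) x ∂(muH n) := by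
    refine integral_congr_ae ?_
    filter_upwards [hFm.coeFn_toLp] with x hx
    rw [hx]
  have hPm : MemLp (partialFourier (-1) (Zbar lam j φ)) 2 (muH n) :=
    memLp_partialFourier hFsm hFm hR hσ
  have e3 : ∫ x, v x * w x ∂(muH n) =
      ∫ x, fiberIntegral (modelKernel lam) a x * partialFourier (-1) (Zbar lam j φ) x ∂(muH n) := by
    refine integral_congr_ae ?_
    filter_upwards [hv.ae_eq, hwae] with x h1 h2
    rw [h1, h2]
  rw [e2]
  refine e1.trans (e3.trans ?_)
  rw [integral_fiberIntegral_mul (isSchurKernel_modelKernel hlam) (Lp.stronglyMeasurable a)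
    (stronglyMeasurable_partialFourier _ hFsm) (Lp.memLp a) hPm]
  refine integral_eq_zero_of_ae (ae_of_all _ fun y => ?_)
  obtain ⟨w₀, t⟩ := y
  -- The transform and the kernel have both been moved to the test side. It remains to see that the
  -- kernel annihilates the transform of `Zbar lam j φ` at every point.
  suffices h0 : fiberIntegral (fun t z w => modelKernel lam t w z)
      (partialFourier (-1) (Zbar lam j φ)) (w₀, t) = 0 by simp [h0]
  simp only [fiberIntegral]
  by_cases ht : 0 < t
  · have hcont := (contDiff_planeWave lam t w₀).continuous
    have hint : Integrable (fun x => planeWave lam t w₀ x * Zbar lam j φ x)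
        ((muC n).prod volume) :=
      (hcont.mul hFc).integrable_of_hasCompactSupport (μ := muH n) hFs.mul_left
    have hz : ∫ x, planeWave lam t w₀ x * Zbar lam j φ x ∂(muH n) = 0 := by
      rw [integral_mul_Zbar lam (contDiff_planeWave lam t w₀) hφ hc]
      simp [Zbar_planeWave]
    rw [muH, integral_prod _ hint] at hz
    -- The column of the kernel times `e^{-ist}` is a constant multiple of a plane wave, so the
    -- integral over `z` is the pairing `hz`, which vanishes.
    have e : ∀ z, modelKernel lam t z w₀ * partialFourier (-1) (Zbar lam j φ) (z, t) =
        (diagConst lam t * Complex.exp (-(t * psi lam w₀)) : ℂ) *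
          ∫ s, planeWave lam t w₀ (z, s) * Zbar lam j φ (z, s) := by
      intro z
      rw [partialFourier, ← integral_const_mul, ← integral_const_mul]
      congr 1
      funext s
      rw [modelKernel_of_pos lam ht, planeWave]
      have : Complex.exp (-(t * (psi lam z + psi lam w₀)) + 2 * t * herm lam z w₀) *
          Complex.exp ((-1 * s * t : ℝ) * Complex.I) = Complex.exp (-(t * psi lam w₀)) *
          Complex.exp (-(t * psi lam z) + 2 * t * herm lam z w₀ - Complex.I * t * s) := by
        rw [← Complex.exp_add, ← Complex.exp_add]; congr 1; push_cast; ring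
      linear_combination (diagConst lam t : ℂ) * Zbar lam j φ (z, s) * this
    simp only [e, integral_const_mul, hz, mul_zero]
  · simp [modelKernel_of_nonpos lam (not_lt.1 ht)]

theorem fderiv_mul_cutoff {χ : ℝ → ℝ} (hχ : ContDiff ℝ ∞ χ) {ρ : Cn n → ℂ} (hρ : ContDiff ℝ ∞ ρ)
    (k : ℝ) (x v : H n) :
    fderiv ℝ (fun y : H n => ρ y.1 * (χ (y.2 / k) : ℂ)) x v =
      fderiv ℝ ρ x.1 v.1 * (χ (x.2 / k) : ℂ) + ρ x.1 * (deriv χ (x.2 / k) * (v.2 / k) : ℝ) := by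
  have h1 : HasFDerivAt (fun y : H n => ρ y.1)
      ((fderiv ℝ ρ x.1).comp (ContinuousLinearMap.fst ℝ (Cn n) ℝ)) x :=
    ((hρ.differentiable (by simp)) x.1).hasFDerivAt.comp x hasFDerivAt_fst
  have h2 : HasDerivAt (fun s : ℝ => (χ (s / k) : ℂ)) ((deriv χ (x.2 / k) * (1 / k) : ℝ) : ℂ) x.2 :=
    (((hχ.differentiable (by simp)) (x.2 / k)).hasDerivAt.comp x.2
      ((hasDerivAt_id x.2).div_const k)).ofReal_comp
  have h3 : HasFDerivAt (fun y : H n => (χ (y.2 / k) : ℂ)) _ x :=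
    h2.hasFDerivAt.comp x hasFDerivAt_snd
  have h4 : HasFDerivAt (fun y : H n => ρ y.1 * (χ (y.2 / k) : ℂ)) _ x := h1.mul h3
  rw [h4.fderiv]
  simp only [add_apply, smul_apply,
    ContinuousLinearMap.comp_apply, ContinuousLinearMap.coe_fst', ContinuousLinearMap.coe_snd',
    smul_eq_mul, ContinuousLinearMap.toSpanSingleton_apply, Complex.real_smul]
  push_cast
  ring

/-- The equation satisfied by the truncated partial Fourier transforms of a CR function. -/
theorem integral_dbar_truncate {χ : ℝ → ℝ} (hχ : IsCutoff χ) {g : L2 n} (hg : g ∈ kerKohn lam)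
    {k : ℕ} (hk : 0 < k) (t : ℝ) (j : Fin n) {ρ : Cn n → ℂ} (hρ : ContDiff ℝ ∞ ρ)
    (hρc : HasCompactSupport ρ) :
    Integrable (fun z => (Real.exp (t * psi lam z) : ℂ) * (1 / 2 * dbar j ρ z) *
      partialFourier 1 (truncate χ k g) (z, t)) (muC n) ∧
    ∫ z, (Real.exp (t * psi lam z) : ℂ) * (1 / 2 * dbar j ρ z) *
        partialFourier 1 (truncate χ k g) (z, t) ∂(muC n) =
      -∫ z, (Real.exp (t * psi lam z) : ℂ) * (Complex.I * lam j * z j * ρ z) *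
        ((1 / k : ℂ) * partialFourier 1 (truncate (deriv χ) k g) (z, t)) ∂(muC n) := by
  have h0 : (0 : ℝ) < k := by exact_mod_cast hk
  -- This is `e^{tψ} e^{ist}`: it supplies both the weight and the Fourier kernel. Being CR, it
  -- passes through `Zbar` as a factor, so `E φ` is an admissible test function for the equation
  -- satisfied by `g`.
  set E := planeWave lam (-t) (0 : Cn n) with hE
  have hEd : ContDiff ℝ ∞ E := contDiff_planeWave lam (-t) 0
  have hEv : ∀ z s, E (z, s) = (Real.exp (t * psi lam z) : ℂ) *
      Complex.exp ((1 * s * t : ℝ) * Complex.I) := by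
    intro z s
    rw [hE, planeWave, Complex.ofReal_exp, ← Complex.exp_add]
    congr 1
    have : herm lam z 0 = 0 := by simp [herm]
    rw [this]
    push_cast; ring
  set φ : H n → ℂ := fun y => ρ y.1 * (χ (y.2 / k) : ℂ) with hφ
  have hχk : ContDiff ℝ ∞ fun y : H n => (χ (y.2 / k) : ℂ) :=
    Complex.ofRealCLM.contDiff.comp (hχ.1.comp (contDiff_snd.div_const _))
  have hφd : ContDiff ℝ ∞ φ := (hρ.comp contDiff_fst).mul hχk
  have hsupp : ∀ (η : ℝ → ℝ), (∀ θ, 2 < |θ| → η θ = 0) → ∀ (r : Cn n → ℂ), HasCompactSupport r →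
      HasCompactSupport fun y : H n => r y.1 * (η (y.2 / k) : ℂ) := by
    intro η hη r hr
    refine HasCompactSupport.intro (hr.isCompact.prod (isCompact_Icc (a := -(2 * (k : ℝ)))
      (b := 2 * (k : ℝ)))) fun y hy => ?_
    rw [Set.mem_prod, not_and_or] at hy
    rcases hy with hy | hy
    · rw [image_eq_zero_of_notMem_tsupport hy, zero_mul]
    · rw [hη, Complex.ofReal_zero, mul_zero]
      rw [abs_div, abs_of_pos h0, lt_div_iff₀ h0]
      by_contra hc
      exact hy (by simpa [abs_le] using not_lt.1 hc)
  have hφc : HasCompactSupport φ := hsupp χ hχ.2.2 ρ hρc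
  have hder0 : ∀ θ, 2 < |θ| → deriv χ θ = 0 := by
    intro θ hθ
    have : χ =ᶠ[𝓝 θ] fun _ => 0 := by
      filter_upwards [(continuous_abs.tendsto θ).eventually (lt_mem_nhds hθ)] with y hy
      exact hχ.2.2 y hy
    rw [this.deriv_eq, deriv_const]
  have hderc : Continuous (deriv χ) := hχ.1.continuous_deriv (by simp)
  -- The derivative in `x_{2n+1}` falls only on the cutoff, giving an error term with factor `1 /
  -- k`; the weighted equation holds exactly only in the limit.
  have hZφ : ∀ x, Zbar lam j φ x = 1 / 2 * dbar j ρ x.1 * (χ (x.2 / k) : ℂ) +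
      Complex.I * lam j * x.1 j * ρ x.1 * ((1 / k : ℂ) * ((deriv χ (x.2 / k) : ℝ) : ℂ)) := by
    intro x
    simp only [Zbar, hφ, fderiv_mul_cutoff hχ.1 hρ, dbar]
    have : fderiv ℝ ρ x.1 0 = 0 := map_zero _
    rw [this]
    push_cast
    ring
  have hZ : ∀ x, Zbar lam j (fun y => E y * φ y) x = E x * Zbar lam j φ x := by
    intro x
    have hmul := fderiv_fun_mul (hEd.differentiable (by simp) x) (hφd.differentiable (by simp) x)
    have hz : Zbar lam j E x = 0 := Zbar_planeWave lam (-t) 0 j x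
    simp only [Zbar, hmul, add_apply, smul_apply,
      smul_eq_mul] at hz ⊢
    linear_combination φ x * hz
  have hmain := mem_kerKohn_iff.1 hg j (fun y => E y * φ y) (hEd.mul hφd) hφc.mul_left
  simp only [hZ, hZφ] at hmain
  have hI : ∀ (r : Cn n → ℂ) (η : ℝ → ℝ), Continuous r → HasCompactSupport r → Continuous η →
      (∀ θ, 2 < |θ| → η θ = 0) →
      Integrable (fun x : H n => g x * (E x * (r x.1 * (η (x.2 / k) : ℂ)))) ((muC n).prod volume) := by
    intro r η hr hrc hη hη0
    have hc : Continuous fun x : H n => E x * (r x.1 * (η (x.2 / k) : ℂ)) :=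
      hEd.continuous.mul ((hr.comp continuous_fst).mul
        (Complex.continuous_ofReal.comp (hη.comp (continuous_snd.div_const _))))
    exact (Lp.memLp g).integrable_mul
      (hc.memLp_of_hasCompactSupport (μ := muH n) (p := 2) (hsupp η hη0 r hrc).mul_left)
  have hP : ∀ (r : Cn n → ℂ) (η : ℝ → ℝ) (z : Cn n),
      ∫ s, g (z, s) * (E (z, s) * (r z * (η (s / k) : ℂ))) =
        (Real.exp (t * psi lam z) : ℂ) * r z * partialFourier 1 (truncate η k g) (z, t) := by
    intro r η z
    rw [partialFourier, ← integral_const_mul]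
    congr 1
    funext s
    rw [hEv, truncate]
    ring
  have hd1 : Continuous fun z => 1 / 2 * dbar j ρ z := by
    have hd : Continuous (fderiv ℝ ρ) := hρ.continuous_fderiv (by simp)
    unfold dbar; fun_prop
  have hd2 : HasCompactSupport fun z => 1 / 2 * dbar j ρ z := by
    refine (hρc.fderiv (𝕜 := ℝ)).mono ?_
    intro x hx
    rw [Function.mem_support] at hx ⊢
    intro h
    exact hx (by simp [dbar, h])
  have hρcont := hρ.continuous
  have i1 := hI _ χ hd1 hd2 hχ.1.continuous hχ.2.2
  have i2 := hI (fun z => Complex.I * lam j * z j * ρ z * (1 / k : ℂ)) (deriv χ) (by fun_prop)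
    ((hρc.mul_left (f := fun z : Cn n => Complex.I * (lam j : ℂ) * z j)).mul_right) hderc hder0
  have hsum : ∫ x, g x * (E x * (1 / 2 * dbar j ρ x.1 * (χ (x.2 / k) : ℂ))) ∂((muC n).prod volume) +
      ∫ x, g x * (E x * (Complex.I * lam j * x.1 j * ρ x.1 * (1 / k : ℂ) *
        ((deriv χ (x.2 / k) : ℝ) : ℂ))) ∂((muC n).prod volume) = 0 := by
    refine (integral_add i1 i2).symm.trans (Eq.trans ?_ hmain)
    refine integral_congr_ae (ae_of_all _ fun x => ?_)
    simp only
    ring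
  rw [integral_prod _ i1, integral_prod _ i2] at hsum
  have hP1 := hP (fun z => 1 / 2 * dbar j ρ z) χ
  have hP2 := hP (fun z => Complex.I * lam j * z j * ρ z * (1 / k : ℂ)) (deriv χ)
  have h1 := i1.integral_prod_left
  simp only [hP1] at h1 hsum
  simp only [hP2] at hsum
  refine ⟨h1, ?_⟩
  rw [eq_neg_iff_add_eq_zero, ← hsum]
  congr 1
  refine integral_congr_ae (ae_of_all _ fun z => ?_)
  simp only
  ring

end Range

/-! ### Fibers of the transform of a CR function are weakly holomorphic up to the weight. -/

section Fibers

variable {n : ℕ} {lam : Fin n → ℝ}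

theorem ae_memLp_fiber {f : H n → ℂ} (hf : StronglyMeasurable f) (h2 : MemLp f 2 (muH n)) :
    ∀ᵐ t : ℝ, MemLp (fun z => f (z, t)) 2 (muC n) := by
  have hm : Measurable fun p => ‖f p‖ₑ ^ 2 := hf.enorm.pow_const 2
  have h := (memLp_two_iff h2.1).1 h2
  rw [muH, lintegral_prod_symm _ hm.aemeasurable] at h
  filter_upwards [ae_lt_top hm.lintegral_prod_left' h] with t ht
  exact (memLp_two_iff (hf.comp_measurable (g := fun z : Cn n => (z, t))
    (by fun_prop)).aestronglyMeasurable).2 ht.ne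

/-- If `F_k → F` in `L²` then the `liminf` of the fiberwise distances vanishes almost everywhere. -/
theorem ae_liminf_fiber_eq_zero {F : ℕ → H n → ℂ} (hF : ∀ k, StronglyMeasurable (F k))
    (h : Tendsto (fun k => ∫⁻ x, ‖F k x‖ₑ ^ 2 ∂(muH n)) atTop (𝓝 0)) {G : ℕ → H n → ℂ}
    (hG : ∀ k, StronglyMeasurable (G k))
    (h' : Tendsto (fun k => ∫⁻ x, ‖G k x‖ₑ ^ 2 ∂(muH n)) atTop (𝓝 0)) :
    ∀ᵐ t : ℝ, liminf (fun k => ∫⁻ z, ‖F k (z, t)‖ₑ ^ 2 ∂(muC n) +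
      ∫⁻ z, ‖G k (z, t)‖ₑ ^ 2 ∂(muC n)) atTop = 0 := by
  have hm : ∀ {f : H n → ℂ}, StronglyMeasurable f →
      Measurable fun t : ℝ => ∫⁻ z, ‖f (z, t)‖ₑ ^ 2 ∂(muC n) := fun hf =>
    (hf.enorm.pow_const 2).lintegral_prod_left'
  have hmN : ∀ k, Measurable fun t : ℝ => ∫⁻ z, ‖F k (z, t)‖ₑ ^ 2 ∂(muC n) +
      ∫⁻ z, ‖G k (z, t)‖ₑ ^ 2 ∂(muC n) := fun k => (hm (hF k)).add (hm (hG k))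
  have hlim : Tendsto (fun k => ∫⁻ t : ℝ, (∫⁻ z, ‖F k (z, t)‖ₑ ^ 2 ∂(muC n) +
      ∫⁻ z, ‖G k (z, t)‖ₑ ^ 2 ∂(muC n))) atTop (𝓝 0) := by
    have := h.add h'
    rw [add_zero] at this
    refine this.congr fun k => ?_
    rw [lintegral_add_left (hm (hF k)), muH,
      lintegral_prod_symm _ ((hF k).enorm.pow_const 2).aemeasurable,
      lintegral_prod_symm _ ((hG k).enorm.pow_const 2).aemeasurable]
  -- Fatou's lemma. With both quantities added under one `liminf`, they become small along common
  -- indices, and no subsequence has to be extracted.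
  have hle := lintegral_liminf_le (μ := (volume : Measure ℝ)) (u := atTop) hmN
  rw [hlim.liminf_eq, nonpos_iff_eq_zero, lintegral_eq_zero_iff (Measurable.liminf hmN)] at hle
  exact hle

theorem eq_zero_of_le_mul_liminf {c M : ℝ≥0∞} {N : ℕ → ℝ≥0∞} (hM : M ≠ ⊤)
    (hN : liminf N atTop = 0) (h : ∀ k, c ≤ M * N k) : c = 0 := by
  by_contra hc
  have h1 : ∀ k, c / M ≤ N k := fun k => ENNReal.div_le_of_le_mul' (h k)
  have h2 : c / M ≤ liminf N atTop := le_liminf_of_le (by isBoundedDefault) (Eventually.of_forall h1)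
  rw [hN, nonpos_iff_eq_zero, ENNReal.div_eq_zero_iff] at h2
  rcases h2 with h2 | h2
  · exact hc h2
  · exact hM h2

theorem deriv_cutoff_eq_zero {χ : ℝ → ℝ} (hχ : IsCutoff χ) {θ : ℝ} (hθ : 2 < |θ|) :
    deriv χ θ = 0 := by
  have : χ =ᶠ[𝓝 θ] fun _ => 0 := by
    filter_upwards [(continuous_abs.tendsto θ).eventually (lt_mem_nhds hθ)] with y hy
    exact hχ.2.2 y hy
  rw [this.deriv_eq, deriv_const]

/-- The scaled partial Fourier transforms of `u χ'(s/k)` tend to zero. -/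
theorem tendsto_partialFourier_deriv {χ : ℝ → ℝ} (hχ : IsCutoff χ) (u : L2 n) :
    Tendsto (fun k : ℕ => ∫⁻ x, ‖(1 / ((k + 1 : ℕ) : ℂ)) *
      partialFourier 1 (truncate (deriv χ) (k + 1) u) x‖ₑ ^ 2 ∂(muH n)) atTop (𝓝 0) := by
  have hdc : Continuous (deriv χ) := hχ.1.continuous_deriv (by simp)
  have hdcs : HasCompactSupport (deriv χ) := by
    refine HasCompactSupport.intro (isCompact_Icc (a := (-2 : ℝ)) (b := 2)) fun x hx =>
      deriv_cutoff_eq_zero hχ ?_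
    by_contra h
    exact hx (by simpa [abs_le] using not_lt.1 h)
  obtain ⟨C, hC⟩ := hdc.bounded_above_of_compact_support hdcs
  have hsm : ∀ k, StronglyMeasurable (truncate (deriv χ) k u) := fun k =>
    stronglyMeasurable_truncate hdc k (Lp.stronglyMeasurable u)
  have hml : ∀ k, MemLp (truncate (deriv χ) k u) 2 ((muC n).prod volume) := fun k =>
    memLp_truncate hdc hC k (Lp.stronglyMeasurable u) (Lp.memLp u)
  have hU := (memLp_two_iff (Lp.memLp u).1).1 (Lp.memLp u)
  set U := ∫⁻ x, ‖u x‖ₑ ^ 2 ∂(muH n) with hUdef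
  have hzero : ∀ k : ℕ, 0 < k → ∀ (x : Cn n) s, 2 * (k : ℝ) < |s| →
      truncate (deriv χ) k u (x, s) = 0 := by
    intro k hk x s hs
    have h0 : (0 : ℝ) < k := by exact_mod_cast hk
    have : deriv χ (s / k) = 0 := by
      refine deriv_cutoff_eq_zero hχ ?_
      rw [abs_div, abs_of_pos h0, lt_div_iff₀ h0]
      exact hs
    simp [truncate, this]
  -- Plancherel bounds the transform of `u χ'(s/k)` by a constant times `sup |χ'|` and the norm of
  -- `u`, so the prefactor `1 / (k + 1)` wins.
  have hbound : ∀ k : ℕ, ∫⁻ x, ‖(1 / ((k + 1 : ℕ) : ℂ)) *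
      partialFourier 1 (truncate (deriv χ) (k + 1) u) x‖ₑ ^ 2 ∂(muH n) ≤
        ENNReal.ofReal (1 / ((k : ℝ) + 1)) ^ 2 *
          (ENNReal.ofReal (2 * Real.pi) * (ENNReal.ofReal C ^ 2 * U)) := by
    intro k
    simp only [enorm_mul, mul_pow]
    rw [lintegral_const_mul _ ((stronglyMeasurable_partialFourier 1 (hsm (k + 1))).enorm.pow_const 2)]
    have e1 : ‖(1 / ((k + 1 : ℕ) : ℂ))‖ₑ = ENNReal.ofReal (1 / ((k : ℝ) + 1)) := by
      rw [← ofReal_norm, norm_div, norm_one, Complex.norm_natCast]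
      push_cast; rfl
    rw [e1]
    gcongr
    refine (lintegral_partialFourier_sq (hsm (k + 1)) ((memLp_two_iff (hml _).1).1 (hml _))
      (hzero (k + 1) k.succ_pos) (by simp)).trans_le ?_
    gcongr
    rw [hUdef, ← lintegral_const_mul _ ((Lp.stronglyMeasurable u).enorm.pow_const 2)]
    refine lintegral_mono fun p => ?_
    rw [← mul_pow]
    refine pow_le_pow_left' ?_ 2
    rw [truncate, enorm_mul, mul_comm]
    gcongr
    rw [← ofReal_norm, Complex.norm_real]
    exact ENNReal.ofReal_le_ofReal (hC _)
  refine tendsto_of_tendsto_of_tendsto_of_le_of_le tendsto_const_nhds ?_ (fun _ => zero_le) hbound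
  have h1 := ENNReal.tendsto_ofReal (tendsto_one_div_add_atTop_nhds_zero_nat (𝕜 := ℝ))
  rw [ENNReal.ofReal_zero] at h1
  have h2 := ENNReal.Tendsto.mul_const (b := ENNReal.ofReal (2 * Real.pi) *
    (ENNReal.ofReal C ^ 2 * U)) (ENNReal.Tendsto.pow (n := 2) h1) (Or.inr (by finiteness))
  simpa using h2

/-- Almost every fiber of the partial inverse Fourier transform of a CR function is, up to the
weight, weakly holomorphic. -/
theorem ae_weak_dbar {χ : ℝ → ℝ} (hχ : IsCutoff χ) {g A : L2 n} (hg : g ∈ kerKohn lam)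
    (hA : HasPartialFourier (μ := muC n) χ 1 g A) :
    ∀ᵐ t : ℝ, ∀ (j : Fin n) (ρ : Cn n → ℂ), ContDiff ℝ ∞ ρ → HasCompactSupport ρ →
      ∫ z, ((Real.exp (t * psi lam z) : ℂ) * A (z, t)) * dbar j ρ z ∂(muC n) = 0 := by
  have hdc : Continuous (deriv χ) := hχ.1.continuous_deriv (by simp)
  have hAm := Lp.stronglyMeasurable A
  have hPm : ∀ (η : ℝ → ℝ), Continuous η → ∀ k,
      StronglyMeasurable (partialFourier 1 (truncate η k (g : H n → ℂ))) := fun η hη k =>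
    stronglyMeasurable_partialFourier _ (stronglyMeasurable_truncate hη k (Lp.stronglyMeasurable g))
  have hlim1 : Tendsto (fun k : ℕ => ∫⁻ x, ‖A x - partialFourier 1 (truncate χ (k + 1) g) x‖ₑ ^ 2
      ∂(muH n)) atTop (𝓝 0) := by
    have h := ENNReal.Tendsto.pow (n := 2) (hA.comp (tendsto_add_atTop_nat 1))
    rw [zero_pow two_ne_zero] at h
    refine h.congr fun k => ?_
    change eLpNorm (fun p => partialFourier 1 (truncate χ (k + 1) g) p - A p) 2 (muH n) ^ 2 = _
    rw [← lintegral_enorm_sq_eq]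
    refine lintegral_congr fun x => ?_
    rw [← enorm_neg, neg_sub]
  have hliminf := ae_liminf_fiber_eq_zero (fun k => hAm.sub (hPm χ hχ.1.continuous (k + 1))) hlim1
    (fun k => stronglyMeasurable_const.mul (hPm (deriv χ) hdc (k + 1)))
    (tendsto_partialFourier_deriv hχ g)
  -- The exceptional set of `t` is fixed before `j` and `ρ` are introduced, so one null set serves
  -- all test functions.
  filter_upwards [hliminf, ae_memLp_fiber hAm (Lp.memLp A)] with t ht hAt
  intro j ρ hρ hρc
  have hρcont := hρ.continuous
  have hpsi := continuous_psi lam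
  set α : Cn n → ℂ := fun z => (Real.exp (t * psi lam z) : ℂ) * (1 / 2 * dbar j ρ z) with hα
  set β : Cn n → ℂ := fun z => (Real.exp (t * psi lam z) : ℂ) * (Complex.I * lam j * z j * ρ z) with hβ
  have hαc : Continuous α := by
    have hd : Continuous (fderiv ℝ ρ) := hρ.continuous_fderiv (by simp)
    have : Continuous (dbar j ρ) := by unfold dbar; fun_prop
    fun_prop
  have hαs : HasCompactSupport α := by
    refine (hρc.fderiv (𝕜 := ℝ)).mono ?_
    intro x hx
    rw [Function.mem_support] at hx ⊢
    intro h
    exact hx (by simp [hα, dbar, h])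
  have hβc : Continuous β := by fun_prop
  have hβs : HasCompactSupport β := HasCompactSupport.mul_left hρc.mul_left
  have hα2 : MemLp α 2 (muC n) := hαc.memLp_of_hasCompactSupport hαs
  have hβ2 : MemLp β 2 (muC n) := hβc.memLp_of_hasCompactSupport hβs
  suffices h0 : ∫ z, α z * A (z, t) ∂(muC n) = 0 by
    have : ∀ z, ((Real.exp (t * psi lam z) : ℂ) * A (z, t)) * dbar j ρ z = 2 * (α z * A (z, t)) := by
      intro z; simp only [hα]; ring
    simp only [this, integral_const_mul, h0, mul_zero]
  have iA : Integrable (fun z => α z * A (z, t)) (muC n) := hα2.integrable_mul hAt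
  rw [← enorm_eq_zero, ← pow_eq_zero_iff (two_ne_zero)]
  refine eq_zero_of_le_mul_liminf (M := 2 * (∫⁻ z, ‖α z‖ₑ ^ 2 ∂(muC n) + ∫⁻ z, ‖β z‖ₑ ^ 2 ∂(muC n)))
    ?_ ht fun k => ?_
  · have h1 := (memLp_two_iff hα2.1).1 hα2
    have h2 := (memLp_two_iff hβ2.1).1 hβ2
    finiteness
  obtain ⟨iP, eP⟩ := integral_dbar_truncate hχ hg k.succ_pos t j hρ hρc
  change Integrable (fun z => α z * partialFourier 1 (truncate χ (k + 1) g) (z, t)) (muC n) at iP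
  change ∫ z, α z * partialFourier 1 (truncate χ (k + 1) g) (z, t) ∂(muC n) = -∫ z, β z *
    ((1 / ((k + 1 : ℕ) : ℂ)) * partialFourier 1 (truncate (deriv χ) (k + 1) g) (z, t)) ∂(muC n) at eP
  -- The truncated equation writes the limit pairing as two errors: the distance of `A` to its
  -- approximants, and the `χ'` term. Cauchy–Schwarz bounds both by quantities whose sum has
  -- `liminf` zero.
  have e : ∫ z, α z * A (z, t) ∂(muC n) =
      ∫ z, α z * (A (z, t) - partialFourier 1 (truncate χ (k + 1) g) (z, t)) ∂(muC n) -
      ∫ z, β z * ((1 / ((k + 1 : ℕ) : ℂ)) *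
        partialFourier 1 (truncate (deriv χ) (k + 1) g) (z, t)) ∂(muC n) := by
    simp only [mul_sub]
    rw [integral_sub iA iP, eP]
    ring
  have hcs : ∀ {f h : Cn n → ℂ}, AEStronglyMeasurable f (muC n) → StronglyMeasurable h →
      ‖∫ z, f z * h z ∂(muC n)‖ₑ ^ 2 ≤ (∫⁻ z, ‖f z‖ₑ ^ 2 ∂(muC n)) * ∫⁻ z, ‖h z‖ₑ ^ 2 ∂(muC n) := by
    intro f h hf hh
    refine le_trans (pow_le_pow_left' ((enorm_integral_le_lintegral_enorm _).trans_eq ?_) 2)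
      (lintegral_mul_sq_le hf.enorm hh.enorm.aemeasurable)
    simp only [enorm_mul]
  have b1 := hcs hα2.1 ((hAm.sub (hPm χ hχ.1.continuous (k + 1))).comp_measurable
    (g := fun z : Cn n => (z, t)) (by fun_prop))
  have b2 := hcs hβ2.1 ((stronglyMeasurable_const (b := (1 / ((k + 1 : ℕ) : ℂ)))).mul
    (hPm (deriv χ) hdc (k + 1)) |>.comp_measurable (g := fun z : Cn n => (z, t)) (by fun_prop))
  rw [e]
  set X := ∫ z, α z * (A (z, t) - partialFourier 1 (truncate χ (k + 1) g) (z, t)) ∂(muC n)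
  set Y := ∫ z, β z * ((1 / ((k + 1 : ℕ) : ℂ)) *
        partialFourier 1 (truncate (deriv χ) (k + 1) g) (z, t)) ∂(muC n)
  have hXY : ‖X - Y‖ₑ ^ 2 ≤ 2 * (‖X‖ₑ ^ 2 + ‖Y‖ₑ ^ 2) := by
    have h1 : ‖X - Y‖ₑ ^ 2 ≤ (‖X‖ₑ + ‖Y‖ₑ) ^ 2 := pow_le_pow_left' (enorm_sub_le) 2
    have h2 := ENNReal.rpow_add_le_mul_rpow_add_rpow ‖X‖ₑ ‖Y‖ₑ (p := 2) (by norm_num)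
    norm_num at h2
    exact h1.trans h2
  refine hXY.trans ?_
  rw [mul_assoc]
  gcongr
  rw [add_mul]
  refine add_le_add (b1.trans ?_) (b2.trans ?_)
  · gcongr
    exact le_self_add
  · gcongr
    exact le_add_self

end Fibers

/-! ### Identification of `P̃` with the Szegő projection. -/

section Projection

variable {n : ℕ} {lam : Fin n → ℝ}

/-- A weakly weighted-holomorphic `L²` function is reproduced by the weighted Bergman kernel. -/
theorem ae_eq_integral_modelKernel_mul (hn : 1 ≤ n) (hlam : ∀ j, 0 < lam j) {t : ℝ} {b : Cn n → ℂ}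
    (hb : MemLp b 2 (muC n))
    (h : ∀ (j : Fin n) (ρ : Cn n → ℂ), ContDiff ℝ ∞ ρ → HasCompactSupport ρ →
      ∫ z, ((Real.exp (t * psi lam z) : ℂ) * b z) * dbar j ρ z ∂(muC n) = 0) :
    ∀ᵐ z ∂(muC n), b z = ∫ w, modelKernel lam t z w * b w ∂(muC n) := by
  have hψ := continuous_psi lam
  have hle : (volume : Measure (Cn n)) ≤ (1 : ℝ≥0∞) • muC n := by
    rw [one_smul, muC]
    intro s
    rw [Measure.smul_apply, ENNReal.smul_def, smul_eq_mul]
    refine le_mul_of_one_le_left' ?_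
    rw [ENNReal.coe_pow]
    exact one_le_pow₀ (by norm_num)
  have hloc : LocallyIntegrable (fun z => (Real.exp (t * psi lam z) : ℂ) * b z) := by
    have h1 : LocallyIntegrable b :=
      (hb.of_measure_le_smul (by simp) hle).locallyIntegrable (by norm_num)
    have h2 := h1.smul_continuous (g := fun z => (Real.exp (t * psi lam z) : ℂ)) (by fun_prop)
    simpa only [smul_eq_mul, mul_comm] using h2
  -- Weyl's lemma gives `b = e^{-tψ} f` with `f` entire. For `t > 0` this is reproduced by the
  -- kernel; for `t ≤ 0` both `f` and the kernel vanish.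
  obtain ⟨f, hf, hbf⟩ := exists_entire_of_weak_dbar hloc (fun j ρ hρ hρc => by
    have := h j ρ hρ hρc
    rw [integral_muC] at this
    exact (mul_eq_zero.1 this).resolve_left (pow_ne_zero _ two_ne_zero))
  have hbf' : b =ᵐ[muC n] fun z => (Real.exp (-t * psi lam z) : ℂ) * f z := by
    rw [Filter.EventuallyEq, ae_muC]
    filter_upwards [hbf] with z hz
    rw [← hz, ← mul_assoc, ← Complex.ofReal_mul, ← Real.exp_add]
    simp
  have h2 := (memLp_congr_ae hbf').1 hb
  rcases lt_or_ge 0 t with ht | ht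
  · filter_upwards [hbf'] with z hz
    rw [hz, ← integral_modelKernel_mul hlam ht hf h2 z]
    refine integral_congr_ae ?_
    filter_upwards [hbf'] with w hw
    rw [hw]
  · have h0 := eq_zero_of_memLp_of_nonpos hn hlam ht hf h2
    filter_upwards [hbf'] with z hz
    rw [hz, h0]
    simp [modelKernel_of_nonpos lam ht]

/-- Transforms of CR functions are fixed by the fiber projections. Measurability of the equality set
allows passage from almost every `t` to almost every point. -/
theorem isFiberwiseIntegral_of_mem_kerKohn (hn : 1 ≤ n) (hlam : ∀ j, 0 < lam j) {χ : ℝ → ℝ}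
    (hχ : IsCutoff χ) {g A : L2 n} (hg : g ∈ kerKohn lam)
    (hA : HasPartialFourier (μ := muC n) χ 1 g A) :
    IsFiberwiseIntegral (modelKernel lam) A A := by
  have hK := isSchurKernel_modelKernel hlam
  have hAm := Lp.stronglyMeasurable A
  have hms : MeasurableSet {x : H n | A x = fiberIntegral (modelKernel lam) A x} :=
    measurableSet_eq_fun hAm.measurable (stronglyMeasurable_fiberIntegral hK hAm).measurable
  have h : ∀ᵐ x ∂(muH n), A x = fiberIntegral (modelKernel lam) A x := by
    refine (Measure.ae_prod_iff_ae_ae hms).2 ((Measure.ae_ae_comm hms).2 ?_)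
    filter_upwards [ae_weak_dbar hχ hg hA, ae_memLp_fiber hAm (Lp.memLp A)] with t h1 h2
    exact ae_eq_integral_modelKernel_mul hn hlam h2 h1
  filter_upwards [h, ae_integrable_fiber hK hAm (Lp.memLp A)] with x h1 h2 using ⟨h2, h1⟩

/-- For `g` in the kernel with transform `A`, adjointness gives `⟪h, g⟫ = ⟪v, A⟫` and `⟪u, g⟫ = ⟪a,
A⟫`. Symmetry of the fiber operator and `A` being fixed give `⟪v, A⟫ = ⟪a, A⟫`. So `u - h` is
orthogonal to the kernel, which contains `h`. -/
theorem eq_szego_of_isFourierConjugate (hn : 1 ≤ n) (hlam : ∀ j, 0 < lam j) {χ : ℝ → ℝ}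
    (hχ : IsCutoff χ) {u h : L2 n} (hu : IsFourierConjugate χ (modelKernel lam) u h) :
    h = szego lam u := by
  obtain ⟨a, v, ha, hv, hh⟩ := hu
  have h1 : |(1 : ℝ)| = 1 := abs_one
  have h2 : |(-1 : ℝ)| = 1 := by simp
  have hker := mem_kerKohn_of_isFiberwiseIntegral hlam hχ hv hh
  rw [isPartialFourierInv_iff] at ha
  rw [isPartialFourier_iff] at hh
  -- Fourier inversion is needed here: the adjoint relation is applied to `u` as the transform of
  -- `a`.
  have hw : HasPartialFourier (μ := muC n) χ (-1) a u := by
    obtain ⟨w, hw⟩ := exists_hasPartialFourier (μ := muC n) hχ h2 a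
    rwa [ha.inversion hχ h1 hw] at hw
  symm
  refine Submodule.eq_starProjection_of_mem_of_inner_eq_zero hker fun g hg => ?_
  obtain ⟨A, hA⟩ := exists_hasPartialFourier (μ := muC n) hχ h1 g
  have hA' : HasPartialFourier (μ := muC n) χ (- -1) g A := by rwa [neg_neg]
  have e1 := hh.inner_eq hχ h2 hA'
  have e2 := hw.inner_eq hχ h2 hA'
  have e3 := hv.inner_eq (isSchurKernel_modelKernel hlam) (modelKernel_conj lam)
    (isFiberwiseIntegral_of_mem_kerKohn hn hlam hχ hg hA)
  have e4 : ⟪u, g⟫_ℂ = ⟪h, g⟫_ℂ := e2.trans (e3.symm.trans e1.symm)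
  exact (inner_sub_left _ _ _).trans (sub_eq_zero.2 e4)

/-- All three stages exist for every `u`; together with the previous identification this is
well-definedness on all of `L²`. -/
theorem isFourierConjugate_iff (hn : 1 ≤ n) (hlam : ∀ j, 0 < lam j) {χ : ℝ → ℝ}
    (hχ : IsCutoff χ) (u h : L2 n) :
    IsFourierConjugate χ (modelKernel lam) u h ↔ h = szego lam u := by
  refine ⟨eq_szego_of_isFourierConjugate hn hlam hχ, ?_⟩
  obtain ⟨A, hA⟩ := exists_hasPartialFourier (μ := muC n) hχ (σ := 1) abs_one u
  obtain ⟨v, hv⟩ := exists_isFiberwiseIntegral (isSchurKernel_modelKernel hlam)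
    ((2 * Real.pi : ℂ)⁻¹ • A)
  obtain ⟨h', hh'⟩ := exists_hasPartialFourier (μ := muC n) hχ (σ := -1) (by simp) v
  have key : IsFourierConjugate χ (modelKernel lam) u h' := by
    refine ⟨_, v, isPartialFourierInv_iff.2 ?_, hv, isPartialFourier_iff.2 hh'⟩
    have h0 : (2 * Real.pi : ℂ) ≠ 0 := by exact_mod_cast Real.two_pi_pos.ne'
    exact (smul_inv_smul₀ h0 A).symm ▸ hA
  rintro rfl
  rwa [← eq_szego_of_isFourierConjugate hn hlam hχ key]

end Projection

/-! ### The oscillatory integral as a distribution. -/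

section OscillatoryIntegral

variable {n : ℕ} {lam : Fin n → ℝ}

variable (lam) in
/-- The frequency component `e^{-it(x_{2n+1} - y_{2n+1})} P_t(z,w)` of the Szegő kernel. -/
def frequencyKernel (t : ℝ) (p : H n × H n) : ℂ :=
  Complex.exp (-(Complex.I * t * (p.1.2 - p.2.2))) * modelKernel lam t p.1.1 p.2.1

theorem enorm_frequencyKernel (t : ℝ) (p : H n × H n) :
    ‖frequencyKernel lam t p‖ₑ = ‖modelKernel lam t p.1.1 p.2.1‖ₑ := by
  have : -(Complex.I * t * (p.1.2 - p.2.2)) = ((-(t * (p.1.2 - p.2.2)) : ℝ) : ℂ) * Complex.I := by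
    push_cast; ring
  rw [← ofReal_norm, ← ofReal_norm, frequencyKernel, norm_mul, this, Complex.norm_exp_ofReal_mul_I,
    one_mul]

theorem measurable_frequencyKernel :
    Measurable fun q : (H n × H n) × ℝ => frequencyKernel lam q.2 q.1 := by
  unfold frequencyKernel
  refine Measurable.mul (by fun_prop) ?_
  exact (measurable_modelKernel lam).comp
    (f := fun q : (H n × H n) × ℝ => (q.2, q.1.1.1, q.1.2.1)) (by fun_prop)

theorem measurable_frequencyKernel_apply (t : ℝ) : Measurable (frequencyKernel (n := n) lam t) :=
  measurable_frequencyKernel.comp (f := fun p : H n × H n => (p, t)) (by fun_prop)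

/-- Pointwise the kernel may grow like `t ^ n`, but Schur's bound controls its integral over all `w`
uniformly in `t`. Compactness serves only the remaining variables. Two integrations by parts
therefore suffice whatever `n` is. -/
theorem exists_setLIntegral_frequencyKernel_le (hlam : ∀ j, 0 < lam j) {K : Set (H n × H n)}
    (hK : IsCompact K) : ∃ C : ℝ≥0∞, C ≠ ⊤ ∧ ∀ t,
      ∫⁻ p in K, ‖frequencyKernel lam t p‖ₑ ∂((muH n).prod (muH n)) ≤ C := by
  set A : Set (H n) := Prod.fst '' K with hA
  set B : Set ℝ := (fun p : H n × H n => p.2.2) '' K with hB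
  have hAc : IsCompact A := hK.image continuous_fst
  have hBc : IsCompact B := hK.image (by fun_prop)
  have hsub : K ⊆ A ×ˢ ((Set.univ : Set (Cn n)) ×ˢ B) := fun p hp =>
    ⟨⟨p, hp, rfl⟩, trivial, ⟨p, hp, rfl⟩⟩
  refine ⟨(2 ^ n * volume B) * muH n A, ?_, fun t => ?_⟩
  · have h1 := hBc.measure_lt_top (μ := volume)
    have h2 := hAc.measure_lt_top (μ := muH n)
    finiteness
  have hm : Measurable fun p : H n × H n => ‖modelKernel lam t p.1.1 p.2.1‖ₑ :=
    ((measurable_modelKernel lam).comp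
      (f := fun p : H n × H n => (t, p.1.1, p.2.1)) (by fun_prop)).enorm
  simp only [enorm_frequencyKernel]
  refine (lintegral_mono_set hsub).trans ?_
  rw [← Measure.prod_restrict, lintegral_prod _ hm.aemeasurable, ← setLIntegral_const]
  refine lintegral_mono fun x => ?_
  have hx : Measurable fun w => ‖modelKernel lam t x.1 w‖ₑ :=
    ((measurable_modelKernel lam).comp (f := fun w : Cn n => (t, x.1, w)) (by fun_prop)).enorm
  rw [muH, ← Measure.prod_restrict, Measure.restrict_univ]
  refine (lintegral_prod (fun y : Cn n × ℝ => ‖modelKernel lam t x.1 y.1‖ₑ)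
    (hx.comp measurable_fst).aemeasurable).trans_le ?_
  simp only [lintegral_const, Measure.restrict_apply_univ]
  rw [lintegral_mul_const _ hx]
  gcongr
  exact lintegral_norm_modelKernel_le hlam t x.1

/-- The Fubini hypothesis for any integrable frequency weight; it is used for the cutoffs `χ(εt)`
and for `(1 + t²)⁻¹`. -/
theorem integrable_mul_frequencyKernel_mul (hlam : ∀ j, 0 < lam j) {w : ℝ → ℂ} (hw : Integrable w)
    (hwm : Measurable w) {Ψ : H n × H n → ℂ} (hΨ : Measurable Ψ) {M : ℝ} (hM : ∀ p, ‖Ψ p‖ ≤ M)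
    {K : Set (H n × H n)} (hK : IsCompact K) (hΨK : ∀ p ∉ K, Ψ p = 0) :
    Integrable (fun q : (H n × H n) × ℝ => w q.2 * (frequencyKernel lam q.2 q.1 * Ψ q.1))
      (((muH n).prod (muH n)).prod volume) := by
  obtain ⟨C, hC, hCt⟩ := exists_setLIntegral_frequencyKernel_le hlam hK
  have hm : Measurable fun q : (H n × H n) × ℝ =>
      w q.2 * (frequencyKernel lam q.2 q.1 * Ψ q.1) :=
    (hwm.comp measurable_snd).mul (measurable_frequencyKernel.mul (hΨ.comp measurable_fst))
  refine ⟨hm.aestronglyMeasurable, ?_⟩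
  rw [HasFiniteIntegral, lintegral_prod_symm _ hm.enorm.aemeasurable]
  have hle : ∀ t, ∫⁻ p, ‖w t * (frequencyKernel lam t p * Ψ p)‖ₑ ∂((muH n).prod (muH n)) ≤
      ‖w t‖ₑ * (C * ENNReal.ofReal M) := by
    intro t
    simp only [enorm_mul]
    have hfm := (measurable_frequencyKernel_apply (lam := lam) t).enorm
    rw [lintegral_const_mul (f := fun p => ‖frequencyKernel lam t p‖ₑ * ‖Ψ p‖ₑ) _ (hfm.mul hΨ.enorm)]
    gcongr
    calc ∫⁻ p, ‖frequencyKernel lam t p‖ₑ * ‖Ψ p‖ₑ ∂((muH n).prod (muH n))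
        = ∫⁻ p in K, ‖frequencyKernel lam t p‖ₑ * ‖Ψ p‖ₑ ∂((muH n).prod (muH n)) := by
          refine (setLIntegral_eq_of_support_subset ?_).symm
          intro p hp
          by_contra h
          exact hp (by simp [hΨK p h])
      _ ≤ ∫⁻ p in K, ‖frequencyKernel lam t p‖ₑ * ENNReal.ofReal M ∂((muH n).prod (muH n)) := by
          refine lintegral_mono fun p => ?_
          gcongr
          rw [← ofReal_norm]
          exact ENNReal.ofReal_le_ofReal (hM p)
      _ ≤ C * ENNReal.ofReal M := by
          rw [lintegral_mul_const _ hfm]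
          gcongr
          exact hCt t
  refine (lintegral_mono hle).trans_lt ?_
  rw [lintegral_mul_const _ hwm.enorm]
  have := hw.2
  rw [HasFiniteIntegral] at this
  finiteness

/-- The pairing of a function with a frequency component of the Szegő kernel. -/
def frequencyPairing (lam : Fin n → ℝ) (Ψ : H n × H n → ℝ) (t : ℝ) : ℂ :=
  ∫ p, frequencyKernel lam t p * (Ψ p : ℂ) ∂((muH n).prod (muH n))

theorem integrable_frequencyKernel_mul (hlam : ∀ j, 0 < lam j) (t : ℝ) {Ψ : H n × H n → ℂ}
    (hΨ : Integrable Ψ ((muH n).prod (muH n))) :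
    Integrable (fun p => frequencyKernel lam t p * Ψ p) ((muH n).prod (muH n)) := by
  refine hΨ.bdd_mul (c := |diagConst lam t|)
    (measurable_frequencyKernel_apply t).aestronglyMeasurable (ae_of_all _ fun p => ?_)
  have h := enorm_frequencyKernel (lam := lam) t p
  rw [enorm_eq_iff_norm_eq] at h
  rw [h]
  exact norm_modelKernel_le hlam t _ _

/-- Abbreviation for test functions on the square of the Heisenberg group. -/
abbrev TestFun (n : ℕ) : Type := 𝓓((⊤ : TopologicalSpace.Opens (H n × H n)), ℝ)

theorem TestFun.integrable_ofReal (Φ : TestFun n) :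
    Integrable (fun p => (Φ p : ℂ)) ((muH n).prod (muH n)) :=
  (Φ.continuous.integrable_of_hasCompactSupport Φ.hasCompactSupport).ofReal

theorem integrable_mul_frequencyKernel_mul_testFun (hlam : ∀ j, 0 < lam j) {w : ℝ → ℂ}
    (hw : Integrable w) (hwm : Measurable w) (Φ : TestFun n) :
    Integrable (fun q : (H n × H n) × ℝ => w q.2 * (frequencyKernel lam q.2 q.1 * (Φ q.1 : ℂ)))
      (((muH n).prod (muH n)).prod volume) := by
  obtain ⟨M, hM⟩ := Φ.continuous.bounded_above_of_compact_support Φ.hasCompactSupport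
  refine integrable_mul_frequencyKernel_mul hlam hw hwm (Ψ := fun p => (Φ p : ℂ)) (M := M)
    (Complex.continuous_ofReal.comp Φ.continuous).measurable (fun p => ?_)
    Φ.hasCompactSupport fun p hp => ?_
  · rw [Complex.norm_real]
    exact hM p
  · simp [image_eq_zero_of_notMem_tsupport hp]

/-- The unit vector in the direction of `x_{2n+1}` of the first factor. -/
def fiberDirection (n : ℕ) : H n × H n := ((0, 1), 0)

theorem hasLineDerivAt_frequencyKernel (t : ℝ) (p : H n × H n) :
    HasLineDerivAt ℝ (frequencyKernel lam t) (-(Complex.I * t) * frequencyKernel lam t p) p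
      (fiberDirection n) := by
  have e : ∀ s : ℝ, frequencyKernel lam t (p + s • fiberDirection n) =
      Complex.exp (-(Complex.I * t * (p.1.2 + s - p.2.2))) * modelKernel lam t p.1.1 p.2.1 := by
    intro s
    simp [frequencyKernel, fiberDirection]
  rw [HasLineDerivAt]
  simp only [e]
  have h1 : HasDerivAt (fun s : ℝ => -(Complex.I * t * (p.1.2 + (s : ℂ) - p.2.2)))
      (-(Complex.I * t * 1)) 0 := by
    have h0 : HasDerivAt (fun s : ℝ => (s : ℂ)) 1 0 := Complex.ofRealCLM.hasDerivAt
    exact (((h0.const_add _).sub_const _).const_mul _).neg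
  refine (h1.cexp.mul_const (modelKernel lam t p.1.1 p.2.1)).congr_deriv ?_
  rw [frequencyKernel, Complex.ofReal_zero, add_zero]
  ring

variable (n) in
/-- The derivative `∂/∂x_{2n+1}` in the first factor. -/
def fiberDeriv : TestFun n →L[ℝ] TestFun n := TestFunction.lineDerivCLM ℝ (fiberDirection n)

/-- Integration by parts in `x_{2n+1}`, on which the kernel depends only through `e^{-itx_{2n+1}}`.
-/
theorem frequencyPairing_lineDeriv (hlam : ∀ j, 0 < lam j) (Φ : TestFun n) (t : ℝ) :
    frequencyPairing lam (fiberDeriv n Φ) t =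
      Complex.I * t * frequencyPairing lam Φ t := by
  set Φ' : TestFun n := fiberDeriv n Φ with hΦ'
  have hd : ∀ p, HasLineDerivAt ℝ Φ (Φ' p) p (fiberDirection n) := by
    intro p
    rw [hΦ', fiberDeriv, TestFunction.lineDerivCLM_apply_of_le (by simp)]
    exact ((Φ.contDiff.differentiable (by simp)) p).lineDifferentiableAt.hasLineDerivAt
  have i1 := integrable_frequencyKernel_mul hlam t Φ.integrable_ofReal
  have i2 := integrable_frequencyKernel_mul hlam t Φ'.integrable_ofReal
  have h := integral_bilinear_hasLineDerivAt_right_eq_neg_left_of_integrable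
    (μ := (muH n).prod (muH n)) (f := frequencyKernel lam t)
    (f' := fun p => -(Complex.I * t) * frequencyKernel lam t p) (g := Φ) (g' := Φ')
    (v := fiberDirection n) (B := (ContinuousLinearMap.lsmul ℝ ℝ : ℝ →L[ℝ] ℂ →L[ℝ] ℂ).flip)
    ?_ ?_ ?_ (fun p _ => hasLineDerivAt_frequencyKernel t p) (fun p _ => hd p)
  · simp only [ContinuousLinearMap.flip_apply, ContinuousLinearMap.lsmul_apply,
      Complex.real_smul] at h
    rw [frequencyPairing, frequencyPairing, ← integral_const_mul]
    simp only [mul_comm (frequencyKernel lam t _)]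
    rw [h, ← integral_neg]
    refine integral_congr_ae (ae_of_all _ fun p => ?_)
    ring
  · refine (i1.const_mul (-(Complex.I * t))).congr (ae_of_all _ fun p => ?_)
    simp
    ring
  · refine i2.congr (ae_of_all _ fun p => ?_)
    simp [mul_comm]
  · refine i1.congr (ae_of_all _ fun p => ?_)
    simp [mul_comm]

variable (n) in
/-- The operator `1 - ∂²/∂x_{2n+1}²` in the first factor. -/
def fiberBessel : TestFun n →L[ℝ] TestFun n :=
  ContinuousLinearMap.id ℝ (TestFun n) - (fiberDeriv n).comp (fiberDeriv n)

/-- Two derivatives give `(it)² = -t²`. Dividing by `1 + t²` is harmless at every `t`, including `t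
= 0`, and yields the decay in frequency. -/
theorem frequencyPairing_fiberBessel (hlam : ∀ j, 0 < lam j) (Φ : TestFun n) (t : ℝ) :
    frequencyPairing lam (fiberBessel n Φ) t = (1 + t ^ 2 : ℝ) * frequencyPairing lam Φ t := by
  have e : ∀ p, fiberBessel n Φ p = Φ p - fiberDeriv n (fiberDeriv n Φ) p := fun p => rfl
  have h := frequencyPairing_lineDeriv hlam
    (fiberDeriv n Φ) t
  rw [frequencyPairing_lineDeriv hlam Φ] at h
  have : frequencyPairing lam (fiberBessel n Φ) t = frequencyPairing lam Φ t -
      frequencyPairing lam (fiberDeriv n (fiberDeriv n Φ)) t := by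
    rw [frequencyPairing, frequencyPairing, frequencyPairing, ← integral_sub
      (integrable_frequencyKernel_mul hlam t (TestFun.integrable_ofReal _))
      (integrable_frequencyKernel_mul hlam t (TestFun.integrable_ofReal _))]
    refine integral_congr_ae (ae_of_all _ fun p => ?_)
    simp only [e, Complex.ofReal_sub, mul_sub]
  rw [this, h]
  push_cast
  linear_combination (-(t : ℂ) ^ 2 * frequencyPairing lam Φ t) * Complex.I_sq

/-- A locally integrable function whose image under `fiberBessel` is the Szegő kernel. -/
def szegoPotential (lam : Fin n → ℝ) (p : H n × H n) : ℂ :=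
  (1 / (2 * Real.pi) : ℂ) * ∫ t : ℝ, (((1 + t ^ 2)⁻¹ : ℝ) : ℂ) * frequencyKernel lam t p

theorem measurable_besselWeight : Measurable fun t : ℝ => (((1 + t ^ 2)⁻¹ : ℝ) : ℂ) := by fun_prop

theorem integrable_besselWeight : Integrable fun t : ℝ => (((1 + t ^ 2)⁻¹ : ℝ) : ℂ) :=
  integrable_inv_one_add_sq.ofReal

theorem locallyIntegrable_szegoPotential (hlam : ∀ j, 0 < lam j) :
    LocallyIntegrable (szegoPotential lam) ((muH n).prod (muH n)) := by
  rw [MeasureTheory.locallyIntegrable_iff]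
  intro K hK
  have h := (integrable_mul_frequencyKernel_mul hlam integrable_besselWeight
    measurable_besselWeight (Ψ := K.indicator fun _ => 1) (M := 1)
    (measurable_const.indicator hK.measurableSet) (fun p => by
      by_cases hp : p ∈ K <;> simp [hp]) hK (fun p hp => by simp [hp])).integral_prod_left
  rw [← integrable_indicator_iff hK.measurableSet]
  refine (h.const_mul (1 / (2 * Real.pi) : ℂ)).congr (ae_of_all _ fun p => ?_)
  by_cases hp : p ∈ K <;> simp [hp, szegoPotential]

/-- The Szegő kernel, as a distribution. -/
def szegoDistribution (lam : Fin n → ℝ) :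
    𝓓'((⊤ : TopologicalSpace.Opens (H n × H n)), ℂ) :=
  (TestFunction.integralAgainstBilinCLM (ContinuousLinearMap.lsmul ℝ ℝ : ℝ →L[ℝ] ℂ →L[ℝ] ℂ)
    ((muH n).prod (muH n)) (szegoPotential lam)).comp (fiberBessel n)

/-- The pairing is `(1 + t²)⁻¹` times the pairing with the Bessel image of the test function, and
the latter weighted integral converges absolutely. -/
theorem integrable_frequencyPairing (hlam : ∀ j, 0 < lam j) (Φ : TestFun n) :
    Integrable (frequencyPairing lam Φ) := by
  have h := (integrable_mul_frequencyKernel_mul_testFun hlam integrable_besselWeight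
    measurable_besselWeight (fiberBessel n Φ)).integral_prod_right
  refine h.congr (ae_of_all _ fun t => ?_)
  have h0 : ((1 + t ^ 2 : ℝ) : ℂ) ≠ 0 := by
    exact_mod_cast (by positivity : (1 + t ^ 2 : ℝ) ≠ 0)
  have := frequencyPairing_fiberBessel hlam Φ t
  rw [frequencyPairing] at this
  simp only [integral_const_mul]
  rw [this, Complex.ofReal_inv, inv_mul_cancel_left₀ h0]

/-- Fubini for the potential; the factor from the Bessel operator cancels the weight `(1 + t²)⁻¹`.
-/
theorem szegoDistribution_apply (hlam : ∀ j, 0 < lam j) (Φ : TestFun n) :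
    szegoDistribution lam Φ = (1 / (2 * Real.pi) : ℂ) * ∫ t, frequencyPairing lam Φ t := by
  have hi := integrable_mul_frequencyKernel_mul_testFun hlam integrable_besselWeight
    measurable_besselWeight (fiberBessel n Φ)
  have e1 : szegoDistribution lam Φ =
      ∫ p, (fiberBessel n Φ p) • szegoPotential lam p ∂((muH n).prod (muH n)) :=
    TestFunction.integralAgainstBilinCLM_eq_integral
      ((locallyIntegrable_szegoPotential hlam).locallyIntegrableOn _)
  rw [e1]
  calc _ = ∫ p, (1 / (2 * Real.pi) : ℂ) * (∫ t : ℝ, (((1 + t ^ 2)⁻¹ : ℝ) : ℂ) *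
          (frequencyKernel lam t p * (fiberBessel n Φ p : ℂ))) ∂((muH n).prod (muH n)) := by
        refine integral_congr_ae (ae_of_all _ fun p => ?_)
        simp only [szegoPotential, Complex.real_smul, ← mul_assoc, integral_mul_const]
        ring
    _ = (1 / (2 * Real.pi) : ℂ) * ∫ t : ℝ, ∫ p, (((1 + t ^ 2)⁻¹ : ℝ) : ℂ) *
          (frequencyKernel lam t p * (fiberBessel n Φ p : ℂ)) ∂((muH n).prod (muH n)) := by
        rw [integral_const_mul, integral_integral_swap hi]
    _ = _ := by
        congr 1
        refine integral_congr_ae (ae_of_all _ fun t => ?_)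
        have h0 : ((1 + t ^ 2 : ℝ) : ℂ) ≠ 0 := by
          exact_mod_cast (by positivity : (1 + t ^ 2 : ℝ) ≠ 0)
        have := frequencyPairing_fiberBessel hlam Φ t
        rw [frequencyPairing] at this
        simp only [integral_const_mul]
        rw [this, Complex.ofReal_inv, inv_mul_cancel_left₀ h0]

/-- After Fubini the truncation is a bounded factor `χ(εt)` tending to `1`, in front of an
integrable function of `t`: dominated convergence applies. -/
theorem isOscillatoryIntegral_szegoDistribution (hlam : ∀ j, 0 < lam j) {χ : ℝ → ℝ}
    (hχ : IsCutoff χ) : IsOscillatoryIntegral χ (modelKernel lam) (szegoDistribution lam) := by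
  intro Φ
  obtain ⟨C, -, hC⟩ := hχ.exists_bound
  have hχc := hχ.1.continuous
  have hχs : HasCompactSupport χ := by
    refine HasCompactSupport.intro (isCompact_Icc (a := (-2 : ℝ)) (b := 2)) fun x hx => hχ.2.2 x ?_
    by_contra h
    exact hx (by simpa [abs_le] using not_lt.1 h)
  have e : ∀ ε : ℝ, 0 < ε → ∫ p : H n × H n,
      truncatedKernel χ (modelKernel lam) ε p.1 p.2 * (Φ p : ℂ) ∂((muH n).prod (muH n)) =
      (1 / (2 * Real.pi) : ℂ) * ∫ t : ℝ, (χ (ε * t) : ℂ) * frequencyPairing lam Φ t := by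
    intro ε hε
    have hw : Integrable fun t : ℝ => (χ (ε * t) : ℂ) :=
      ((hχc.integrable_of_hasCompactSupport hχs).comp_mul_left' hε.ne').ofReal
    have hwm : Measurable fun t : ℝ => (χ (ε * t) : ℂ) := by
      have := hχc.measurable
      fun_prop
    have hi := integrable_mul_frequencyKernel_mul_testFun hlam hw hwm Φ
    calc _ = ∫ p, (1 / (2 * Real.pi) : ℂ) * (∫ t : ℝ, (χ (ε * t) : ℂ) *
          (frequencyKernel lam t p * (Φ p : ℂ))) ∂((muH n).prod (muH n)) := by
          refine integral_congr_ae (ae_of_all _ fun p => ?_)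
          simp only [truncatedKernel, frequencyKernel, ← mul_assoc, integral_mul_const]
      _ = _ := by
          rw [integral_const_mul, integral_integral_swap hi]
          simp only [integral_const_mul, frequencyPairing]
  rw [szegoDistribution_apply hlam]
  refine Tendsto.congr' (f₁ := fun ε : ℝ => (1 / (2 * Real.pi) : ℂ) *
    ∫ t : ℝ, (χ (ε * t) : ℂ) * frequencyPairing lam Φ t) ?_ (Tendsto.const_mul _ ?_)
  · filter_upwards [self_mem_nhdsWithin] with ε hε using (e ε hε).symm
  have hJ := integrable_frequencyPairing hlam Φ
  refine tendsto_integral_filter_of_dominated_convergence (fun t => C * ‖frequencyPairing lam Φ t‖)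
    (Eventually.of_forall fun ε => ?_) (Eventually.of_forall fun ε => ae_of_all _ fun t => ?_)
    (hJ.norm.const_mul C) (ae_of_all _ fun t => ?_)
  · exact (Continuous.aestronglyMeasurable (by fun_prop)).mul hJ.1
  · rw [norm_mul, Complex.norm_real]
    gcongr
    exact hC _
  · have h1 : Tendsto (fun ε : ℝ => (χ (ε * t) : ℂ)) (𝓝 0) (𝓝 (χ (0 * t) : ℂ)) :=
      Continuous.tendsto (by fun_prop) 0
    rw [zero_mul, hχ.2.1 0 (by simp)] at h1
    simpa using (h1.mono_left nhdsWithin_le_nhds).mul_const (frequencyPairing lam Φ t)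

end OscillatoryIntegral

/-! ### The distribution kernel of the Szegő projection. -/

section DistributionKernel

variable {n : ℕ} {lam : Fin n → ℝ}

theorem fiberIntegral_ae_eq {K : ℝ → Cn n → Cn n → ℂ} (hK : IsSchurKernel K) {a b : H n → ℂ}
    (ha : StronglyMeasurable a) (hb : StronglyMeasurable b) (hab : a =ᵐ[muH n] b) :
    fiberIntegral K a =ᵐ[muH n] fiberIntegral K b := by
  have h : ∀ᵐ t : ℝ, ∀ᵐ w ∂(muC n), a (w, t) = b (w, t) :=
    (Measure.ae_ae_comm (p := fun w t => a (w, t) = b (w, t))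
      (measurableSet_eq_fun ha.measurable hb.measurable)).1
      (Measure.ae_ae_of_ae_prod hab)
  have hms : MeasurableSet {x : H n | fiberIntegral K a x = fiberIntegral K b x} :=
    measurableSet_eq_fun (stronglyMeasurable_fiberIntegral hK ha).measurable
      (stronglyMeasurable_fiberIntegral hK hb).measurable
  refine (Measure.ae_prod_iff_ae_ae hms).2 ((Measure.ae_ae_comm hms).2 ?_)
  filter_upwards [h] with t ht
  refine ae_of_all _ fun z => integral_congr_ae ?_
  filter_upwards [ht] with w hw
  rw [hw]

/-- On elementary tensors, the pairing with a frequency component is computed by partial Fourier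
transforms. -/
theorem integral_frequencyKernel_mul_tensor (hlam : ∀ j, 0 < lam j) {u v : H n → ℂ}
    (hu : Integrable u (muH n)) (hv : Integrable v (muH n)) (t : ℝ) :
    ∫ p, frequencyKernel lam t p * (v p.1 * u p.2) ∂((muH n).prod (muH n)) =
      ∫ z, fiberIntegral (modelKernel lam) (partialFourier 1 u) (z, t) *
        partialFourier (-1) v (z, t) ∂(muC n) := by
  have hi := integrable_frequencyKernel_mul hlam t (hv.mul_prod hu)
  have hK := isSchurKernel_modelKernel hlam
  have hinner : ∀ x : H n, ∫ y, frequencyKernel lam t (x, y) * (v x * u y) ∂(muH n) =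
      fiberIntegral (modelKernel lam) (partialFourier 1 u) (x.1, t) *
        (v x * Complex.exp ((-1 * x.2 * t : ℝ) * Complex.I)) := by
    intro x
    have hg : Integrable (fun y : H n => modelKernel lam t x.1 y.1 *
        (u y * Complex.exp ((1 * y.2 * t : ℝ) * Complex.I))) ((muC n).prod volume) := by
      refine Integrable.bdd_mul (c := |diagConst lam t|) ?_
        ((hK.measurable_slice t x.1).comp measurable_fst).aestronglyMeasurable
        (ae_of_all _ fun y => norm_modelKernel_le hlam t _ _)
      refine hu.mul_bdd (c := 1) (Continuous.aestronglyMeasurable (by fun_prop))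
        (ae_of_all _ fun y => (Complex.norm_exp_ofReal_mul_I _).le)
    have e : ∀ y, frequencyKernel lam t (x, y) * (v x * u y) =
        (modelKernel lam t x.1 y.1 * (u y * Complex.exp ((1 * y.2 * t : ℝ) * Complex.I))) *
          (v x * Complex.exp ((-1 * x.2 * t : ℝ) * Complex.I)) := by
      intro y
      have : Complex.exp (-(Complex.I * t * (x.2 - y.2))) =
          Complex.exp ((1 * y.2 * t : ℝ) * Complex.I) *
            Complex.exp ((-1 * x.2 * t : ℝ) * Complex.I) := by
        rw [← Complex.exp_add]
        congr 1
        push_cast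
        ring
      simp only [frequencyKernel, this]
      ring
    simp only [e]
    rw [integral_mul_const]
    congr 1
    refine (integral_prod _ hg).trans ?_
    simp only [fiberIntegral, partialFourier, integral_const_mul]
  rw [integral_prod _ hi]
  simp only [hinner]
  have hi' : Integrable (fun x : H n => fiberIntegral (modelKernel lam) (partialFourier 1 u)
      (x.1, t) * (v x * Complex.exp ((-1 * x.2 * t : ℝ) * Complex.I))) ((muC n).prod volume) :=
    hi.integral_prod_left.congr (ae_of_all _ hinner)
  refine (integral_prod _ hi').trans ?_
  simp only [partialFourier, integral_const_mul]

theorem isDistributionKernel_szegoDistribution (hn : 1 ≤ n) (hlam : ∀ j, 0 < lam j) {χ : ℝ → ℝ}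
    (hχ : IsCutoff χ) : IsDistributionKernel (szego lam) (szegoDistribution lam) := by
  intro u v f Φ hf hΦ
  have hK := isSchurKernel_modelKernel hlam
  have hpi : (2 * Real.pi : ℂ) ≠ 0 := by exact_mod_cast Real.two_pi_pos.ne'
  set u' : H n → ℂ := fun x => (u x : ℂ) with hu'
  set v' : H n → ℂ := fun x => (v x : ℂ) with hv'
  have huc : Continuous u' := Complex.continuous_ofReal.comp u.continuous
  have hvc : Continuous v' := Complex.continuous_ofReal.comp v.continuous
  have hus : HasCompactSupport u' := u.hasCompactSupport.comp_left Complex.ofReal_zero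
  have hvs : HasCompactSupport v' := v.hasCompactSupport.comp_left Complex.ofReal_zero
  have hum : StronglyMeasurable u' := huc.stronglyMeasurable
  have hvm : StronglyMeasurable v' := hvc.stronglyMeasurable
  have hv2 : MemLp v' 2 (muH n) := hvc.memLp_of_hasCompactSupport hvs
  obtain ⟨Ru, hRu⟩ := exists_bound_snd hus
  obtain ⟨Rv, hRv⟩ := exists_bound_snd hvs
  set V : L2 n := hv2.toLp v' with hV
  have hVv : V =ᵐ[muH n] v' := hv2.coeFn_toLp
  obtain ⟨A, hA⟩ := exists_hasPartialFourier (μ := muC n) hχ (σ := 1) abs_one f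
  obtain ⟨W, hW⟩ := exists_hasPartialFourier (μ := muC n) hχ (σ := -1) (by simp) V
  obtain ⟨b, hb⟩ := exists_isFiberwiseIntegral hK ((2 * Real.pi : ℂ)⁻¹ • A)
  obtain ⟨h, hh⟩ := exists_hasPartialFourier (μ := muC n) hχ (σ := -1) (by simp) b
  have hAu : A =ᵐ[muH n] partialFourier 1 u' := hA.ae_eq hχ abs_one hum hf hRu
  have hWv : W =ᵐ[muH n] partialFourier (-1) v' := hW.ae_eq hχ (by simp) hvm hVv hRv
  have key : h = szego lam f := by
    refine eq_szego_of_isFourierConjugate hn hlam hχ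
      ⟨_, b, isPartialFourierInv_iff.2 ?_, hb, isPartialFourier_iff.2 hh⟩
    exact (smul_inv_smul₀ hpi A).symm ▸ hA
  have hbu : b =ᵐ[muH n] fun x => (2 * Real.pi : ℂ)⁻¹ *
      fiberIntegral (modelKernel lam) (partialFourier 1 u') x := by
    have h1 : (((2 * Real.pi : ℂ)⁻¹ • A : L2 n) : H n → ℂ) =ᵐ[muH n]
        fun x => (2 * Real.pi : ℂ)⁻¹ * partialFourier 1 u' x := by
      filter_upwards [Lp.coeFn_smul (2 * Real.pi : ℂ)⁻¹ (A : L2 n), hAu] with x h1 h2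
      rw [h1, Pi.smul_apply, smul_eq_mul, h2]
    refine hb.ae_eq.trans ((fiberIntegral_ae_eq hK (Lp.stronglyMeasurable _)
      ((stronglyMeasurable_partialFourier 1 hum).const_mul _) h1).trans (ae_of_all _ fun x => ?_))
    simp only [fiberIntegral, ← integral_const_mul]
    refine integral_congr_ae (ae_of_all _ fun w => ?_)
    ring
  have hbW : (fun x => b x * W x) =ᵐ[muH n] fun x => (2 * Real.pi : ℂ)⁻¹ *
      (fiberIntegral (modelKernel lam) (partialFourier 1 u') x * partialFourier (-1) v' x) := by
    filter_upwards [hbu, hWv] with x h1 h2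
    rw [h1, h2, mul_assoc]
  have hint : Integrable (fun x => (2 * Real.pi : ℂ)⁻¹ *
      (fiberIntegral (modelKernel lam) (partialFourier 1 u') x * partialFourier (-1) v' x))
      ((muC n).prod volume) :=
    ((Lp.memLp b).integrable_mul (Lp.memLp W) : Integrable (fun x => b x * W x) (muH n)).congr hbW
  have huv : ∀ t, frequencyPairing lam Φ t = ∫ z, fiberIntegral (modelKernel lam)
      (partialFourier 1 u') (z, t) * partialFourier (-1) v' (z, t) ∂(muC n) := by
    intro t
    rw [← integral_frequencyKernel_mul_tensor hlam (huc.integrable_of_hasCompactSupport hus)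
      (hvc.integrable_of_hasCompactSupport hvs), frequencyPairing]
    refine integral_congr_ae (ae_of_all _ fun p => ?_)
    simp only [hu', hv', ← Complex.ofReal_mul, ← hΦ]
  -- On a tensor the frequency integral becomes the pairing of the fiberwise projection `b` of the
  -- transform of `u` with the transform `W` of `v`. Bilinear symmetry of the partial transform
  -- moves it from `V` back to `b`, which produces the Szegő projection of `f`.
  calc szegoDistribution lam Φ = (2 * Real.pi : ℂ)⁻¹ * ∫ t, frequencyPairing lam Φ t := by
        rw [szegoDistribution_apply hlam, one_div]
    _ = ∫ x, b x * W x ∂(muH n) := by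
        refine Eq.trans ?_ (integral_congr_ae hbW).symm
        refine Eq.trans ?_ (integral_prod_symm _ hint).symm
        simp only [integral_const_mul, huv]
    _ = ∫ x, h x * V x ∂(muH n) := (hh.integral_mul hχ (by simp) hW).symm
    _ = ∫ x, szego lam f x * v' x ∂(muH n) := by
        refine integral_congr_ae ?_
        filter_upwards [hVv] with x hx
        rw [hx, ← key]
        rfl

end DistributionKernel

end Heisenberg

end

theorem theorem7p5 (n : ℕ) (hn : 1 ≤ n) (lam : Fin n → ℝ) (hlam : ∀ j, 0 < lam j)
    (χ : ℝ → ℝ) (hχ : Heisenberg.IsCutoff χ)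
    (ι : ℝ → Type*)
    (s : ∀ t : ℝ, HilbertBasis (ι t) ℂ
      (Heisenberg.bergmanSpace (fun z : Heisenberg.Cn n => t * Heisenberg.psi lam z))) :
    (∀ u h : Heisenberg.L2 n,
      Heisenberg.IsFourierConjugate χ (fun t => Heisenberg.bergmanKernel (s t)) u h ↔
        h = Heisenberg.szego lam u) ∧
    ∃ K : 𝓓'((⊤ : TopologicalSpace.Opens (Heisenberg.H n × Heisenberg.H n)), ℂ),
      Heisenberg.IsDistributionKernel (Heisenberg.szego lam) K ∧
      Heisenberg.IsOscillatoryIntegral χ (fun t => Heisenberg.bergmanKernel (s t)) K := by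
  -- The closed form removes the dependence on the bases, chosen separately for each `t`, and with
  -- it any question of measurability in `t`.
  have hP : (fun t => Heisenberg.bergmanKernel (s t)) = Heisenberg.modelKernel lam := by
    funext t z w
    exact Heisenberg.bergmanKernel_eq_modelKernel hn hlam (s t) z w
  rw [hP]
  exact ⟨Heisenberg.isFourierConjugate_iff hn hlam hχ, Heisenberg.szegoDistribution lam,
    Heisenberg.isDistributionKernel_szegoDistribution hn hlam hχ,
    Heisenberg.isOscillatoryIntegral_szegoDistribution hlam hχ⟩
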